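/- **Theorem (convergence of Scaffold-P with partial participation).** *Problem.* Let $n\ge 1$, let $\mathcal D_1,\dots,\mathcal D_n$ be probability distributions on a data space, let $F(u,v;\xi)$ be a sample loss with $u\in\mathbb R^{d_u}$, $v\in\mathbb R^{d_v}$, and put $$f_i(u,v_i)=\mathbb E_{\xi\sim\mathcal D_i}[F(u,v_i;\xi)],\qquad f(u,\mathbf v)=\frac1n\sum_{i=1}^n f_i(u,v_i),\qquad \mathbf v=(v_1,\dots,v_n),$$ where these expectations exist, $F(\cdot,\cdot;\xi)$ has partial gradients at every point for $\mathcal D_i$-almost every $\xi$, these partial gradients are measurable, and $f$ is bounded below. *Assumptions.* (i) Smoothness: each $f_i$ is differentiable in $u$ and in $v$; $\nabla_u f_i$ is $L_u$-Lipschitz in $u$ and $L_{uv}$-Lipschitz in $v$; $\nabla_v f_i$ is $L_v$-Lipschitz in $v$ and $L_{vu}$-Lipschitz in $u$. Put $L=\max\{L_u,L_v,L_{uv},L_{vu}\}$. (ii) Stochastic gradients: for all $i,u,v$ and $\xi\sim\mathcal D_i$, $\mathbb E[\nabla_uF(u,v;\xi)]=\nabla_uf_i(u,v)$, $\mathbb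 E[\nabla_vF(u,v;\xi)]=\nabla_vf_i(u,v)$, $\mathbb E\|\nabla_uF(u,v;\xi)-\nabla_uf_i(u,v)\|^2\le\sigma_u^2$ and $\mathbb E\|\nabla_vF(u,v;\xi)-\nabla_vf_i(u,v)\|^2\le\sigma_v^2$. No bound on the heterogeneity of the clients is assumed. *Algorithm (Scaffold-P).* Let $T,K\ge1$, $1\le m\le n$, with inner step sizes $\gamma_u,\gamma_v>0$ and outer step sizes $\eta_u,\eta_v$. Samples $\xi^t_{i,k}\sim\mathcal D_i$ ($-1\le t\le T-1$, $1\le i\le n$, $0\le k\le K-1$) and client sets $\mathcal S^t$ ($0\le t\le T-1$), uniformly distributed among the $m$-element subsets of $\{1,\dots,n\}$, are all mutually independent. Given deterministic $u^0,\mathbf v^0$, set $c_i^0=\frac1K\sum_{k}\nabla_uF(u^0,v_i^0;\xi^{-1}_{i,k})$ and $c^0=\frac1n\sum_ic_i^0$. In round $t=0,\dots,T-1$, each client $i\in\mathcal S^t$ starts from $u^t_{i,0}=u^t$, $v^t_{i,0}=v^t_i$ and performs, for $k=0,\dots,K-1$, $$u^t_{i,k+1}=u^t_{i,k}-\gamma_u\big(\nabla_uF(u^t_{i,k},v^t_{i,k};\xi^t_{i,k})-c_i^t+c^t\big),\qquad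 v^t_{i,k+1}=v^t_{i,k}-\gamma_v\nabla_vF(u^t_{i,k},v^t_{i,k};\xi^t_{i,k});$$ then $v_i^{t+1}=(1-\eta_v)v_i^t+\eta_vv^t_{i,K}$ and $c_i^{t+1}=c_i^t-c^t+\frac1{K\gamma_u}(u^t-u^t_{i,K})$ for $i\in\mathcal S^t$, while $v_i^{t+1}=v_i^t$ and $c_i^{t+1}=c_i^t$ for $i\notin\mathcal S^t$. Finally $$u^{t+1}=(1-\eta_u)u^t+\frac{\eta_u}m\sum_{i\in\mathcal S^t}u^t_{i,K},\qquad c^{t+1}=c^t+\frac1n\sum_{i\in\mathcal S^t}(c_i^{t+1}-c_i^t).$$ *Claim.* Suppose $\gamma_u\eta_u=\gamma_v\eta_v=:\gamma$, $\eta_u\ge\sqrt m$, $\eta_v\ge\sqrt{n/m}$ and $\gamma\le\frac1{72LK}\min\big(\frac m{n^{2/3}},1\big)$ (no restriction on $\gamma$ if $L=0$). Put $F_0=f(u^0,\mathbf v^0)-\inf f$ and $$\mathcal G_u^t=\mathbb E\|\nabla_uf(u^t,\mathbf v^t)\|^2,\qquad\hat{\mathcal G}_{\mathbf v}^t=\frac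 m{n^2}\sum_{i=1}^n\mathbb E\|\nabla_vf_i(u^t,v_i^t)\|^2.$$ Then all these expectations are finite for $0\le t\le T-1$ and $$\frac1T\sum_{t=0}^{T-1}\big(\mathcal G_u^t+\hat{\mathcal G}_{\mathbf v}^t\big)\le\frac{4F_0}{TK\gamma}+148\Big(\frac{\sigma_u^2}m+\frac{m\sigma_v^2}n\Big)L\gamma .$$ -/

import Mathlib

open MeasureTheory ProbabilityTheory
open scoped NNReal

noncomputable section

namespace ScaffoldP

/-- The Euclidean space `ℝ^d`. -/
abbrev Vec (d : ℕ) := EuclideanSpace ℝ (Fin d)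

/-! ### Partial gradients and the objective -/

/-- Partial gradient `∇_u h(u, v)` with respect to the first variable. -/
def gradU {du : ℕ} {V : Type*} (h : Vec du → V → ℝ) (u : Vec du) (v : V) : Vec du :=
  gradient (fun u' => h u' v) u

/-- Partial gradient `∇_v h(u, v)` with respect to the second variable. -/
def gradV {dv : ℕ} {U : Type*} (h : U → Vec dv → ℝ) (u : U) (v : Vec dv) : Vec dv :=
  gradient (fun v' => h u v') v

/-- The loss of client `i`, `f_i(u, v_i) = 𝔼_{ξ ∼ D_i} F(u, v_i; ξ)`. -/
def localLoss {n du dv : ℕ} {Ξ : Type*} [MeasurableSpace Ξ]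
    (F : Vec du → Vec dv → Ξ → ℝ) (D : Fin n → Measure Ξ) (i : Fin n)
    (u : Vec du) (v : Vec dv) : ℝ :=
  ∫ x, F u v x ∂(D i)

/-- The objective `f(u, 𝐯) = (1/n) ∑ᵢ f_i(u, v_i)`. -/
def globalLoss {n du dv : ℕ} {Ξ : Type*} [MeasurableSpace Ξ]
    (F : Vec du → Vec dv → Ξ → ℝ) (D : Fin n → Measure Ξ)
    (u : Vec du) (v : Fin n → Vec dv) : ℝ :=
  (1 / (n : ℝ)) * ∑ i, localLoss F D i u (v i)

/-- The initial gap `F₀ = f(u⁰, 𝐯⁰) - inf f`. -/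
def initialGap {n du dv : ℕ} {Ξ : Type*} [MeasurableSpace Ξ]
    (F : Vec du → Vec dv → Ξ → ℝ) (D : Fin n → Measure Ξ)
    (u₀ : Vec du) (v₀ : Fin n → Vec dv) : ℝ :=
  globalLoss F D u₀ v₀ - ⨅ p : Vec du × (Fin n → Vec dv), globalLoss F D p.1 p.2

/-! ### Assumptions on the problem -/

/-- Smoothness: every `f_i` is differentiable in `u` and in `v`, and the partial gradients are
Lipschitz in each variable separately. -/
structure Smooth {n du dv : ℕ} (f : Fin n → Vec du → Vec dv → ℝ) (Lu Luv Lv Lvu : ℝ≥0) :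
    Prop where
  differentiable_u : ∀ i v, Differentiable ℝ (fun u => f i u v)
  differentiable_v : ∀ i u, Differentiable ℝ (fun v => f i u v)
  lipschitz_u_u : ∀ i v, LipschitzWith Lu (fun u => gradU (f i) u v)
  lipschitz_u_v : ∀ i u, LipschitzWith Luv (fun v => gradU (f i) u v)
  lipschitz_v_v : ∀ i u, LipschitzWith Lv (fun v => gradV (f i) u v)
  lipschitz_v_u : ∀ i v, LipschitzWith Lvu (fun u => gradV (f i) u v)

/-- Stochastic gradient `∇_u F(u, v; x)`. -/
def stochGradU {du dv : ℕ} {Ξ : Type*} (F : Vec du → Vec dv → Ξ → ℝ)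
    (u : Vec du) (v : Vec dv) (x : Ξ) : Vec du :=
  gradU (fun u' v' => F u' v' x) u v

/-- Stochastic gradient `∇_v F(u, v; x)`. -/
def stochGradV {du dv : ℕ} {Ξ : Type*} (F : Vec du → Vec dv → Ξ → ℝ)
    (u : Vec du) (v : Vec dv) (x : Ξ) : Vec dv :=
  gradV (fun u' v' => F u' v' x) u v

/-- The sample loss is a well-posed random objective: `f_i` is a genuine expectation, `F(·, ·; x)`
has partial gradients at each point for `D_i`-almost every `x`, and these are measurable. -/
structure WellPosed {n du dv : ℕ} {Ξ : Type*} [MeasurableSpace Ξ]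
    (F : Vec du → Vec dv → Ξ → ℝ) (D : Fin n → Measure Ξ) : Prop where
  integrable : ∀ i u v, Integrable (F u v) (D i)
  differentiable_u : ∀ i u v, ∀ᵐ x ∂(D i), DifferentiableAt ℝ (fun u' => F u' v x) u
  differentiable_v : ∀ i u v, ∀ᵐ x ∂(D i), DifferentiableAt ℝ (fun v' => F u v' x) v
  measurable_u : Measurable (fun p : Vec du × Vec dv × Ξ => stochGradU F p.1 p.2.1 p.2.2)
  measurable_v : Measurable (fun p : Vec du × Vec dv × Ξ => stochGradV F p.1 p.2.1 p.2.2)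

/-- Stochastic gradients are unbiased with variances at most `σu ^ 2` and `σv ^ 2`. -/
structure StochasticGradient {n du dv : ℕ} {Ξ : Type*} [MeasurableSpace Ξ]
    (F : Vec du → Vec dv → Ξ → ℝ) (D : Fin n → Measure Ξ) (σu σv : ℝ) : Prop where
  integrable_u : ∀ i u v, Integrable (stochGradU F u v) (D i)
  integrable_v : ∀ i u v, Integrable (stochGradV F u v) (D i)
  unbiased_u : ∀ i u v, ∫ x, stochGradU F u v x ∂(D i) = gradU (localLoss F D i) u v
  unbiased_v : ∀ i u v, ∫ x, stochGradV F u v x ∂(D i) = gradV (localLoss F D i) u v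
  integrable_sq_u : ∀ i u v,
    Integrable (fun x => ‖stochGradU F u v x - gradU (localLoss F D i) u v‖ ^ 2) (D i)
  integrable_sq_v : ∀ i u v,
    Integrable (fun x => ‖stochGradV F u v x - gradV (localLoss F D i) u v‖ ^ 2) (D i)
  variance_u : ∀ i u v,
    ∫ x, ‖stochGradU F u v x - gradU (localLoss F D i) u v‖ ^ 2 ∂(D i) ≤ σu ^ 2
  variance_v : ∀ i u v,
    ∫ x, ‖stochGradV F u v x - gradV (localLoss F D i) u v‖ ^ 2 ∂(D i) ≤ σv ^ 2

/-! ### The algorithm -/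

/-- Variables held at the beginning of a round: shared variable `u`, personal variables `v i`,
client control variables `ci i`, server control variable `c`. -/
structure State (n du dv : ℕ) where
  u : Vec du
  v : Fin n → Vec dv
  ci : Fin n → Vec du
  c : Vec du

/-- The numerical parameters of the algorithm: number `K` of local steps, number `m` of sampled
clients, inner step sizes `γu, γv`, outer step sizes `ηu, ηv`. -/
structure Params where
  K : ℕ
  m : ℕ
  γu : ℝ
  γv : ℝ
  ηu : ℝ
  ηv : ℝ

section Algorithm

variable {n du dv : ℕ} {Ξ : Type*}

/-- Local iterates `(u_{i,k}, v_{i,k})` of one client within one round, started at `(u, v)`, with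
control variables `ci, c` and with the sample `x k` used in local step `k`. -/
def localIter (F : Vec du → Vec dv → Ξ → ℝ) (P : Params) (ci c : Vec du)
    (u : Vec du) (v : Vec dv) (x : ℕ → Ξ) : ℕ → Vec du × Vec dv
  | 0 => (u, v)
  | k + 1 =>
    let p := localIter F P ci c u v x k
    (p.1 - P.γu • (stochGradU F p.1 p.2 (x k) - ci + c),
      p.2 - P.γv • stochGradV F p.1 p.2 (x k))

/-- Initialization: `c_i⁰ = (1/K) ∑ₖ ∇_u F(u⁰, v_i⁰; x_{i,k})`, `c⁰ = (1/n) ∑ᵢ c_i⁰`. -/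
def initState (F : Vec du → Vec dv → Ξ → ℝ) (P : Params) (u₀ : Vec du) (v₀ : Fin n → Vec dv)
    (x : Fin n → ℕ → Ξ) : State n du dv :=
  let ci₀ : Fin n → Vec du := fun i =>
    (1 / (P.K : ℝ)) • ∑ k ∈ Finset.range P.K, stochGradU F u₀ (v₀ i) (x i k)
  { u := u₀
    v := v₀
    ci := ci₀
    c := (1 / (n : ℝ)) • ∑ i, ci₀ i }

/-- One communication round, with sampled clients `A` and data samples `x i k`. Clients outside `A`
keep their personal and control variables. -/
def round (F : Vec du → Vec dv → Ξ → ℝ) (P : Params) (A : Finset (Fin n)) (x : Fin n → ℕ → Ξ)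
    (s : State n du dv) : State n du dv :=
  let out : Fin n → Vec du × Vec dv := fun i =>
    localIter F P (s.ci i) s.c s.u (s.v i) (x i) P.K
  let ci' : Fin n → Vec du := fun i =>
    if i ∈ A then s.ci i - s.c + (1 / ((P.K : ℝ) * P.γu)) • (s.u - (out i).1) else s.ci i
  { u := (1 - P.ηu) • s.u + (P.ηu / (P.m : ℝ)) • ∑ i ∈ A, (out i).1
    v := fun i => if i ∈ A then (1 - P.ηv) • s.v i + P.ηv • (out i).2 else s.v i
    ci := ci'
    c := s.c + (1 / (n : ℝ)) • ∑ i ∈ A, (ci' i - s.ci i) }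

/-- The state at the beginning of round `t`. The samples `x 0` are used only for the initial
control variables, and round `t` uses the samples `x (t + 1)` and the client set `A t`. -/
def run (F : Vec du → Vec dv → Ξ → ℝ) (P : Params) (u₀ : Vec du) (v₀ : Fin n → Vec dv)
    (x : ℕ → Fin n → ℕ → Ξ) (A : ℕ → Finset (Fin n)) : ℕ → State n du dv
  | 0 => initState F P u₀ v₀ (x 0)
  | t + 1 => round F P (A t) (x (t + 1)) (run F P u₀ v₀ x A t)

end Algorithm

/-! ### Randomness and the measured quantities -/

/-- The randomness of the first `T` rounds: data samples `ξ t i k ∼ D i` (`t = 0` is the batch for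
the initial control variables, `t + 1` belongs to round `t`), client sets `S t` uniform among
the subsets of size `m`, all of them mutually independent. -/
structure Sampling {n : ℕ} {Ω Ξ : Type*} [MeasurableSpace Ω] [MeasurableSpace Ξ]
    (μ : Measure Ω) (D : Fin n → Measure Ξ) (m K T : ℕ)
    (ξ : ℕ → Fin n → ℕ → Ω → Ξ) (S : ℕ → Ω → Finset (Fin n)) : Prop where
  measurable_ξ : ∀ t ≤ T, ∀ i, ∀ k < K, Measurable (ξ t i k)
  measurable_S : ∀ t < T, Measurable (S t)
  law_ξ : ∀ t ≤ T, ∀ i, ∀ k < K, μ.map (ξ t i k) = D i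
  law_S : ∀ t < T, μ.map (S t) = uniformOn {A : Finset (Fin n) | A.card = m}
  indep_ξ : iIndepFun (fun (j : Fin (T + 1) × Fin n × Fin K) => ξ j.1 j.2.1 j.2.2) μ
  indep_S : iIndepFun (fun (t : Fin T) => S t) μ
  indep_ξ_S : IndepFun (fun ω (j : Fin (T + 1) × Fin n × Fin K) => ξ j.1 j.2.1 j.2.2 ω)
    (fun ω (t : Fin T) => S t ω) μ

/-- The random state at the beginning of round `t`. -/
def process {n du dv : ℕ} {Ω Ξ : Type*} (F : Vec du → Vec dv → Ξ → ℝ) (P : Params)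
    (u₀ : Vec du) (v₀ : Fin n → Vec dv)
    (ξ : ℕ → Fin n → ℕ → Ω → Ξ) (S : ℕ → Ω → Finset (Fin n)) (t : ℕ) (ω : Ω) :
    State n du dv :=
  run F P u₀ v₀ (fun t i k => ξ t i k ω) (fun t => S t ω) t

/-- `‖∇_u f(u, 𝐯)‖²` at a state. -/
def sqGradU {n du dv : ℕ} {Ξ : Type*} [MeasurableSpace Ξ]
    (F : Vec du → Vec dv → Ξ → ℝ) (D : Fin n → Measure Ξ) (s : State n du dv) : ℝ :=
  ‖gradU (globalLoss F D) s.u s.v‖ ^ 2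

/-- `‖∇_{v_i} f_i(u, v_i)‖²` at a state. -/
def sqGradV {n du dv : ℕ} {Ξ : Type*} [MeasurableSpace Ξ]
    (F : Vec du → Vec dv → Ξ → ℝ) (D : Fin n → Measure Ξ) (i : Fin n) (s : State n du dv) : ℝ :=
  ‖gradV (localLoss F D i) s.u (s.v i)‖ ^ 2

end ScaffoldP

end

/-! Write `B = γK`, `θ = LB`, `p = m/n`. In the control update the old corrections cancel: a sampled
client's new `c_i` is the plain average of its stochastic gradients along its local path, that is,
an average of true gradients at the remembered local iterates `M i k` plus averaged noise. The gap
between the current average gradient `a_i` of client `i` and `c_i` is therefore controlled by three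
quantities: the drift `W` of the present local path, the lag `X` (mean squared distance of the
remembered points to the current `(u, v_i)`), and the noise `N` stored in `c_i`. Gradients of
different clients are never compared, which is why no heterogeneity bound is needed. The identity `c
= vmean ci` is preserved, so the corrections do not bias the mean step.

The argument is a descent for the potential `f + λ·lag`. For a fixed state, the descent lemma
averaged over the client set yields `-B/2` times the squared gradients, plus squared step lengths.
Sampling without replacement has variance at most `1/m` times the population variance
(`subsetAvg_norm_sq_le`), and that variance brings in `X`. In return the lag contracts: a sampled
client replaces its remembered points, while for an unsampled one the square is expanded exactly and
its cross term (`exists_subsetAvg_notMem_inner`) is absorbed by Young's inequality at the cost of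
`p/2`, leaving the factor `1 - p/2`. The weight `λ = 30 L³B²n/m²` is chosen so that this contraction
pays for the `X` in the step variance (`progress_le`). The Young constant `4/p`, times `λB²`, is of
order `B θ³n²/m³`; keeping it small is the reason for the restriction `m/n^{2/3}`. The lower bounds
on the outer step sizes give `γu² ≤ γ²/m` and `γv² ≤ pγ²`, so the drift carries the same factors
`1/m` and `m/n` as the final noise term (`ClientRun.mean_drift_le`).

On the probabilistic side, a round is analysed from a frozen state. Noises are orthogonal along
local steps, being martingale differences, and across clients, by independence. The random state,
independent of the data of the round, is inserted by Fubini (`meanLE_step`). Values of `f` along the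
iterates are not known in advance to be integrable; one-round bounds are therefore stated through
integrable majorants (`UpperMean`), and integrability follows because the potential minus `inf f` is
nonnegative. The mean control error never exceeds `σu²/K`. Summing `RoundRun.upperMean_potential`
over the rounds telescopes (`Sampling.sum_progress_le`). -/

noncomputable section

namespace ScaffoldP

/-! ### Averages over the subsets of a given size -/

section SubsetAverage

variable {n : ℕ}

/-- The average of `φ` over the `m`-element subsets of `Fin n`. -/
def subsetAvg (m : ℕ) (φ : Finset (Fin n) → ℝ) : ℝ :=
  (∑ A ∈ Finset.powersetCard m Finset.univ, φ A) / (n.choose m : ℝ)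

variable {m : ℕ}

lemma subsetAvg_add (φ ψ : Finset (Fin n) → ℝ) :
    subsetAvg m (fun A => φ A + ψ A) = subsetAvg m φ + subsetAvg m ψ := by
  simp only [subsetAvg, Finset.sum_add_distrib, add_div]

lemma subsetAvg_sub (φ ψ : Finset (Fin n) → ℝ) :
    subsetAvg m (fun A => φ A - ψ A) = subsetAvg m φ - subsetAvg m ψ := by
  simp only [subsetAvg, Finset.sum_sub_distrib, sub_div]

lemma subsetAvg_mul_left (a : ℝ) (φ : Finset (Fin n) → ℝ) :
    subsetAvg m (fun A => a * φ A) = a * subsetAvg m φ := by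
  simp only [subsetAvg, ← Finset.mul_sum, mul_div_assoc]

lemma subsetAvg_mul_right (a : ℝ) (φ : Finset (Fin n) → ℝ) :
    subsetAvg m (fun A => φ A * a) = subsetAvg m φ * a := by
  simp only [mul_comm _ a, subsetAvg_mul_left]

lemma subsetAvg_sum {ι : Type*} (s : Finset ι) (φ : ι → Finset (Fin n) → ℝ) :
    subsetAvg m (fun A => ∑ j ∈ s, φ j A) = ∑ j ∈ s, subsetAvg m (φ j) := by
  simp only [subsetAvg, Finset.sum_div]
  rw [Finset.sum_comm]

lemma subsetAvg_const (hmn : m ≤ n) (a : ℝ) : subsetAvg (n := n) m (fun _ => a) = a := by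
  have : (n.choose m : ℝ) ≠ 0 := by
    exact_mod_cast (Nat.choose_pos hmn).ne'
  simp [subsetAvg, Finset.card_powersetCard]
  field_simp

lemma subsetAvg_mono {φ ψ : Finset (Fin n) → ℝ}
    (h : ∀ A : Finset (Fin n), A.card = m → φ A ≤ ψ A) :
    subsetAvg m φ ≤ subsetAvg m ψ := by
  unfold subsetAvg
  gcongr with A hA
  exact h A (Finset.mem_powersetCard.1 hA).2

lemma subsetAvg_congr {φ ψ : Finset (Fin n) → ℝ}
    (h : ∀ A : Finset (Fin n), A.card = m → φ A = ψ A) :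
    subsetAvg m φ = subsetAvg m ψ :=
  le_antisymm (subsetAvg_mono fun A hA => (h A hA).le) (subsetAvg_mono fun A hA => (h A hA).ge)

lemma subsetAvg_nonneg {φ : Finset (Fin n) → ℝ} (h : ∀ A, 0 ≤ φ A) : 0 ≤ subsetAvg m φ :=
  div_nonneg (Finset.sum_nonneg fun A _ => h A) (Nat.cast_nonneg _)

/-- The indicator of membership, as a real number. -/
def memInd (A : Finset (Fin n)) (i : Fin n) : ℝ := if i ∈ A then 1 else 0

lemma memInd_mul_self (A : Finset (Fin n)) (i : Fin n) :
    memInd A i * memInd A i = memInd A i := by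
  unfold memInd; split_ifs <;> simp

lemma memInd_nonneg (A : Finset (Fin n)) (i : Fin n) : 0 ≤ memInd A i := by
  unfold memInd; split_ifs <;> simp

lemma memInd_le_one (A : Finset (Fin n)) (i : Fin n) : memInd A i ≤ 1 := by
  unfold memInd; split_ifs <;> simp

lemma sum_mem_eq_sum_memInd {E : Type*} [AddCommGroup E] [Module ℝ E]
    (A : Finset (Fin n)) (y : Fin n → E) :
    ∑ i ∈ A, y i = ∑ i, memInd A i • y i := by
  simp [memInd, ite_smul]

/-- Exactly `(n-1).choose (m-1)` of the `m`-subsets contain a given point, and `n * (n-1).choose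
(m-1) = n.choose m * m`. -/
lemma subsetAvg_memInd (hm : 1 ≤ m) (hmn : m ≤ n) (i : Fin n) :
    subsetAvg m (fun A => memInd A i) = (m : ℝ) / n := by
  have hc : (n.choose m : ℝ) ≠ 0 := by
    exact_mod_cast (Nat.choose_pos hmn).ne'
  have h1 : ∑ A ∈ Finset.powersetCard m (Finset.univ : Finset (Fin n)), memInd A i
      = ((n - 1).choose (m - 1) : ℝ) := by
    have := Finset.card_filter_powersetCard_subset ({i} : Finset (Fin n)) Finset.univ m
      (by simp) (by simpa using hm)
    simp only [Finset.singleton_subset_iff, Finset.card_univ, Fintype.card_fin,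
      Finset.card_singleton] at this
    simp only [memInd, Finset.sum_boole]
    exact_mod_cast this
  have h2 : (n : ℝ) * ((n - 1).choose (m - 1) : ℝ) = n.choose m * m := by
    obtain ⟨m', rfl⟩ : ∃ m', m = m' + 1 := ⟨m - 1, by omega⟩
    obtain ⟨n', rfl⟩ : ∃ n', n = n' + 1 := ⟨n - 1, by omega⟩
    exact_mod_cast Nat.add_one_mul_choose_eq n' m'
  have hn : (n : ℝ) ≠ 0 := by
    have : n ≠ 0 := by omega
    exact_mod_cast this
  rw [subsetAvg, h1]
  field_simp
  linarith

/-- By symmetry all pairs of distinct clients are sampled together with the same frequency `q`. Its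
value is never needed, only that it is common to all pairs and lies between `0` and the frequency of
a single client. -/
lemma exists_subsetAvg_memInd_mul (hm : 1 ≤ m) (hmn : m ≤ n) :
    ∃ q : ℝ, 0 ≤ q ∧ q ≤ (m : ℝ) / n ∧
      ∀ i j : Fin n, i ≠ j → subsetAvg m (fun A => memInd A i * memInd A j) = q := by
  by_cases h : ∃ i j : Fin n, i ≠ j
  · obtain ⟨i₀, j₀, hij₀⟩ := h
    have key : ∀ i j : Fin n, i ≠ j → subsetAvg m (fun A => memInd A i * memInd A j)
        -- The case distinction guards against truncated subtraction: for `m = 1` the binomial `(n -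
        -- 2).choose (m - 2)` would be `1`, while no singleton contains two points.
        = if 2 ≤ m then ((n - 2).choose (m - 2) : ℝ) / n.choose m else 0 := by
      intro i j hij
      split_ifs with h2
      · have := Finset.card_filter_powersetCard_subset ({i, j} : Finset (Fin n)) Finset.univ m
          (by simp) (by simpa [Finset.card_pair hij] using h2)
        rw [Finset.card_pair hij, Finset.card_univ, Fintype.card_fin] at this
        rw [subsetAvg]
        congr 1
        rw [← this, ← Finset.sum_boole]
        refine Finset.sum_congr rfl fun A _ => ?_
        by_cases hi : i ∈ A <;> by_cases hj : j ∈ A <;>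
          simp [memInd, Finset.insert_subset_iff, hi, hj]
      · rw [subsetAvg, Finset.sum_eq_zero, zero_div]
        intro A hA
        have hc := (Finset.mem_powersetCard.1 hA).2
        have : ¬ (i ∈ A ∧ j ∈ A) := by
          rintro ⟨hi, hj⟩
          have := Finset.card_le_card (show ({i, j} : Finset (Fin n)) ⊆ A by
            simp [Finset.insert_subset_iff, hi, hj])
          rw [Finset.card_pair hij] at this
          omega
        unfold memInd
        by_cases hi : i ∈ A <;> by_cases hj : j ∈ A <;> simp_all
    refine ⟨subsetAvg m (fun A => memInd A i₀ * memInd A j₀), ?_, ?_, fun i j hij => ?_⟩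
    · exact subsetAvg_nonneg fun A => mul_nonneg (memInd_nonneg _ _) (memInd_nonneg _ _)
    · rw [← subsetAvg_memInd hm hmn i₀]
      exact subsetAvg_mono fun A _ =>
        mul_le_of_le_one_right (memInd_nonneg _ _) (memInd_le_one _ _)
    · rw [key i j hij, key i₀ j₀ hij₀]
  · push Not at h
    exact ⟨0, le_rfl, by positivity, fun i j hij => absurd (h i j) hij⟩

lemma subsetAvg_sum_mem (hm : 1 ≤ m) (hmn : m ≤ n) (r : Fin n → ℝ) :
    subsetAvg m (fun A => ∑ i ∈ A, r i) = (m : ℝ) / n * ∑ i, r i := by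
  have h : ∀ A : Finset (Fin n), ∑ i ∈ A, r i = ∑ i, memInd A i * r i := fun A =>
    sum_mem_eq_sum_memInd A r
  rw [subsetAvg_congr fun A _ => h A, subsetAvg_sum, Finset.mul_sum]
  refine Finset.sum_congr rfl fun i _ => ?_
  rw [subsetAvg_mul_right, subsetAvg_memInd hm hmn]

lemma subsetAvg_ite (hm : 1 ≤ m) (hmn : m ≤ n) (i : Fin n) (r s : ℝ) :
    subsetAvg m (fun A => if i ∈ A then r else s) = (m : ℝ) / n * r + (1 - (m : ℝ) / n) * s := by
  have : ∀ A : Finset (Fin n), (if i ∈ A then r else s) = memInd A i * (r - s) + s := by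
    intro A; unfold memInd; split_ifs <;> ring
  simp only [this]
  rw [subsetAvg_add, subsetAvg_mul_right, subsetAvg_memInd hm hmn, subsetAvg_const hmn]
  ring

/-! ### Vector means and sampling without replacement -/

variable {E : Type*} [NormedAddCommGroup E] [InnerProductSpace ℝ E]

/-- The average of a family of vectors. -/
def vmean (y : Fin n → E) : E := (1 / (n : ℝ)) • ∑ i, y i

lemma nsmul_vmean (hn : 1 ≤ n) (y : Fin n → E) : (n : ℝ) • vmean y = ∑ i, y i := by
  have : (n : ℝ) ≠ 0 := by
    have : n ≠ 0 := by omega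
    exact_mod_cast this
  rw [vmean, smul_smul, mul_one_div_cancel this, one_smul]

lemma sum_sub_vmean (y : Fin n → E) : ∑ i, (y i - vmean y) = 0 := by
  rcases Nat.eq_zero_or_pos n with rfl | hn
  · simp
  · rw [Finset.sum_sub_distrib, Finset.sum_const, Finset.card_univ, Fintype.card_fin,
      ← Nat.cast_smul_eq_nsmul ℝ, nsmul_vmean hn, sub_self]

lemma vmean_add (y z : Fin n → E) : vmean (fun i => y i + z i) = vmean y + vmean z := by
  simp [vmean, Finset.sum_add_distrib]

lemma vmean_sub (y z : Fin n → E) : vmean (fun i => y i - z i) = vmean y - vmean z := by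
  simp [vmean, Finset.sum_sub_distrib, smul_sub]

lemma vmean_const (hn : 1 ≤ n) (x : E) : vmean (fun _ : Fin n => x) = x := by
  have : (n : ℝ) ≠ 0 := by
    have : n ≠ 0 := by omega
    exact_mod_cast this
  rw [vmean, Finset.sum_const, Finset.card_univ, Fintype.card_fin, ← Nat.cast_smul_eq_nsmul ℝ,
    smul_smul, one_div_mul_cancel this, one_smul]

lemma sum_norm_sub_vmean_sq (y : Fin n → E) :
    ∑ i, ‖y i - vmean y‖ ^ 2 = ∑ i, ‖y i‖ ^ 2 - n * ‖vmean y‖ ^ 2 := by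
  rcases Nat.eq_zero_or_pos n with rfl | hn
  · simp
  have h : ∀ i, ‖y i - vmean y‖ ^ 2
      = ‖y i‖ ^ 2 - 2 * inner ℝ (y i) (vmean y) + ‖vmean y‖ ^ 2 := fun i =>
    norm_sub_sq_real _ _
  simp only [h, Finset.sum_add_distrib, Finset.sum_sub_distrib, ← Finset.mul_sum,
    ← sum_inner, ← nsmul_vmean hn y, inner_smul_left, real_inner_self_eq_norm_sq]
  simp
  ring

lemma sum_norm_sub_vmean_sq_le (y : Fin n → E) :
    ∑ i, ‖y i - vmean y‖ ^ 2 ≤ ∑ i, ‖y i‖ ^ 2 := by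
  rw [sum_norm_sub_vmean_sq]
  have : 0 ≤ (n : ℝ) * ‖vmean y‖ ^ 2 := by positivity
  linarith

lemma norm_vmean_sq_le (y : Fin n → E) : ‖vmean y‖ ^ 2 ≤ (1 / (n : ℝ)) * ∑ i, ‖y i‖ ^ 2 := by
  rcases Nat.eq_zero_or_pos n with rfl | hn
  · simp [vmean]
  have h := sum_norm_sub_vmean_sq y
  have h0 : 0 ≤ ∑ i, ‖y i - vmean y‖ ^ 2 := Finset.sum_nonneg fun _ _ => by positivity
  have : (0 : ℝ) < n := by exact_mod_cast hn
  rw [one_div, inv_mul_eq_div, le_div_iff₀ this]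
  linarith

/-- Splits a sampled average into the full mean and a combination of centred vectors. The latter sum
to zero over all clients, so any constant part of the sampling frequencies drops out after
averaging. -/
lemma sum_mem_eq_add (A : Finset (Fin n)) (hA : A.card = m) (hm : 1 ≤ m) (y : Fin n → E) :
    (1 / (m : ℝ)) • ∑ i ∈ A, y i
      = vmean y + (1 / (m : ℝ)) • ∑ i, memInd A i • (y i - vmean y) := by
  have : (m : ℝ) ≠ 0 := by
    have : m ≠ 0 := by omega
    exact_mod_cast this
  rw [← sum_mem_eq_sum_memInd, Finset.sum_sub_distrib, Finset.sum_const, hA,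
    ← Nat.cast_smul_eq_nsmul ℝ, smul_sub, smul_smul, one_div_mul_cancel this, one_smul]
  abel

lemma subsetAvg_inner_sum_mem (hm : 1 ≤ m) (hmn : m ≤ n) (w : E) (y : Fin n → E) :
    subsetAvg m (fun A => inner ℝ w ((1 / (m : ℝ)) • ∑ i ∈ A, y i)) = inner ℝ w (vmean y) := by
  have hm0 : (m : ℝ) ≠ 0 := by
    have : m ≠ 0 := by omega
    exact_mod_cast this
  simp only [inner_smul_right, inner_sum, vmean]
  rw [subsetAvg_mul_left, subsetAvg_sum_mem hm hmn]
  field_simp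

/-- After centring, the second moment involves the frequencies `m/n` on the diagonal and `q` off it.
Since the centred vectors sum to zero, the constant part `q` of this matrix contributes nothing and
`(m/n - q) ∑‖z i‖²` remains. Dropping `q ≥ 0` loses only the gain of sampling without replacement.
-/
lemma subsetAvg_norm_sq_le (hm : 1 ≤ m) (hmn : m ≤ n) (y : Fin n → E) :
    subsetAvg m (fun A => ‖(1 / (m : ℝ)) • ∑ i ∈ A, y i‖ ^ 2)
      ≤ ‖vmean y‖ ^ 2 + (1 / (m : ℝ)) * ((1 / (n : ℝ)) * ∑ i, ‖y i - vmean y‖ ^ 2) := by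
  obtain ⟨q, hq0, hqp, hq⟩ := exists_subsetAvg_memInd_mul hm hmn
  have hm0 : (m : ℝ) ≠ 0 := by
    have : m ≠ 0 := by omega
    exact_mod_cast this
  have hn0 : (n : ℝ) ≠ 0 := by
    have : n ≠ 0 := by omega
    exact_mod_cast this
  set z : Fin n → E := fun i => y i - vmean y with hz
  have hzsum : ∑ i, z i = 0 := sum_sub_vmean y
  have hexp : ∀ A : Finset (Fin n), A.card = m → ‖(1 / (m : ℝ)) • ∑ i ∈ A, y i‖ ^ 2
      = ‖vmean y‖ ^ 2 + (2 / (m : ℝ)) * ∑ i, memInd A i * inner ℝ (vmean y) (z i)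
        + (1 / (m : ℝ)) ^ 2 * ∑ i, ∑ j, (memInd A i * memInd A j) * inner ℝ (z i) (z j) := by
    intro A hA
    rw [sum_mem_eq_add A hA hm y, norm_add_sq_real, inner_smul_right, norm_smul, mul_pow,
      ← real_inner_self_eq_norm_sq (∑ i, memInd A i • (y i - vmean y)), inner_sum, sum_inner]
    simp only [inner_smul_right, inner_smul_left, Real.norm_eq_abs, sq_abs, inner_sum]
    simp only [conj_trivial, hz, Finset.mul_sum]
    congr 1
    · congr 1
      exact Finset.sum_congr rfl fun i _ => by ring
    · exact Finset.sum_congr rfl fun i _ => Finset.sum_congr rfl fun j _ => by ring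
  rw [subsetAvg_congr hexp, subsetAvg_add, subsetAvg_add, subsetAvg_const hmn,
    subsetAvg_mul_left, subsetAvg_mul_left, subsetAvg_sum, subsetAvg_sum]
  simp only [subsetAvg_sum, subsetAvg_mul_right, subsetAvg_memInd hm hmn]
  have h1 : ∑ i, (m : ℝ) / n * inner ℝ (vmean y) (z i) = 0 := by
    rw [← Finset.mul_sum, ← inner_sum, hzsum, inner_zero_right, mul_zero]
  have h2 : ∑ i, ∑ j, subsetAvg m (fun A => memInd A i * memInd A j) * inner ℝ (z i) (z j)
      = ((m : ℝ) / n - q) * ∑ i, ‖z i‖ ^ 2 := by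
    have : ∀ i j, subsetAvg m (fun A => memInd A i * memInd A j) * inner ℝ (z i) (z j)
        = q * inner ℝ (z i) (z j)
          + if i = j then ((m : ℝ) / n - q) * ‖z i‖ ^ 2 else 0 := by
      intro i j
      split_ifs with hij
      · subst hij
        simp only [memInd_mul_self, subsetAvg_memInd hm hmn, real_inner_self_eq_norm_sq]
        ring
      · rw [hq i j hij, add_zero]
    simp only [this, Finset.sum_add_distrib, ← Finset.mul_sum, ← inner_sum, hzsum]
    simp [Finset.mul_sum]
  rw [h1, h2]
  have hS : 0 ≤ ∑ i, ‖z i‖ ^ 2 := Finset.sum_nonneg fun _ _ => by positivity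
  have h3 : (1 / (m : ℝ)) ^ 2 * (((m : ℝ) / n - q) * ∑ i, ‖z i‖ ^ 2)
      ≤ (1 / (m : ℝ)) ^ 2 * (((m : ℝ) / n) * ∑ i, ‖z i‖ ^ 2) := by
    gcongr
    linarith
  have h4 : (1 / (m : ℝ)) ^ 2 * (((m : ℝ) / n) * ∑ i, ‖z i‖ ^ 2)
      = (1 / (m : ℝ)) * ((1 / (n : ℝ)) * ∑ i, ‖z i‖ ^ 2) := by
    field_simp
  linarith

/-- An unsampled client sees a slightly biased average, because its own vector is excluded. The bias
points away from `y i - vmean y` with a weight `κ ≤ 1/n`, small enough to be harmless in the lag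
estimate. -/
lemma exists_subsetAvg_notMem_inner (hm : 1 ≤ m) (hmn : m ≤ n) :
    ∃ κ : ℝ, 0 ≤ κ ∧ κ ≤ 1 / (n : ℝ) ∧ ∀ (i : Fin n) (x : E) (y : Fin n → E),
      subsetAvg m (fun A => if i ∈ A then 0 else inner ℝ x ((1 / (m : ℝ)) • ∑ j ∈ A, y j))
        = (1 - (m : ℝ) / n) * inner ℝ x (vmean y) - κ * inner ℝ x (y i - vmean y) := by
  obtain ⟨q, hq0, hqp, hq⟩ := exists_subsetAvg_memInd_mul hm hmn
  have hm0 : (0 : ℝ) < m := by exact_mod_cast hm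
  have hn0 : (0 : ℝ) < n := by exact_mod_cast (by omega : 0 < n)
  -- The diagonal frequency `m/n` minus the pair frequency `q`, times the factor `1/m` of the
  -- sampled average; discarding `q` leaves `(m/n)/m = 1/n`.
  refine ⟨((m : ℝ) / n - q) / m, div_nonneg (by linarith) hm0.le, ?_, fun i x y => ?_⟩
  · rw [div_le_div_iff₀ hm0 hn0]
    have : (m : ℝ) / n * n = m := by field_simp
    nlinarith [mul_nonneg hq0 hn0.le]
  set z : Fin n → E := fun i => y i - vmean y with hz
  have hzsum : ∑ i, z i = 0 := sum_sub_vmean y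
  have hexp : ∀ A : Finset (Fin n), A.card = m →
      (if i ∈ A then 0 else inner ℝ x ((1 / (m : ℝ)) • ∑ j ∈ A, y j))
      = (1 - memInd A i) * inner ℝ x (vmean y)
        + (1 / (m : ℝ)) * (∑ j, memInd A j * inner ℝ x (z j)
          - ∑ j, (memInd A i * memInd A j) * inner ℝ x (z j)) := by
    intro A hA
    rw [sum_mem_eq_add A hA hm y]
    unfold memInd
    split_ifs with h
    · simp
    · simp only [inner_add_right, inner_smul_right, inner_sum]
      simp [hz]
  rw [subsetAvg_congr hexp, subsetAvg_add, subsetAvg_mul_right, subsetAvg_mul_left,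
    subsetAvg_sub, subsetAvg_sub, subsetAvg_sum, subsetAvg_sum, subsetAvg_const hmn]
  simp only [subsetAvg_mul_right, subsetAvg_memInd hm hmn]
  have h1 : ∑ j, (m : ℝ) / n * inner ℝ x (z j) = 0 := by
    rw [← Finset.mul_sum, ← inner_sum, hzsum, inner_zero_right, mul_zero]
  have h2 : ∑ j, subsetAvg m (fun A => memInd A i * memInd A j) * inner ℝ x (z j)
      = ((m : ℝ) / n - q) * inner ℝ x (z i) := by
    have : ∀ j, subsetAvg m (fun A => memInd A i * memInd A j) * inner ℝ x (z j)
        = q * inner ℝ x (z j)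
          + if i = j then ((m : ℝ) / n - q) * inner ℝ x (z j) else 0 := by
      intro j
      split_ifs with hij
      · subst hij
        simp only [memInd_mul_self, subsetAvg_memInd hm hmn]
        ring
      · rw [hq i j hij, add_zero]
    simp only [this, Finset.sum_add_distrib, ← Finset.mul_sum, ← inner_sum, hzsum]
    simp
  rw [h1, h2]
  ring

end SubsetAverage

end ScaffoldP

end

noncomputable section

namespace ScaffoldP

/-! ### Smoothness -/

section Smoothness

/-- Descent lemma for a function whose gradient is Lipschitz. -/
lemma le_add_inner_gradient_add {E : Type*} [NormedAddCommGroup E] [InnerProductSpace ℝ E]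
    [CompleteSpace E] {g : E → ℝ} {L : ℝ} (hg : Differentiable ℝ g)
    (hL : ∀ x y, ‖gradient g x - gradient g y‖ ≤ L * ‖x - y‖) (x y : E) :
    g y ≤ g x + inner ℝ (gradient g x) (y - x) + L / 2 * ‖y - x‖ ^ 2 := by
  set d := y - x with hd
  -- `φ` compares `g` on the segment with its quadratic majorant. The Lipschitz bound makes its
  -- derivative nonpositive on `(0, 1)`, and `φ 1 ≤ φ 0` is the claim.
  let φ : ℝ → ℝ := fun t => g (x + t • d) - t * inner ℝ (gradient g x) d - L / 2 * t ^ 2 * ‖d‖ ^ 2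
  have hφ : ∀ t, HasDerivAt φ
      (inner ℝ (gradient g (x + t • d)) d - inner ℝ (gradient g x) d - L * t * ‖d‖ ^ 2) t := by
    intro t
    have h1 : HasDerivAt (fun t : ℝ => x + t • d) d t := by
      simpa using ((hasDerivAt_id t).smul_const d).const_add x
    have h2 : HasDerivAt (fun t : ℝ => g (x + t • d)) (inner ℝ (gradient g (x + t • d)) d) t := by
      have := ((hg (x + t • d)).hasFDerivAt).comp_hasDerivAt t h1
      rwa [← inner_gradient_left] at this
    have h3 : HasDerivAt (fun t : ℝ => t * inner ℝ (gradient g x) d)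
        (inner ℝ (gradient g x) d) t := by
      simpa using (hasDerivAt_id t).mul_const (inner ℝ (gradient g x) d)
    have h4 : HasDerivAt (fun t : ℝ => L / 2 * t ^ 2 * ‖d‖ ^ 2) (L * t * ‖d‖ ^ 2) t := by
      have := (((hasDerivAt_id t).pow 2).const_mul (L / 2)).mul_const (‖d‖ ^ 2)
      refine this.congr_deriv ?_
      simp only [id, Nat.cast_ofNat]
      ring
    exact (h2.sub h3).sub h4
  have hanti : AntitoneOn φ (Set.Icc 0 1) := by
    refine antitoneOn_of_hasDerivWithinAt_nonpos (convex_Icc 0 1)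
      (fun t _ => (hφ t).continuousAt.continuousWithinAt)
      (fun t _ => (hφ t).hasDerivWithinAt) fun t ht => ?_
    rw [interior_Icc] at ht
    have h1 : inner ℝ (gradient g (x + t • d) - gradient g x) d ≤ L * t * ‖d‖ ^ 2 := by
      refine (real_inner_le_norm _ _).trans ?_
      have h2 := hL (x + t • d) x
      rw [add_sub_cancel_left, norm_smul, Real.norm_of_nonneg ht.1.le] at h2
      calc _ ≤ L * (t * ‖d‖) * ‖d‖ := by gcongr
        _ = _ := by ring
    rw [inner_sub_left] at h1
    linarith
  have := hanti (Set.left_mem_Icc.2 zero_le_one) (Set.right_mem_Icc.2 zero_le_one) zero_le_one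
  have hxd : x + d = y := by rw [hd]; abel
  simp only [φ, one_smul, zero_smul, add_zero, hxd] at this
  linarith

variable {n du dv : ℕ}

/-- Differentiability in each variable together with gradients that are Lipschitz in both
variables, with a single constant. -/
structure JointSmooth (f : Fin n → Vec du → Vec dv → ℝ) (L : ℝ) : Prop where
  nonneg : 0 ≤ L
  differentiable_u : ∀ i v, Differentiable ℝ (fun u => f i u v)
  differentiable_v : ∀ i u, Differentiable ℝ (fun v => f i u v)
  gradU_le : ∀ i u v u' v',
    ‖gradU (f i) u v - gradU (f i) u' v'‖ ≤ L * ‖u - u'‖ + L * ‖v - v'‖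
  gradV_le : ∀ i u v u' v',
    ‖gradV (f i) u v - gradV (f i) u' v'‖ ≤ L * ‖u - u'‖ + L * ‖v - v'‖

lemma Smooth.jointSmooth {f : Fin n → Vec du → Vec dv → ℝ} {Lu Luv Lv Lvu : ℝ≥0}
    (h : Smooth f Lu Luv Lv Lvu) :
    JointSmooth f (max (max (Lu : ℝ) Lv) (max (Luv : ℝ) Lvu)) := by
  set L := max (max (Lu : ℝ) Lv) (max (Luv : ℝ) Lvu) with hL
  have h1 : (Lu : ℝ) ≤ L := (le_max_left _ _).trans (le_max_left _ _)
  have h2 : (Lv : ℝ) ≤ L := (le_max_right _ _).trans (le_max_left _ _)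
  have h3 : (Luv : ℝ) ≤ L := (le_max_left _ _).trans (le_max_right _ _)
  have h4 : (Lvu : ℝ) ≤ L := (le_max_right _ _).trans (le_max_right _ _)
  refine ⟨Lu.coe_nonneg.trans h1, h.differentiable_u, h.differentiable_v, ?_, ?_⟩
  · intro i u v u' v'
    calc ‖gradU (f i) u v - gradU (f i) u' v'‖
        ≤ ‖gradU (f i) u v - gradU (f i) u' v‖ + ‖gradU (f i) u' v - gradU (f i) u' v'‖ :=
          norm_sub_le_norm_sub_add_norm_sub _ _ _
      _ ≤ Lu * ‖u - u'‖ + Luv * ‖v - v'‖ :=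
          add_le_add ((h.lipschitz_u_u i v).norm_sub_le u u') ((h.lipschitz_u_v i u').norm_sub_le v v')
      _ ≤ _ := by gcongr
  · intro i u v u' v'
    calc ‖gradV (f i) u v - gradV (f i) u' v'‖
        ≤ ‖gradV (f i) u v - gradV (f i) u' v‖ + ‖gradV (f i) u' v - gradV (f i) u' v'‖ :=
          norm_sub_le_norm_sub_add_norm_sub _ _ _
      _ ≤ Lvu * ‖u - u'‖ + Lv * ‖v - v'‖ :=
          add_le_add ((h.lipschitz_v_u i v).norm_sub_le u u') ((h.lipschitz_v_v i u').norm_sub_le v v')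
      _ ≤ _ := by gcongr

/-! ### Consequences of joint smoothness -/

namespace JointSmooth

variable {f : Fin n → Vec du → Vec dv → ℝ} {L : ℝ}

lemma gradU_sq_le (h : JointSmooth f L) (i : Fin n) (u u' : Vec du) (v v' : Vec dv) :
    ‖gradU (f i) u v - gradU (f i) u' v'‖ ^ 2
      ≤ 2 * L ^ 2 * (‖u - u'‖ ^ 2 + ‖v - v'‖ ^ 2) := by
  have h1 := pow_le_pow_left₀ (norm_nonneg _) (h.gradU_le i u v u' v') 2
  nlinarith [sq_nonneg (L * ‖u - u'‖ - L * ‖v - v'‖)]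

lemma gradV_sq_le (h : JointSmooth f L) (i : Fin n) (u u' : Vec du) (v v' : Vec dv) :
    ‖gradV (f i) u v - gradV (f i) u' v'‖ ^ 2
      ≤ 2 * L ^ 2 * (‖u - u'‖ ^ 2 + ‖v - v'‖ ^ 2) := by
  have h1 := pow_le_pow_left₀ (norm_nonneg _) (h.gradV_le i u v u' v') 2
  nlinarith [sq_nonneg (L * ‖u - u'‖ - L * ‖v - v'‖)]

lemma lipschitzWith_gradU (h : JointSmooth f L) (i : Fin n) :
    LipschitzWith (L.toNNReal + L.toNNReal)
      (fun p : Vec du × Vec dv => gradU (f i) p.1 p.2) := by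
  refine LipschitzWith.uncurry (f := fun u v => gradU (f i) u v) (fun v => ?_) fun u => ?_
  · refine LipschitzWith.of_dist_le_mul fun u u' => ?_
    rw [dist_eq_norm, dist_eq_norm, Real.coe_toNNReal _ h.nonneg]
    simpa using h.gradU_le i u v u' v
  · refine LipschitzWith.of_dist_le_mul fun v v' => ?_
    rw [dist_eq_norm, dist_eq_norm, Real.coe_toNNReal _ h.nonneg]
    simpa using h.gradU_le i u v u v'

lemma lipschitzWith_gradV (h : JointSmooth f L) (i : Fin n) :
    LipschitzWith (L.toNNReal + L.toNNReal)
      (fun p : Vec du × Vec dv => gradV (f i) p.1 p.2) := by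
  refine LipschitzWith.uncurry (f := fun u v => gradV (f i) u v) (fun v => ?_) fun u => ?_
  · refine LipschitzWith.of_dist_le_mul fun u u' => ?_
    rw [dist_eq_norm, dist_eq_norm, Real.coe_toNNReal _ h.nonneg]
    simpa using h.gradV_le i u v u' v
  · refine LipschitzWith.of_dist_le_mul fun v v' => ?_
    rw [dist_eq_norm, dist_eq_norm, Real.coe_toNNReal _ h.nonneg]
    simpa using h.gradV_le i u v u v'

lemma measurable_gradU (h : JointSmooth f L) (i : Fin n) :
    Measurable (fun p : Vec du × Vec dv => gradU (f i) p.1 p.2) :=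
  (h.lipschitzWith_gradU i).continuous.measurable

lemma measurable_gradV (h : JointSmooth f L) (i : Fin n) :
    Measurable (fun p : Vec du × Vec dv => gradV (f i) p.1 p.2) :=
  (h.lipschitzWith_gradV i).continuous.measurable

/-- Differentiability is assumed only in each variable separately, so joint measurability is
obtained by the Carathéodory criterion: continuity in `u`, measurability in `v`. -/
lemma measurable_uncurry (h : JointSmooth f L) (i : Fin n) :
    Measurable (fun p : Vec du × Vec dv => f i p.1 p.2) := by
  have := measurable_uncurry_of_continuous_of_measurable (u := fun u v => f i u v)
    (fun v => (h.differentiable_u i v).continuous)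
    (fun u => (h.differentiable_v i u).continuous.measurable)
  exact this

/-- The point is moved first in `v` and then in `u`, each with a descent constant `L / 2`. The
gradient in `u` is then taken at the moved `v'`; replacing it by the one at `v` costs `L‖v' - v‖‖u'
- u‖`, which turns both constants into `L`. -/
lemma descent (h : JointSmooth f L) (i : Fin n) (u u' : Vec du) (v v' : Vec dv) :
    f i u' v' ≤ f i u v + inner ℝ (gradU (f i) u v) (u' - u)
      + inner ℝ (gradV (f i) u v) (v' - v) + L * ‖u' - u‖ ^ 2 + L * ‖v' - v‖ ^ 2 := by
  have h1 : f i u' v' ≤ f i u v' + inner ℝ (gradU (f i) u v') (u' - u) + L / 2 * ‖u' - u‖ ^ 2 :=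
    le_add_inner_gradient_add (h.differentiable_u i v')
      (fun x y => (h.gradU_le i x v' y v').trans_eq (by simp)) u u'
  have h2 : f i u v' ≤ f i u v + inner ℝ (gradV (f i) u v) (v' - v) + L / 2 * ‖v' - v‖ ^ 2 :=
    le_add_inner_gradient_add (h.differentiable_v i u)
      (fun x y => (h.gradV_le i u x u y).trans_eq (by simp)) v v'
  have h3 : inner ℝ (gradU (f i) u v' - gradU (f i) u v) (u' - u)
      ≤ L * ‖v' - v‖ * ‖u' - u‖ := by
    refine (real_inner_le_norm _ _).trans ?_
    gcongr
    simpa using h.gradU_le i u v' u v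
  rw [inner_sub_left] at h3
  nlinarith [mul_nonneg h.nonneg (sq_nonneg (‖v' - v‖ - ‖u' - u‖))]

/-- The average of the local functions. -/
lemma hasGradientAt_mean (h : JointSmooth f L) (u : Vec du) (v : Fin n → Vec dv) :
    HasGradientAt (fun u' => (1 / (n : ℝ)) * ∑ i, f i u' (v i))
      (vmean fun i => gradU (f i) u (v i)) u := by
  rw [hasGradientAt_iff_hasFDerivAt]
  have h1 : ∀ i, HasFDerivAt (fun u' => f i u' (v i))
      (InnerProductSpace.toDual ℝ (Vec du) (gradU (f i) u (v i))) u := fun i =>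
    hasGradientAt_iff_hasFDerivAt.1 (h.differentiable_u i (v i) u).hasGradientAt
  have h2 := (HasFDerivAt.fun_sum fun i (_ : i ∈ Finset.univ) => h1 i).const_mul (1 / (n : ℝ))
  refine h2.congr_fderiv ?_
  simp [vmean, map_sum]

lemma descent_mean (h : JointSmooth f L) (u u' : Vec du) (v v' : Fin n → Vec dv) (hn : 1 ≤ n) :
    (1 / (n : ℝ)) * ∑ i, f i u' (v' i) ≤ (1 / (n : ℝ)) * ∑ i, f i u (v i)
      + inner ℝ (vmean fun i => gradU (f i) u (v i)) (u' - u)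
      + (1 / (n : ℝ)) * ∑ i, inner ℝ (gradV (f i) u (v i)) (v' i - v i)
      + L * ‖u' - u‖ ^ 2 + L * ((1 / (n : ℝ)) * ∑ i, ‖v' i - v i‖ ^ 2) := by
  have hn0 : (n : ℝ) ≠ 0 := by exact_mod_cast (by omega : n ≠ 0)
  have h1 : (1 / (n : ℝ)) * ∑ i, f i u' (v' i) ≤ (1 / (n : ℝ)) * ∑ i, (f i u (v i)
      + inner ℝ (gradU (f i) u (v i)) (u' - u) + inner ℝ (gradV (f i) u (v i)) (v' i - v i)
      + L * ‖u' - u‖ ^ 2 + L * ‖v' i - v i‖ ^ 2) := by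
    gcongr with i
    exact h.descent i u u' (v i) (v' i)
  refine h1.trans_eq ?_
  simp only [Finset.sum_add_distrib, ← Finset.mul_sum, Finset.sum_const, Finset.card_univ,
    Fintype.card_fin, nsmul_eq_mul, vmean, inner_smul_left, sum_inner, conj_trivial]
  field_simp

end JointSmooth

end Smoothness

end ScaffoldP

end

noncomputable section

namespace ScaffoldP

/-! ### One round, averaged over the client sets -/

section Averaged

variable {n du dv m : ℕ}

lemma norm_add_sq_le_two {E : Type*} [SeminormedAddCommGroup E] (x y : E) :
    ‖x + y‖ ^ 2 ≤ 2 * ‖x‖ ^ 2 + 2 * ‖y‖ ^ 2 := by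
  have := pow_le_pow_left₀ (norm_nonneg _) (norm_add_le x y) 2
  nlinarith [sq_nonneg (‖x‖ - ‖y‖)]

/-- Only the client set is averaged here; the directions `y` and `q` are fixed. The linear terms are
exact, because a sampled average is unbiased and each `v i` moves with frequency `m/n`. -/
lemma JointSmooth.subsetAvg_descent {f : Fin n → Vec du → Vec dv → ℝ} {L : ℝ}
    (h : JointSmooth f L) (hm : 1 ≤ m) (hmn : m ≤ n) (u : Vec du) (v : Fin n → Vec dv)
    (y : Fin n → Vec du) (q : Fin n → Vec dv) (B : ℝ) :
    subsetAvg m (fun A => (1 / (n : ℝ)) * ∑ i, f i (u - B • (1 / (m : ℝ)) • ∑ j ∈ A, y j)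
        (if i ∈ A then v i - B • q i else v i))
      ≤ (1 / (n : ℝ)) * ∑ i, f i u (v i)
        - B * inner ℝ (vmean fun i => gradU (f i) u (v i)) (vmean y)
        - B * ((m : ℝ) / n) * ((1 / (n : ℝ)) * ∑ i, inner ℝ (gradV (f i) u (v i)) (q i))
        + L * B ^ 2 * subsetAvg m (fun A => ‖(1 / (m : ℝ)) • ∑ i ∈ A, y i‖ ^ 2)
        + L * B ^ 2 * ((m : ℝ) / n) * ((1 / (n : ℝ)) * ∑ i, ‖q i‖ ^ 2) := by
  have h1 : ∀ A : Finset (Fin n), A.card = m →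
      (1 / (n : ℝ)) * ∑ i, f i (u - B • (1 / (m : ℝ)) • ∑ j ∈ A, y j)
        (if i ∈ A then v i - B • q i else v i) ≤
      (1 / (n : ℝ)) * ∑ i, f i u (v i)
      + (-B) * inner ℝ (vmean fun i => gradU (f i) u (v i)) ((1 / (m : ℝ)) • ∑ j ∈ A, y j)
      + (-B * (1 / (n : ℝ))) * ∑ i ∈ A, inner ℝ (gradV (f i) u (v i)) (q i)
      + (L * B ^ 2) * ‖(1 / (m : ℝ)) • ∑ i ∈ A, y i‖ ^ 2
      + (L * B ^ 2 * (1 / (n : ℝ))) * ∑ i ∈ A, ‖q i‖ ^ 2 := by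
    intro A _
    refine (h.descent_mean u _ v _ (hm.trans hmn)).trans_eq ?_
    have e1 : ∀ i, ((if i ∈ A then v i - B • q i else v i) - v i)
        = if i ∈ A then -(B • q i) else 0 := by
      intro i; split_ifs <;> simp
    have e2 : ∑ i, inner ℝ (gradV (f i) u (v i)) ((if i ∈ A then v i - B • q i else v i) - v i)
        = -B * ∑ i ∈ A, inner ℝ (gradV (f i) u (v i)) (q i) := by
      simp only [e1, Finset.mul_sum, apply_ite (inner ℝ _), inner_zero_right,
        Finset.sum_ite_mem, Finset.univ_inter, inner_neg_right, inner_smul_right, neg_mul]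
    have e3 : ∑ i, ‖(if i ∈ A then v i - B • q i else v i) - v i‖ ^ 2
        = B ^ 2 * ∑ i ∈ A, ‖q i‖ ^ 2 := by
      have : ∀ i, ‖if i ∈ A then -(B • q i) else 0‖ ^ 2
          = if i ∈ A then B ^ 2 * ‖q i‖ ^ 2 else 0 := by
        intro i
        split_ifs
        · rw [norm_neg, norm_smul, mul_pow, Real.norm_eq_abs, sq_abs]
        · simp
      simp only [e1, this, Finset.sum_ite_mem, Finset.univ_inter, Finset.mul_sum]
    rw [e2, e3, sub_sub_cancel_left, norm_neg, inner_neg_right, inner_smul_right, norm_smul,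
      mul_pow, Real.norm_eq_abs, sq_abs]
    ring
  refine (subsetAvg_mono h1).trans_eq ?_
  rw [subsetAvg_add, subsetAvg_add, subsetAvg_add, subsetAvg_add, subsetAvg_const hmn,
    subsetAvg_mul_left, subsetAvg_mul_left, subsetAvg_mul_left, subsetAvg_mul_left,
    subsetAvg_inner_sum_mem hm hmn, subsetAvg_sum_mem hm hmn, subsetAvg_sum_mem hm hmn]
  ring

/-- The mean over clients and local steps of a family of reals. -/
def dmean (n K : ℕ) (r : Fin n → ℕ → ℝ) : ℝ :=
  (1 / (n : ℝ)) * ∑ i, (1 / (K : ℝ)) * ∑ k ∈ Finset.range K, r i k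

lemma dmean_mono {K : ℕ} {r s : Fin n → ℕ → ℝ} (h : ∀ i k, r i k ≤ s i k) :
    dmean n K r ≤ dmean n K s := by
  unfold dmean
  gcongr with i _ k _
  exact h i k

lemma dmean_add {K : ℕ} (r s : Fin n → ℕ → ℝ) :
    dmean n K (fun i k => r i k + s i k) = dmean n K r + dmean n K s := by
  simp only [dmean, Finset.sum_add_distrib, mul_add]

lemma dmean_mul_left {K : ℕ} (a : ℝ) (r : Fin n → ℕ → ℝ) :
    dmean n K (fun i k => a * r i k) = a * dmean n K r := by
  simp only [dmean, Finset.mul_sum]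
  exact Finset.sum_congr rfl fun i _ => Finset.sum_congr rfl fun k _ => by ring

lemma dmean_left {K : ℕ} (hK : 1 ≤ K) (r : Fin n → ℝ) :
    dmean n K (fun i _ => r i) = (1 / (n : ℝ)) * ∑ i, r i := by
  have : (K : ℝ) ≠ 0 := by exact_mod_cast (by omega : K ≠ 0)
  simp only [dmean, Finset.sum_const, Finset.card_range, nsmul_eq_mul]
  congr 1
  exact Finset.sum_congr rfl fun i _ => by field_simp

lemma dmean_const {K : ℕ} (hn : 1 ≤ n) (hK : 1 ≤ K) (a : ℝ) : dmean n K (fun _ _ => a) = a := by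
  have : (n : ℝ) ≠ 0 := by exact_mod_cast (by omega : n ≠ 0)
  rw [dmean_left hK, Finset.sum_const, Finset.card_univ, Fintype.card_fin, nsmul_eq_mul]
  field_simp

lemma dmean_nonneg {K : ℕ} {r : Fin n → ℕ → ℝ} (h : ∀ i k, 0 ≤ r i k) : 0 ≤ dmean n K r := by
  unfold dmean
  have : ∀ i, 0 ≤ ∑ k ∈ Finset.range K, r i k := fun i => Finset.sum_nonneg fun k _ => h i k
  have : ∀ i, 0 ≤ (1 / (K : ℝ)) * ∑ k ∈ Finset.range K, r i k := fun i =>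
    mul_nonneg (by positivity) (this i)
  exact mul_nonneg (by positivity) (Finset.sum_nonneg fun i _ => this i)

/-- Mean squared distance from the points `M i k`, `k < K`, to `(u, v i)`. -/
def lag (K : ℕ) (u : Vec du) (v : Fin n → Vec dv) (M : Fin n → ℕ → Vec du × Vec dv) : ℝ :=
  dmean n K fun i k => ‖(M i k).1 - u‖ ^ 2 + ‖(M i k).2 - v i‖ ^ 2

lemma lag_nonneg (K : ℕ) (u : Vec du) (v : Fin n → Vec dv) (M : Fin n → ℕ → Vec du × Vec dv) :
    0 ≤ lag K u v M :=
  dmean_nonneg fun _ _ => by positivity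

lemma subsetAvg_dmean {K : ℕ} (r : Fin n → ℕ → Finset (Fin n) → ℝ) :
    subsetAvg m (fun A => dmean n K fun i k => r i k A)
      = dmean n K fun i k => subsetAvg m (r i k) := by
  simp only [dmean, subsetAvg_mul_left, subsetAvg_sum]

/-- The lag after a round: for sampled clients the points are replaced by `Mp i k`. -/
lemma exists_subsetAvg_lag_le (hm : 1 ≤ m) (hmn : m ≤ n) {K : ℕ} (hK : 1 ≤ K) :
    ∃ κ : ℝ, 0 ≤ κ ∧ κ ≤ 1 / (n : ℝ) ∧
      ∀ (u : Vec du) (v : Fin n → Vec dv) (y : Fin n → Vec du) (q : Fin n → Vec dv)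
        (M Mp : Fin n → ℕ → Vec du × Vec dv) (B : ℝ),
      subsetAvg m (fun A => lag K (u - B • (1 / (m : ℝ)) • ∑ j ∈ A, y j)
        (fun i => if i ∈ A then v i - B • q i else v i)
        (fun i k => if i ∈ A then Mp i k else M i k)) ≤
      (1 - (m : ℝ) / n) * lag K u v M + 2 * ((m : ℝ) / n) * lag K u v Mp
        + 2 * B ^ 2 * subsetAvg m (fun A => ‖(1 / (m : ℝ)) • ∑ i ∈ A, y i‖ ^ 2)
        + 2 * B ^ 2 * ((m : ℝ) / n) * ((1 / (n : ℝ)) * ∑ i, ‖q i‖ ^ 2)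
        + 2 * B * dmean n K fun i k => (1 - (m : ℝ) / n) * inner ℝ ((M i k).1 - u) (vmean y)
            - κ * inner ℝ ((M i k).1 - u) (y i - vmean y) := by
  obtain ⟨κ, hκ0, hκn, hκ⟩ := exists_subsetAvg_notMem_inner (E := Vec du) hm hmn
  refine ⟨κ, hκ0, hκn, fun u v y q M Mp B => ?_⟩
  have hn := hm.trans hmn
  unfold lag
  rw [subsetAvg_dmean]
  have hterm : ∀ i k, subsetAvg m (fun A =>
      ‖(if i ∈ A then Mp i k else M i k).1 - (u - B • (1 / (m : ℝ)) • ∑ j ∈ A, y j)‖ ^ 2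
        + ‖(if i ∈ A then Mp i k else M i k).2 - (if i ∈ A then v i - B • q i else v i)‖ ^ 2) ≤
      (1 - (m : ℝ) / n) * (‖(M i k).1 - u‖ ^ 2 + ‖(M i k).2 - v i‖ ^ 2)
      + (2 * ((m : ℝ) / n)) * (‖(Mp i k).1 - u‖ ^ 2 + ‖(Mp i k).2 - v i‖ ^ 2)
      + 2 * B ^ 2 * subsetAvg m (fun A => ‖(1 / (m : ℝ)) • ∑ i ∈ A, y i‖ ^ 2)
      + 2 * B ^ 2 * ((m : ℝ) / n) * ‖q i‖ ^ 2
      + (2 * B) * ((1 - (m : ℝ) / n) * inner ℝ ((M i k).1 - u) (vmean y)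
            - κ * inner ℝ ((M i k).1 - u) (y i - vmean y)) := by
    intro i k
    -- For a sampled client a factor `2` is affordable. For an unsampled one the square is expanded
    -- exactly, so that the old lag keeps the coefficient `1 - m/n` with no loss; the price is a
    -- cross term linear in the step.
    have hA : ∀ A : Finset (Fin n), A.card = m →
        ‖(if i ∈ A then Mp i k else M i k).1 - (u - B • (1 / (m : ℝ)) • ∑ j ∈ A, y j)‖ ^ 2
        + ‖(if i ∈ A then Mp i k else M i k).2 - (if i ∈ A then v i - B • q i else v i)‖ ^ 2
        ≤ (if i ∈ A then 2 * (‖(Mp i k).1 - u‖ ^ 2 + ‖(Mp i k).2 - v i‖ ^ 2)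
              + 2 * B ^ 2 * ‖q i‖ ^ 2 else ‖(M i k).1 - u‖ ^ 2 + ‖(M i k).2 - v i‖ ^ 2)
          + (2 * B ^ 2) * ‖(1 / (m : ℝ)) • ∑ i ∈ A, y i‖ ^ 2
          + (2 * B) * (if i ∈ A then 0
              else inner ℝ ((M i k).1 - u) ((1 / (m : ℝ)) • ∑ j ∈ A, y j)) := by
      intro A _
      set w := (1 / (m : ℝ)) • ∑ j ∈ A, y j
      have e : ‖B • w‖ ^ 2 = B ^ 2 * ‖w‖ ^ 2 := by
        rw [norm_smul, mul_pow, Real.norm_eq_abs, sq_abs]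
      split_ifs with hi
      · have h1 := norm_add_sq_le_two ((Mp i k).1 - u) (B • w)
        have h2 := norm_add_sq_le_two ((Mp i k).2 - v i) (B • q i)
        have e' : ‖B • q i‖ ^ 2 = B ^ 2 * ‖q i‖ ^ 2 := by
          rw [norm_smul, mul_pow, Real.norm_eq_abs, sq_abs]
        rw [e] at h1
        rw [e'] at h2
        rw [sub_sub_eq_add_sub, sub_sub_eq_add_sub, add_sub_right_comm, add_sub_right_comm]
        linarith
      · have h1 := norm_add_sq_real ((M i k).1 - u) (B • w)
        rw [e, inner_smul_right] at h1
        rw [sub_sub_eq_add_sub, add_sub_right_comm, h1]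
        nlinarith [mul_nonneg (sq_nonneg B) (sq_nonneg ‖w‖)]
    refine (subsetAvg_mono hA).trans_eq ?_
    rw [subsetAvg_add, subsetAvg_add, subsetAvg_ite hm hmn, subsetAvg_mul_left,
      subsetAvg_mul_left, hκ]
    ring
  refine (dmean_mono hterm).trans_eq ?_
  rw [dmean_add, dmean_add, dmean_add, dmean_add, dmean_const hn hK, dmean_mul_left,
    dmean_mul_left, dmean_mul_left, dmean_mul_left, dmean_left hK]

end Averaged

end ScaffoldP

end

noncomputable section

set_option linter.unusedSectionVars false

namespace ScaffoldP

/-! ### Second moments -/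

section SecondMoment

variable {Ω : Type*} [mΩ : MeasurableSpace Ω] {μ : Measure Ω}
  {E : Type*} [NormedAddCommGroup E]

/-- The second moment `𝔼‖f‖²`. -/
def sqMean (μ : Measure Ω) (f : Ω → E) : ℝ := ∫ ω, ‖f ω‖ ^ 2 ∂μ

lemma sqMean_nonneg (f : Ω → E) : 0 ≤ sqMean μ f :=
  integral_nonneg fun _ => by positivity

lemma integrable_norm_sq {f : Ω → E} (hf : MemLp f 2 μ) :
    Integrable (fun ω => ‖f ω‖ ^ 2) μ :=
  (memLp_two_iff_integrable_sq_norm hf.1).1 hf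

lemma norm_sum_sq_le {ι : Type*} (s : Finset ι) (x : ι → E) :
    ‖∑ k ∈ s, x k‖ ^ 2 ≤ s.card * ∑ k ∈ s, ‖x k‖ ^ 2 :=
  (pow_le_pow_left₀ (norm_nonneg _) (norm_sum_le _ _) 2).trans sq_sum_le_card_mul_sum_sq

lemma memLp_sum {ι : Type*} (s : Finset ι) {f : ι → Ω → E} (hf : ∀ k ∈ s, MemLp (f k) 2 μ) :
    MemLp (fun ω => ∑ k ∈ s, f k ω) 2 μ :=
  memLp_finsetSum s hf

lemma sqMean_sum_le {ι : Type*} (s : Finset ι) {f : ι → Ω → E}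
    (hf : ∀ k ∈ s, MemLp (f k) 2 μ) :
    sqMean μ (fun ω => ∑ k ∈ s, f k ω) ≤ s.card * ∑ k ∈ s, sqMean μ (f k) := by
  unfold sqMean
  rw [← integral_finsetSum s fun k hk => integrable_norm_sq (hf k hk), ← integral_const_mul]
  exact integral_mono (integrable_norm_sq (memLp_sum s hf))
    ((integrable_finsetSum s fun k hk => integrable_norm_sq (hf k hk)).const_mul _)
    fun ω => norm_sum_sq_le s _

lemma sqMean_const [IsProbabilityMeasure μ] (x : E) : sqMean μ (fun _ => x) = ‖x‖ ^ 2 := by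
  simp [sqMean]

variable [InnerProductSpace ℝ E]

lemma sqMean_smul (a : ℝ) (f : Ω → E) :
    sqMean μ (fun ω => a • f ω) = a ^ 2 * sqMean μ f := by
  simp only [sqMean, norm_smul, mul_pow, Real.norm_eq_abs, sq_abs, integral_const_mul]

lemma integrable_inner_of_memLp {f g : Ω → E} (hf : MemLp f 2 μ) (hg : MemLp g 2 μ) :
    Integrable (fun ω => inner ℝ (f ω) (g ω)) μ := by
  refine ((integrable_norm_sq hf).add (integrable_norm_sq hg)).mono' (hf.1.inner hg.1)
    (Filter.Eventually.of_forall fun ω => ?_)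
  have := norm_inner_le_norm (𝕜 := ℝ) (f ω) (g ω)
  simp only [Pi.add_apply]
  nlinarith [sq_nonneg (‖f ω‖ - ‖g ω‖), sq_nonneg (‖f ω‖ + ‖g ω‖)]

lemma sqMean_add {f g : Ω → E} (hf : MemLp f 2 μ) (hg : MemLp g 2 μ) :
    sqMean μ (fun ω => f ω + g ω)
      = sqMean μ f + 2 * ∫ ω, inner ℝ (f ω) (g ω) ∂μ + sqMean μ g := by
  unfold sqMean
  have hi := (integrable_inner_of_memLp hf hg).const_mul 2
  simp only [norm_add_sq_real]
  rw [integral_add, integral_add (integrable_norm_sq hf) hi, integral_const_mul]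
  · exact (integrable_norm_sq hf).add hi
  · exact integrable_norm_sq hg

lemma sqMean_sum_of_orthogonal {ι : Type*} (s : Finset ι) {f : ι → Ω → E}
    (hf : ∀ k ∈ s, MemLp (f k) 2 μ)
    (h : ∀ j ∈ s, ∀ k ∈ s, j ≠ k → ∫ ω, inner ℝ (f j ω) (f k ω) ∂μ = 0) :
    sqMean μ (fun ω => ∑ k ∈ s, f k ω) = ∑ k ∈ s, sqMean μ (f k) := by
  classical
  induction s using Finset.induction_on with
  | empty => simp [sqMean]
  | insert a s ha ih =>
    simp only [Finset.sum_insert ha]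
    have hs : ∀ k ∈ s, MemLp (f k) 2 μ := fun k hk => hf k (Finset.mem_insert_of_mem hk)
    rw [sqMean_add (hf a (Finset.mem_insert_self _ _)) (memLp_sum s hs),
      ih hs fun j hj k hk => h j (Finset.mem_insert_of_mem hj) k (Finset.mem_insert_of_mem hk)]
    simp only [inner_sum]
    rw [integral_finsetSum s fun k hk =>
      integrable_inner_of_memLp (hf a (Finset.mem_insert_self _ _)) (hs k hk),
      Finset.sum_eq_zero fun k hk => ?_]
    · ring
    · exact h a (Finset.mem_insert_self _ _) k (Finset.mem_insert_of_mem hk)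
        (fun hak => ha (hak ▸ hk))

end SecondMoment

/-! ### Noise evaluated at a point that is independent of the sample -/

section Noise

variable {Ω Ξ β ζ E : Type*} [mΩ : MeasurableSpace Ω] [MeasurableSpace Ξ] [MeasurableSpace β]
  [MeasurableSpace ζ]
  [NormedAddCommGroup E] [InnerProductSpace ℝ E] [CompleteSpace E] [MeasurableSpace E]
  [BorelSpace E] [SecondCountableTopology E]
  {μ : Measure Ω} [IsProbabilityMeasure μ] {D : Measure Ξ} [IsProbabilityMeasure D]

/-- A centered family of random vectors with variance at most `σ ^ 2`. -/
structure IsNoise (g : β → Ξ → E) (D : Measure Ξ) (σ : ℝ) : Prop where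
  measurable : Measurable (fun p : β × Ξ => g p.1 p.2)
  integrable : ∀ y, Integrable (g y) D
  integral_eq : ∀ y, ∫ x, g y x ∂D = 0
  integrable_sq : ∀ y, Integrable (fun x => ‖g y x‖ ^ 2) D
  sq_le : ∀ y, ∫ x, ‖g y x‖ ^ 2 ∂D ≤ σ ^ 2

lemma map_prodMk_of_indepFun {Z : Ω → ζ} {X : Ω → Ξ} (hZ : Measurable Z) (hX : Measurable X)
    (hD : μ.map X = D) (h : IndepFun Z X μ) :
    μ.map (fun ω => (Z ω, X ω)) = (μ.map Z).prod D := by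
  have h1 : IsProbabilityMeasure (μ.map Z) := Measure.isProbabilityMeasure_map hZ.aemeasurable
  have h2 : IsProbabilityMeasure (μ.map X) := Measure.isProbabilityMeasure_map hX.aemeasurable
  rw [← hD]
  exact (indepFun_iff_map_prod_eq_prod_map_map' hZ.aemeasurable hX.aemeasurable
    inferInstance inferInstance).1 h

namespace IsNoise

variable {g : β → Ξ → E} {σ : ℝ}

/-- Fubini on the product law of `Y` and `X`. The integral of nonnegative functions is used because
integrability of the composite is not yet known; it is deduced from this bound in `memLp`. -/
lemma lintegral_le (hg : IsNoise g D σ) {Y : Ω → β} {X : Ω → Ξ} (hY : Measurable Y)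
    (hX : Measurable X) (hD : μ.map X = D) (h : IndepFun Y X μ) :
    ∫⁻ ω, ENNReal.ofReal (‖g (Y ω) (X ω)‖ ^ 2) ∂μ ≤ ENNReal.ofReal (σ ^ 2) := by
  have hm : Measurable fun p : β × Ξ => ENNReal.ofReal (‖g p.1 p.2‖ ^ 2) :=
    (hg.measurable.norm.pow_const 2).ennreal_ofReal
  have h1 : IsProbabilityMeasure (μ.map Y) := Measure.isProbabilityMeasure_map hY.aemeasurable
  calc ∫⁻ ω, ENNReal.ofReal (‖g (Y ω) (X ω)‖ ^ 2) ∂μ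
      = ∫⁻ p, ENNReal.ofReal (‖g p.1 p.2‖ ^ 2) ∂(μ.map fun ω => (Y ω, X ω)) :=
        (lintegral_map hm (hY.prodMk hX)).symm
    _ = ∫⁻ y, ∫⁻ x, ENNReal.ofReal (‖g y x‖ ^ 2) ∂D ∂(μ.map Y) := by
        rw [map_prodMk_of_indepFun hY hX hD h, lintegral_prod _ hm.aemeasurable]
    _ ≤ ∫⁻ _, ENNReal.ofReal (σ ^ 2) ∂(μ.map Y) := by
        refine lintegral_mono fun y => ?_
        rw [← ofReal_integral_eq_lintegral_ofReal (hg.integrable_sq y)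
          (Filter.Eventually.of_forall fun _ => by positivity)]
        exact ENNReal.ofReal_le_ofReal (hg.sq_le y)
    _ = ENNReal.ofReal (σ ^ 2) := by simp

lemma measurable_comp (hg : IsNoise g D σ) {Y : Ω → β} {X : Ω → Ξ} (hY : Measurable Y)
    (hX : Measurable X) : Measurable fun ω => g (Y ω) (X ω) :=
  hg.measurable.comp (hY.prodMk hX)

lemma memLp (hg : IsNoise g D σ) {Y : Ω → β} {X : Ω → Ξ} (hY : Measurable Y)
    (hX : Measurable X) (hD : μ.map X = D) (h : IndepFun Y X μ) :
    MemLp (fun ω => g (Y ω) (X ω)) 2 μ := by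
  have hm := hg.measurable_comp hY hX
  rw [memLp_two_iff_integrable_sq_norm hm.aestronglyMeasurable]
  refine ⟨(hm.norm.pow_const 2).aestronglyMeasurable, ?_⟩
  rw [hasFiniteIntegral_iff_ofReal (Filter.Eventually.of_forall fun _ => by positivity)]
  exact (hg.lintegral_le hY hX hD h).trans_lt ENNReal.ofReal_lt_top

lemma sqMean_le (hg : IsNoise g D σ) {Y : Ω → β} {X : Ω → Ξ} (hY : Measurable Y)
    (hX : Measurable X) (hD : μ.map X = D) (h : IndepFun Y X μ) :
    sqMean μ (fun ω => g (Y ω) (X ω)) ≤ σ ^ 2 := by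
  have := hg.lintegral_le hY hX hD h
  rw [← ofReal_integral_eq_lintegral_ofReal (integrable_norm_sq (hg.memLp hY hX hD h))
    (Filter.Eventually.of_forall fun _ => by positivity)] at this
  exact (ENNReal.ofReal_le_ofReal_iff (sq_nonneg _)).1 this

/-- For fixed values of `φ` and `Y`, the integral over the sample vanishes by centring. This
requires the pair `(φ, Y)`, and not merely each component, to be independent of `X`. -/
lemma integral_inner_eq_zero (hg : IsNoise g D σ) {φ : Ω → E} {Y : Ω → β} {X : Ω → Ξ}
    (hφ : Measurable φ) (hY : Measurable Y) (hX : Measurable X) (hD : μ.map X = D)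
    (h : IndepFun (fun ω => (φ ω, Y ω)) X μ) (hφ2 : MemLp φ 2 μ) :
    ∫ ω, inner ℝ (φ ω) (g (Y ω) (X ω)) ∂μ = 0 := by
  have hZ : Measurable fun ω => (φ ω, Y ω) := hφ.prodMk hY
  have hYX : IndepFun Y X μ := h.comp measurable_snd measurable_id
  have h1 : IsProbabilityMeasure (μ.map fun ω => (φ ω, Y ω)) :=
    Measure.isProbabilityMeasure_map hZ.aemeasurable
  let G : (E × β) × Ξ → ℝ := fun p => inner ℝ p.1.1 (g p.1.2 p.2)
  have hG : Measurable G := by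
    have : Measurable fun p : (E × β) × Ξ => g p.1.2 p.2 :=
      hg.measurable.comp ((measurable_snd.comp measurable_fst).prodMk measurable_snd)
    exact (measurable_fst.comp measurable_fst).inner this
  have hint : Integrable G ((μ.map fun ω => (φ ω, Y ω)).prod D) := by
    rw [← map_prodMk_of_indepFun hZ hX hD h,
      integrable_map_measure hG.aestronglyMeasurable (hZ.prodMk hX).aemeasurable]
    exact integrable_inner_of_memLp hφ2 (hg.memLp hY hX hD hYX)
  calc ∫ ω, inner ℝ (φ ω) (g (Y ω) (X ω)) ∂μ
      = ∫ p, G p ∂(μ.map fun ω => ((φ ω, Y ω), X ω)) :=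
        (integral_map (hZ.prodMk hX).aemeasurable hG.aestronglyMeasurable).symm
    _ = ∫ z, ∫ x, G (z, x) ∂D ∂(μ.map fun ω => (φ ω, Y ω)) := by
        rw [map_prodMk_of_indepFun hZ hX hD h, integral_prod _ hint]
    _ = 0 := by
        refine integral_eq_zero_of_ae (Filter.Eventually.of_forall fun z => ?_)
        simp only [G, Pi.zero_apply]
        rw [integral_inner (hg.integrable z.2), hg.integral_eq, inner_zero_right]

end IsNoise

/-- Samples `x k`, `k < K`, with law `D`, each independent of the past `𝓕 k`. -/
structure FreshSamples (μ : Measure Ω) (D : Measure Ξ) (K : ℕ) (x : ℕ → Ω → Ξ)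
    (𝓕 : ℕ → MeasurableSpace Ω) : Prop where
  le : ∀ k, 𝓕 k ≤ mΩ
  mono : Monotone 𝓕
  measurable : ∀ k, Measurable[𝓕 (k + 1)] (x k)
  law : ∀ k < K, μ.map (x k) = D
  indep : ∀ k < K, Indep (𝓕 k) (MeasurableSpace.comap (x k) inferInstance) μ

namespace FreshSamples

variable {K : ℕ} {x : ℕ → Ω → Ξ} {𝓕 : ℕ → MeasurableSpace Ω} {g : β → Ξ → E} {σ : ℝ}
  {p : ℕ → Ω → β}

lemma indepFun (hx : FreshSamples μ D K x 𝓕) {k : ℕ} (hk : k < K) {Z : Ω → ζ}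
    (hZ : Measurable[𝓕 k] Z) : IndepFun Z (x k) μ := by
  rw [IndepFun_iff_Indep]
  exact indep_of_indep_of_le_left (hx.indep k hk) hZ.comap_le

lemma measurable' (hx : FreshSamples μ D K x 𝓕) (k : ℕ) : Measurable (x k) :=
  (hx.measurable k).mono (hx.le _) le_rfl

lemma memLp_noise (hx : FreshSamples μ D K x 𝓕) (hg : IsNoise g D σ)
    (hp : ∀ k, Measurable[𝓕 k] (p k)) {k : ℕ} (hk : k < K) :
    MemLp (fun ω => g (p k ω) (x k ω)) 2 μ :=
  hg.memLp ((hp k).mono (hx.le k) le_rfl) (hx.measurable' k) (hx.law k hk)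
    (hx.indepFun hk (hp k))

lemma sqMean_noise_le (hx : FreshSamples μ D K x 𝓕) (hg : IsNoise g D σ)
    (hp : ∀ k, Measurable[𝓕 k] (p k)) {k : ℕ} (hk : k < K) :
    sqMean μ (fun ω => g (p k ω) (x k ω)) ≤ σ ^ 2 :=
  hg.sqMean_le ((hp k).mono (hx.le k) le_rfl) (hx.measurable' k) (hx.law k hk)
    (hx.indepFun hk (hp k))

lemma measurable_noise (hx : FreshSamples μ D K x 𝓕) (hg : IsNoise g D σ)
    (hp : ∀ k, Measurable[𝓕 k] (p k)) (k : ℕ) :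
    Measurable[𝓕 (k + 1)] (fun ω => g (p k ω) (x k ω)) :=
  hg.measurable.comp (((hp k).mono (hx.mono (Nat.le_succ k)) le_rfl).prodMk (hx.measurable k))

lemma integral_inner_noise (hx : FreshSamples μ D K x 𝓕) (hg : IsNoise g D σ)
    (hp : ∀ k, Measurable[𝓕 k] (p k)) {k : ℕ} (hk : k < K) {φ : Ω → E}
    (hφ : Measurable[𝓕 k] φ) (hφ2 : MemLp φ 2 μ) :
    ∫ ω, inner ℝ (φ ω) (g (p k ω) (x k ω)) ∂μ = 0 :=
  hg.integral_inner_eq_zero (hφ.mono (hx.le k) le_rfl) ((hp k).mono (hx.le k) le_rfl)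
    (hx.measurable' k) (hx.law k hk) (hx.indepFun hk (hφ.prodMk (hp k))) hφ2

/-- The noises are martingale differences: an earlier one is determined by the past of a later one,
hence orthogonal to it. The bound thus grows like `k` and not `k ^ 2`. -/
lemma sqMean_sum_noise_le (hx : FreshSamples μ D K x 𝓕) (hg : IsNoise g D σ)
    (hp : ∀ k, Measurable[𝓕 k] (p k)) {k : ℕ} (hk : k ≤ K) :
    sqMean μ (fun ω => ∑ j ∈ Finset.range k, g (p j ω) (x j ω)) ≤ k * σ ^ 2 := by
  have hlt : ∀ j ∈ Finset.range k, j < K := fun j hj => (Finset.mem_range.1 hj).trans_le hk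
  have key : ∀ i ∈ Finset.range k, ∀ j ∈ Finset.range k, i < j →
      ∫ ω, inner ℝ (g (p i ω) (x i ω)) (g (p j ω) (x j ω)) ∂μ = 0 := by
    intro i hi j hj hij
    exact hx.integral_inner_noise hg hp (hlt j hj)
      ((hx.measurable_noise hg hp i).mono (hx.mono hij) le_rfl) (hx.memLp_noise hg hp (hlt i hi))
  rw [sqMean_sum_of_orthogonal _ fun j hj => hx.memLp_noise hg hp (hlt j hj)]
  · calc _ ≤ ∑ _j ∈ Finset.range k, σ ^ 2 :=
          Finset.sum_le_sum fun j hj => hx.sqMean_noise_le hg hp (hlt j hj)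
      _ = _ := by simp
  · intro i hi j hj hij
    rcases lt_or_gt_of_ne hij with h | h
    · exact key i hi j hj h
    · simp only [real_inner_comm (g (p j _) _)]
      exact key j hj i hi h

end FreshSamples

end Noise

end ScaffoldP

end

noncomputable section

set_option linter.unusedSectionVars false

namespace ScaffoldP

/-! ### The local iterates of one client -/

section Client

variable {n du dv : ℕ} {Ξ : Type*} [MeasurableSpace Ξ]
  {F : Vec du → Vec dv → Ξ → ℝ} {D : Fin n → Measure Ξ} [∀ i, IsProbabilityMeasure (D i)]

/-- Deviation of the stochastic gradient in `u` from its mean. -/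
def noiseU (F : Vec du → Vec dv → Ξ → ℝ) (D : Fin n → Measure Ξ) (i : Fin n)
    (p : Vec du × Vec dv) (x : Ξ) : Vec du :=
  stochGradU F p.1 p.2 x - gradU (localLoss F D i) p.1 p.2

/-- Deviation of the stochastic gradient in `v` from its mean. -/
def noiseV (F : Vec du → Vec dv → Ξ → ℝ) (D : Fin n → Measure Ξ) (i : Fin n)
    (p : Vec du × Vec dv) (x : Ξ) : Vec dv :=
  stochGradV F p.1 p.2 x - gradV (localLoss F D i) p.1 p.2

variable {L σu σv : ℝ}

lemma WellPosed.measurable_stochGradU (hF : WellPosed F D) :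
    Measurable fun p : (Vec du × Vec dv) × Ξ => stochGradU F p.1.1 p.1.2 p.2 :=
  hF.measurable_u.comp ((measurable_fst.comp measurable_fst).prodMk
    ((measurable_snd.comp measurable_fst).prodMk measurable_snd))

lemma WellPosed.measurable_stochGradV (hF : WellPosed F D) :
    Measurable fun p : (Vec du × Vec dv) × Ξ => stochGradV F p.1.1 p.1.2 p.2 :=
  hF.measurable_v.comp ((measurable_fst.comp measurable_fst).prodMk
    ((measurable_snd.comp measurable_fst).prodMk measurable_snd))

lemma StochasticGradient.isNoise_noiseU (hg : StochasticGradient F D σu σv) (hF : WellPosed F D)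
    (hf : JointSmooth (localLoss F D) L) (i : Fin n) : IsNoise (noiseU F D i) (D i) σu where
  measurable := hF.measurable_stochGradU.sub ((hf.measurable_gradU i).comp measurable_fst)
  integrable y := (hg.integrable_u i y.1 y.2).sub (integrable_const _)
  integral_eq y := by
    simp only [noiseU]
    rw [integral_sub (hg.integrable_u i y.1 y.2) (integrable_const _), hg.unbiased_u]
    simp
  integrable_sq y := hg.integrable_sq_u i y.1 y.2
  sq_le y := hg.variance_u i y.1 y.2

lemma StochasticGradient.isNoise_noiseV (hg : StochasticGradient F D σu σv) (hF : WellPosed F D)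
    (hf : JointSmooth (localLoss F D) L) (i : Fin n) : IsNoise (noiseV F D i) (D i) σv where
  measurable := hF.measurable_stochGradV.sub ((hf.measurable_gradV i).comp measurable_fst)
  integrable y := (hg.integrable_v i y.1 y.2).sub (integrable_const _)
  integral_eq y := by
    simp only [noiseV]
    rw [integral_sub (hg.integrable_v i y.1 y.2) (integrable_const _), hg.unbiased_v]
    simp
  integrable_sq y := hg.integrable_sq_v i y.1 y.2
  sq_le y := hg.variance_v i y.1 y.2

omit [MeasurableSpace Ξ] in
lemma localIter_fst (P : Params) (ci c u : Vec du) (v : Vec dv) (x : ℕ → Ξ) (k : ℕ) :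
    (localIter F P ci c u v x k).1 = u - P.γu • ∑ j ∈ Finset.range k,
      (stochGradU F (localIter F P ci c u v x j).1 (localIter F P ci c u v x j).2 (x j)
        - ci + c) := by
  induction k with
  | zero => simp [localIter]
  | succ k ih =>
    rw [Finset.sum_range_succ, smul_add, ← sub_sub, ← ih]
    rfl

omit [MeasurableSpace Ξ] in
lemma localIter_snd (P : Params) (ci c u : Vec du) (v : Vec dv) (x : ℕ → Ξ) (k : ℕ) :
    (localIter F P ci c u v x k).2 = v - P.γv • ∑ j ∈ Finset.range k,
      stochGradV F (localIter F P ci c u v x j).1 (localIter F P ci c u v x j).2 (x j) := by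
  induction k with
  | zero => simp [localIter]
  | succ k ih =>
    rw [Finset.sum_range_succ, smul_add, ← sub_sub, ← ih]
    rfl

variable {Ω : Type*} [mΩ : MeasurableSpace Ω] {μ : Measure Ω} [IsProbabilityMeasure μ]

lemma JointSmooth.memLp_gradU {f : Fin n → Vec du → Vec dv → ℝ} (hf : JointSmooth f L) (i : Fin n)
    {U : Ω → Vec du} {V : Ω → Vec dv} (hU : MemLp U 2 μ) (hV : MemLp V 2 μ) :
    MemLp (fun ω => gradU (f i) (U ω) (V ω)) 2 μ := by
  have hm : AEStronglyMeasurable (fun ω => gradU (f i) (U ω) (V ω)) μ :=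
    (hf.lipschitzWith_gradU i).continuous.comp_aestronglyMeasurable (hU.1.prodMk hV.1)
  have h1 : MemLp (fun ω => gradU (f i) (U ω) (V ω) - gradU (f i) 0 0) 2 μ := by
    refine MemLp.mono ((hU.norm.const_mul L).add (hV.norm.const_mul L))
      (hm.sub aestronglyMeasurable_const) (Filter.Eventually.of_forall fun ω => ?_)
    refine (hf.gradU_le i _ _ _ _).trans ?_
    simp only [sub_zero, Pi.add_apply]
    exact le_abs_self _
  exact (memLp_congr_ae (Filter.Eventually.of_forall fun ω => by simp)).1
    (h1.add (memLp_const (gradU (f i) 0 0)))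

lemma JointSmooth.memLp_gradV {f : Fin n → Vec du → Vec dv → ℝ} (hf : JointSmooth f L) (i : Fin n)
    {U : Ω → Vec du} {V : Ω → Vec dv} (hU : MemLp U 2 μ) (hV : MemLp V 2 μ) :
    MemLp (fun ω => gradV (f i) (U ω) (V ω)) 2 μ := by
  have hm : AEStronglyMeasurable (fun ω => gradV (f i) (U ω) (V ω)) μ :=
    (hf.lipschitzWith_gradV i).continuous.comp_aestronglyMeasurable (hU.1.prodMk hV.1)
  have h1 : MemLp (fun ω => gradV (f i) (U ω) (V ω) - gradV (f i) 0 0) 2 μ := by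
    refine MemLp.mono ((hU.norm.const_mul L).add (hV.norm.const_mul L))
      (hm.sub aestronglyMeasurable_const) (Filter.Eventually.of_forall fun ω => ?_)
    refine (hf.gradV_le i _ _ _ _).trans ?_
    simp only [sub_zero, Pi.add_apply]
    exact le_abs_self _
  exact (memLp_congr_ae (Filter.Eventually.of_forall fun ω => by simp)).1
    (h1.add (memLp_const (gradV (f i) 0 0)))

lemma sqMean_add_add_le {E : Type*} [NormedAddCommGroup E] {f g h : Ω → E}
    (hf : MemLp f 2 μ) (hg : MemLp g 2 μ) (hh : MemLp h 2 μ) :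
    sqMean μ (fun ω => f ω + g ω + h ω) ≤ 3 * (sqMean μ f + sqMean μ g + sqMean μ h) := by
  have hf' := integrable_norm_sq hf
  have hg' := integrable_norm_sq hg
  have hh' := integrable_norm_sq hh
  unfold sqMean
  rw [← integral_add hf' hg', ← integral_add (by exact hf'.add hg') hh', ← integral_const_mul]
  refine integral_mono (integrable_norm_sq ((hf.add hg).add hh))
    (((hf'.add hg').add hh').const_mul 3) fun ω => ?_
  have := pow_le_pow_left₀ (norm_nonneg _) (norm_add₃_le (a := f ω) (b := g ω) (c := h ω)) 2
  simp only
  nlinarith [sq_nonneg (‖f ω‖ - ‖g ω‖), sq_nonneg (‖f ω‖ - ‖h ω‖), sq_nonneg (‖g ω‖ - ‖h ω‖)]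

/-- The local iterates of client `i` driven by random samples. -/
structure ClientRun (μ : Measure Ω) (F : Vec du → Vec dv → Ξ → ℝ) (D : Fin n → Measure Ξ)
    (L σu σv : ℝ) (P : Params) (i : Fin n) (x : ℕ → Ω → Ξ)
    (𝓕 : ℕ → MeasurableSpace Ω) : Prop where
  wellPosed : WellPosed F D
  stochasticGradient : StochasticGradient F D σu σv
  smooth : JointSmooth (localLoss F D) L
  fresh : FreshSamples μ (D i) P.K x 𝓕

namespace ClientRun

variable {P : Params} {i : Fin n} {x : ℕ → Ω → Ξ} {𝓕 : ℕ → MeasurableSpace Ω}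

lemma isNoiseU (h : ClientRun μ F D L σu σv P i x 𝓕) : IsNoise (noiseU F D i) (D i) σu :=
  h.stochasticGradient.isNoise_noiseU h.wellPosed h.smooth i

lemma isNoiseV (h : ClientRun μ F D L σu σv P i x 𝓕) : IsNoise (noiseV F D i) (D i) σv :=
  h.stochasticGradient.isNoise_noiseV h.wellPosed h.smooth i

variable (ci c u : Vec du) (v : Vec dv)

/-- The starting data `ci, c, u, v` are frozen vectors, so the `k`-th iterate depends only on
samples before step `k` and its evaluation point is independent of the next sample. -/
lemma measurable_iter (h : ClientRun μ F D L σu σv P i x 𝓕) (k : ℕ) :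
    Measurable[𝓕 k] fun ω => localIter F P ci c u v (fun k => x k ω) k := by
  induction k with
  | zero => exact measurable_const
  | succ k ih =>
    have h1 := ih.mono (h.fresh.mono (Nat.le_succ k)) le_rfl
    have h2 := h1.prodMk (h.fresh.measurable k)
    have hu := h.wellPosed.measurable_stochGradU.comp h2
    have hv := h.wellPosed.measurable_stochGradV.comp h2
    exact ((measurable_fst.comp h1).sub (((hu.sub_const ci).add_const c).const_smul P.γu)).prodMk
      ((measurable_snd.comp h1).sub (hv.const_smul P.γv))

lemma memLp_iter (h : ClientRun μ F D L σu σv P i x 𝓕) {k : ℕ} (hk : k ≤ P.K) :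
    MemLp (fun ω => (localIter F P ci c u v (fun k => x k ω) k).1) 2 μ ∧
    MemLp (fun ω => (localIter F P ci c u v (fun k => x k ω) k).2) 2 μ := by
  induction k with
  | zero => exact ⟨memLp_const _, memLp_const _⟩
  | succ k ih =>
    obtain ⟨h1, h2⟩ := ih (by omega)
    have hu := (h.fresh.memLp_noise h.isNoiseU (h.measurable_iter ci c u v) (k := k)
      (by omega)).add (h.smooth.memLp_gradU i h1 h2)
    have hv := (h.fresh.memLp_noise h.isNoiseV (h.measurable_iter ci c u v) (k := k)
      (by omega)).add (h.smooth.memLp_gradV i h1 h2)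
    have hu' := h1.sub (((hu.sub (memLp_const ci)).add (memLp_const c)).const_smul P.γu)
    have hv' := h2.sub (hv.const_smul P.γv)
    constructor
    · refine hu'.congr_norm ?_ (Filter.Eventually.of_forall fun ω => ?_)
      · exact ((measurable_fst.comp (h.measurable_iter ci c u v (k + 1))).mono (h.fresh.le _)
          le_rfl).aestronglyMeasurable
      · simp only [localIter, noiseU, Pi.sub_apply, Pi.smul_apply, Pi.add_apply, sub_add_cancel]
    · refine hv'.congr_norm ?_ (Filter.Eventually.of_forall fun ω => ?_)
      · exact ((measurable_snd.comp (h.measurable_iter ci c u v (k + 1))).mono (h.fresh.le _)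
          le_rfl).aestronglyMeasurable
      · simp only [localIter, noiseV, Pi.sub_apply, Pi.smul_apply, Pi.add_apply, sub_add_cancel]

/-- Mean squared distance of the `k`-th local iterate to the starting point. -/
def drift (μ : Measure Ω) (F : Vec du → Vec dv → Ξ → ℝ) (P : Params) (x : ℕ → Ω → Ξ)
    (ci c u : Vec du) (v : Vec dv) (k : ℕ) : ℝ :=
  sqMean μ (fun ω => (localIter F P ci c u v (fun k => x k ω) k).1 - u)
    + sqMean μ (fun ω => (localIter F P ci c u v (fun k => x k ω) k).2 - v)

lemma drift_nonneg (k : ℕ) : 0 ≤ drift μ F P x ci c u v k :=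
  add_nonneg (sqMean_nonneg _) (sqMean_nonneg _)

lemma memLp_gradU_iter (h : ClientRun μ F D L σu σv P i x 𝓕) {k : ℕ} (hk : k ≤ P.K) :
    MemLp (fun ω => gradU (localLoss F D i) (localIter F P ci c u v (fun k => x k ω) k).1
      (localIter F P ci c u v (fun k => x k ω) k).2) 2 μ :=
  h.smooth.memLp_gradU i (h.memLp_iter ci c u v hk).1 (h.memLp_iter ci c u v hk).2

lemma memLp_gradV_iter (h : ClientRun μ F D L σu σv P i x 𝓕) {k : ℕ} (hk : k ≤ P.K) :
    MemLp (fun ω => gradV (localLoss F D i) (localIter F P ci c u v (fun k => x k ω) k).1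
      (localIter F P ci c u v (fun k => x k ω) k).2) 2 μ :=
  h.smooth.memLp_gradV i (h.memLp_iter ci c u v hk).1 (h.memLp_iter ci c u v hk).2

lemma integrable_drift (h : ClientRun μ F D L σu σv P i x 𝓕) {k : ℕ} (hk : k ≤ P.K) :
    Integrable (fun ω => ‖(localIter F P ci c u v (fun k => x k ω) k).1 - u‖ ^ 2) μ ∧
    Integrable (fun ω => ‖(localIter F P ci c u v (fun k => x k ω) k).2 - v‖ ^ 2) μ :=
  ⟨integrable_norm_sq ((h.memLp_iter ci c u v hk).1.sub (memLp_const u)),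
    integrable_norm_sq ((h.memLp_iter ci c u v hk).2.sub (memLp_const v))⟩

lemma sqMean_gradU_sub_le (h : ClientRun μ F D L σu σv P i x 𝓕) {k : ℕ} (hk : k ≤ P.K) :
    sqMean μ (fun ω => gradU (localLoss F D i) (localIter F P ci c u v (fun k => x k ω) k).1
      (localIter F P ci c u v (fun k => x k ω) k).2 - gradU (localLoss F D i) u v)
      ≤ 2 * L ^ 2 * drift μ F P x ci c u v k := by
  obtain ⟨h1, h2⟩ := h.integrable_drift ci c u v hk
  unfold drift sqMean
  rw [← integral_add h1 h2, ← integral_const_mul]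
  exact integral_mono (integrable_norm_sq ((h.memLp_gradU_iter ci c u v hk).sub (memLp_const _)))
    ((h1.add h2).const_mul _) fun ω => h.smooth.gradU_sq_le i _ _ _ _

lemma sqMean_gradV_sub_le (h : ClientRun μ F D L σu σv P i x 𝓕) {k : ℕ} (hk : k ≤ P.K) :
    sqMean μ (fun ω => gradV (localLoss F D i) (localIter F P ci c u v (fun k => x k ω) k).1
      (localIter F P ci c u v (fun k => x k ω) k).2 - gradV (localLoss F D i) u v)
      ≤ 2 * L ^ 2 * drift μ F P x ci c u v k := by
  obtain ⟨h1, h2⟩ := h.integrable_drift ci c u v hk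
  unfold drift sqMean
  rw [← integral_add h1 h2, ← integral_const_mul]
  exact integral_mono (integrable_norm_sq ((h.memLp_gradV_iter ci c u v hk).sub (memLp_const _)))
    ((h1.add h2).const_mul _) fun ω => h.smooth.gradV_sq_le i _ _ _ _

/-- Bound on the drift at one local step by the accumulated drift. -/
lemma drift_le (h : ClientRun μ F D L σu σv P i x 𝓕) {k : ℕ} (hk : k < P.K) :
    drift μ F P x ci c u v k ≤
      3 * P.γu ^ 2 * (P.K * σu ^ 2
        + P.K * (2 * L ^ 2 * ∑ j ∈ Finset.range P.K, drift μ F P x ci c u v j)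
        + P.K ^ 2 * ‖gradU (localLoss F D i) u v - ci + c‖ ^ 2)
      + 3 * P.γv ^ 2 * (P.K * σv ^ 2
        + P.K * (2 * L ^ 2 * ∑ j ∈ Finset.range P.K, drift μ F P x ci c u v j)
        + P.K ^ 2 * ‖gradV (localLoss F D i) u v‖ ^ 2) := by
  have hkK : (k : ℝ) ≤ P.K := by exact_mod_cast hk.le
  have hlt : ∀ j ∈ Finset.range k, j < P.K := fun j hj => (Finset.mem_range.1 hj).trans hk
  have hsum : ∑ j ∈ Finset.range k, drift μ F P x ci c u v j
      ≤ ∑ j ∈ Finset.range P.K, drift μ F P x ci c u v j :=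
    Finset.sum_le_sum_of_subset_of_nonneg (Finset.range_mono hk.le)
      fun j _ _ => drift_nonneg ci c u v j
  have hsum0 : 0 ≤ ∑ j ∈ Finset.range k, drift μ F P x ci c u v j :=
    Finset.sum_nonneg fun j _ => drift_nonneg ci c u v j
  set p : ℕ → Ω → Vec du × Vec dv :=
    fun k ω => localIter F P ci c u v (fun k => x k ω) k with hp
  have hpm : ∀ k, Measurable[𝓕 k] (p k) := h.measurable_iter ci c u v
  refine add_le_add ?_ ?_
  · set r := gradU (localLoss F D i) u v - ci + c with hr
    -- The displacement is a sum of noise, deviation of the gradients from the starting gradient,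
    -- and `k` copies of the corrected starting direction `r`. Orthogonality gives `K σu ^ 2` for
    -- the first; Cauchy–Schwarz gives `K` and `K ^ 2` for the others.
    have e : ∀ ω, (localIter F P ci c u v (fun k => x k ω) k).1 - u = (-P.γu) •
        (∑ j ∈ Finset.range k, noiseU F D i (p j ω) (x j ω)
          + ∑ j ∈ Finset.range k, (gradU (localLoss F D i) (p j ω).1 (p j ω).2
              - gradU (localLoss F D i) u v) + (k : ℝ) • r) := by
      intro ω
      have hk' : (k : ℝ) • r = ∑ _j ∈ Finset.range k, r := by
        rw [Finset.sum_const, Finset.card_range, Nat.cast_smul_eq_nsmul]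
      rw [localIter_fst, sub_sub_cancel_left, neg_smul, neg_inj, hk', ← Finset.sum_add_distrib,
        ← Finset.sum_add_distrib]
      congr 1
      refine Finset.sum_congr rfl fun j _ => ?_
      simp only [noiseU, hr, hp]
      abel
    simp only [e]
    rw [sqMean_smul, neg_sq]
    have m1 : MemLp (fun ω => ∑ j ∈ Finset.range k, noiseU F D i (p j ω) (x j ω)) 2 μ :=
      memLp_sum _ fun j hj => h.fresh.memLp_noise h.isNoiseU hpm (hlt j hj)
    have m2 : ∀ j ∈ Finset.range k, MemLp (fun ω => gradU (localLoss F D i) (p j ω).1 (p j ω).2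
              - gradU (localLoss F D i) u v) 2 μ := fun j hj =>
      (h.memLp_gradU_iter ci c u v (hlt j hj).le).sub (memLp_const _)
    have b0 := sqMean_add_add_le m1 (memLp_sum _ m2) (memLp_const ((k : ℝ) • r))
    have b1 := h.fresh.sqMean_sum_noise_le h.isNoiseU hpm hk.le
    have b2 := sqMean_sum_le _ m2
    have b3 : ∑ j ∈ Finset.range k, sqMean μ (fun ω =>
        gradU (localLoss F D i) (p j ω).1 (p j ω).2 - gradU (localLoss F D i) u v)
        ≤ 2 * L ^ 2 * ∑ j ∈ Finset.range k, drift μ F P x ci c u v j := by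
      rw [Finset.mul_sum]
      exact Finset.sum_le_sum fun j hj => h.sqMean_gradU_sub_le ci c u v (hlt j hj).le
    rw [sqMean_const, norm_smul, mul_pow, Real.norm_eq_abs, sq_abs] at b0
    rw [Finset.card_range] at b2
    have b1' : (k : ℝ) * σu ^ 2 ≤ P.K * σu ^ 2 := by gcongr
    have b2' : (k : ℝ) * ∑ j ∈ Finset.range k, sqMean μ (fun ω =>
        gradU (localLoss F D i) (p j ω).1 (p j ω).2 - gradU (localLoss F D i) u v)
        ≤ P.K * (2 * L ^ 2 * ∑ j ∈ Finset.range P.K, drift μ F P x ci c u v j) := by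
      refine (mul_le_mul_of_nonneg_left b3 (Nat.cast_nonneg k)).trans ?_
      gcongr
    have b3' : (k : ℝ) ^ 2 * ‖r‖ ^ 2 ≤ P.K ^ 2 * ‖r‖ ^ 2 := by gcongr
    have : (0 : ℝ) ≤ P.γu ^ 2 := sq_nonneg _
    rw [mul_comm 3, mul_assoc]
    refine mul_le_mul_of_nonneg_left ?_ this
    linarith
  · set r := gradV (localLoss F D i) u v with hr
    have e : ∀ ω, (localIter F P ci c u v (fun k => x k ω) k).2 - v = (-P.γv) •
        (∑ j ∈ Finset.range k, noiseV F D i (p j ω) (x j ω)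
          + ∑ j ∈ Finset.range k, (gradV (localLoss F D i) (p j ω).1 (p j ω).2 - r)
          + (k : ℝ) • r) := by
      intro ω
      have hk' : (k : ℝ) • r = ∑ _j ∈ Finset.range k, r := by
        rw [Finset.sum_const, Finset.card_range, Nat.cast_smul_eq_nsmul]
      rw [localIter_snd, sub_sub_cancel_left, neg_smul, neg_inj, hk', ← Finset.sum_add_distrib,
        ← Finset.sum_add_distrib]
      congr 1
      refine Finset.sum_congr rfl fun j _ => ?_
      simp only [noiseV, hp]
      abel
    simp only [e]
    rw [sqMean_smul, neg_sq]
    have m1 : MemLp (fun ω => ∑ j ∈ Finset.range k, noiseV F D i (p j ω) (x j ω)) 2 μ :=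
      memLp_sum _ fun j hj => h.fresh.memLp_noise h.isNoiseV hpm (hlt j hj)
    have m2 : ∀ j ∈ Finset.range k,
        MemLp (fun ω => gradV (localLoss F D i) (p j ω).1 (p j ω).2 - r) 2 μ := fun j hj =>
      (h.memLp_gradV_iter ci c u v (hlt j hj).le).sub (memLp_const _)
    have b0 := sqMean_add_add_le m1 (memLp_sum _ m2) (memLp_const ((k : ℝ) • r))
    have b1 := h.fresh.sqMean_sum_noise_le h.isNoiseV hpm hk.le
    have b2 := sqMean_sum_le _ m2
    have b3 : ∑ j ∈ Finset.range k, sqMean μ (fun ω =>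
        gradV (localLoss F D i) (p j ω).1 (p j ω).2 - r)
        ≤ 2 * L ^ 2 * ∑ j ∈ Finset.range k, drift μ F P x ci c u v j := by
      rw [Finset.mul_sum]
      exact Finset.sum_le_sum fun j hj => h.sqMean_gradV_sub_le ci c u v (hlt j hj).le
    rw [sqMean_const, norm_smul, mul_pow, Real.norm_eq_abs, sq_abs] at b0
    rw [Finset.card_range] at b2
    have b1' : (k : ℝ) * σv ^ 2 ≤ P.K * σv ^ 2 := by gcongr
    have b2' : (k : ℝ) * ∑ j ∈ Finset.range k, sqMean μ (fun ω =>
        gradV (localLoss F D i) (p j ω).1 (p j ω).2 - r)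
        ≤ P.K * (2 * L ^ 2 * ∑ j ∈ Finset.range P.K, drift μ F P x ci c u v j) := by
      refine (mul_le_mul_of_nonneg_left b3 (Nat.cast_nonneg k)).trans ?_
      gcongr
    have b3' : (k : ℝ) ^ 2 * ‖r‖ ^ 2 ≤ P.K ^ 2 * ‖r‖ ^ 2 := by gcongr
    have : (0 : ℝ) ≤ P.γv ^ 2 := sq_nonneg _
    rw [mul_comm 3, mul_assoc]
    refine mul_le_mul_of_nonneg_left ?_ this
    linarith

/-- The drift averaged over the local steps. -/
lemma mean_drift_le (h : ClientRun μ F D L σu σv P i x 𝓕) (hK : 1 ≤ P.K) {γ a b : ℝ}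
    (ha : P.γu ^ 2 ≤ a * γ ^ 2) (hb : P.γv ^ 2 ≤ b * γ ^ 2) (ha1 : a ≤ 1) (hb1 : b ≤ 1)
    (hθ0 : 0 ≤ L * γ * P.K) (hθ : L * γ * P.K ≤ 1 / 72) :
    (1 / (P.K : ℝ)) * ∑ k ∈ Finset.range P.K, drift μ F P x ci c u v k ≤
      4 * P.K * γ ^ 2 * (a * σu ^ 2 + b * σv ^ 2)
      + 4 * P.K ^ 2 * γ ^ 2 * (a * ‖gradU (localLoss F D i) u v - ci + c‖ ^ 2
        + b * ‖gradV (localLoss F D i) u v‖ ^ 2) := by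
  have hK0 : (0 : ℝ) < P.K := by exact_mod_cast hK
  set M := ∑ k ∈ Finset.range P.K, drift μ F P x ci c u v k with hM
  set R := ‖gradU (localLoss F D i) u v - ci + c‖ ^ 2 with hR
  set H := ‖gradV (localLoss F D i) u v‖ ^ 2 with hH
  have hM0 : 0 ≤ M := Finset.sum_nonneg fun j _ => drift_nonneg ci c u v j
  have hR0 : 0 ≤ R := sq_nonneg _
  have hH0 : 0 ≤ H := sq_nonneg _
  set B := 3 * (a * γ ^ 2) * (P.K * σu ^ 2 + P.K * (2 * L ^ 2 * M) + P.K ^ 2 * R)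
      + 3 * (b * γ ^ 2) * (P.K * σv ^ 2 + P.K * (2 * L ^ 2 * M) + P.K ^ 2 * H) with hB
  have hterm : ∀ k ∈ Finset.range P.K, drift μ F P x ci c u v k ≤ B := by
    intro k hk
    have h0 := h.drift_le ci c u v (Finset.mem_range.1 hk)
    rw [← hM, ← hR, ← hH] at h0
    refine h0.trans ?_
    rw [hB]
    gcongr
  have hMB : M ≤ P.K * B := by
    calc M ≤ ∑ _k ∈ Finset.range P.K, B := Finset.sum_le_sum hterm
      _ = P.K * B := by simp
  have hsq : (L * γ * P.K) ^ 2 ≤ 1 / 5184 := by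
    calc (L * γ * P.K) ^ 2 ≤ (1 / 72) ^ 2 := by gcongr
      _ = _ := by norm_num
  have hg : 0 ≤ γ ^ 2 := sq_nonneg _
  have hag : 0 ≤ a * γ ^ 2 := (sq_nonneg _).trans ha
  have hbg : 0 ≤ b * γ ^ 2 := (sq_nonneg _).trans hb
  set S := a * γ ^ 2 * (P.K * σu ^ 2 + P.K ^ 2 * R) + b * γ ^ 2 * (P.K * σv ^ 2 + P.K ^ 2 * H)
    with hS
  have hS0 : 0 ≤ S := by positivity
  have h1 : (a + b) * (L * γ * P.K) ^ 2 * M ≤ 2 * (1 / 5184) * M := by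
    have : (a + b) * (L * γ * P.K) ^ 2 ≤ 2 * (1 / 5184) :=
      mul_le_mul (by linarith) hsq (sq_nonneg _) (by norm_num)
    exact mul_le_mul_of_nonneg_right this hM0
  have h2 : M ≤ 3 * P.K * S + 6 * ((a + b) * (L * γ * P.K) ^ 2 * M) := by
    refine hMB.trans_eq ?_
    rw [hB, hS]; ring
  -- The accumulated drift occurs on both sides. Its coefficient on the right is at most `12 /
  -- 5184`, so absorbing it raises the constant `3` to at most `4`.
  have h3 : M ≤ 4 * P.K * S := by
    have : 0 ≤ P.K * S := by positivity
    linarith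
  rw [one_div, inv_mul_le_iff₀ hK0]
  refine h3.trans_eq ?_
  rw [hS]; ring

end ClientRun

end Client

end ScaffoldP

end

noncomputable section

set_option linter.unusedSectionVars false

namespace ScaffoldP

/-! ### Bounds on means -/

section MeanLE

variable {Ω : Type*} [mΩ : MeasurableSpace Ω] {μ : Measure Ω}

/-- `f` is integrable with mean at most `b`. -/
def MeanLE (μ : Measure Ω) (f : Ω → ℝ) (b : ℝ) : Prop := Integrable f μ ∧ ∫ ω, f ω ∂μ ≤ b

namespace MeanLE

variable {f g : Ω → ℝ} {a b : ℝ}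

lemma add (hf : MeanLE μ f a) (hg : MeanLE μ g b) : MeanLE μ (fun ω => f ω + g ω) (a + b) :=
  ⟨hf.1.add hg.1, by rw [integral_add hf.1 hg.1]; exact add_le_add hf.2 hg.2⟩

lemma const_mul {r : ℝ} (hr : 0 ≤ r) (hf : MeanLE μ f a) : MeanLE μ (fun ω => r * f ω) (r * a) :=
  ⟨hf.1.const_mul r, by rw [integral_const_mul]; exact mul_le_mul_of_nonneg_left hf.2 hr⟩

lemma const [IsProbabilityMeasure μ] (r : ℝ) : MeanLE μ (fun _ => r) r :=
  ⟨integrable_const r, by simp⟩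

lemma sum {ι : Type*} {s : Finset ι} {f : ι → Ω → ℝ} {b : ι → ℝ}
    (h : ∀ j ∈ s, MeanLE μ (f j) (b j)) : MeanLE μ (fun ω => ∑ j ∈ s, f j ω) (∑ j ∈ s, b j) :=
  ⟨integrable_finsetSum s fun j hj => (h j hj).1, by
    rw [integral_finsetSum s fun j hj => (h j hj).1]
    exact Finset.sum_le_sum fun j hj => (h j hj).2⟩

lemma mono (hf : MeanLE μ f a) (h : a ≤ b) : MeanLE μ f b := ⟨hf.1, hf.2.trans h⟩

lemma dmean {n K : ℕ} {r : Fin n → ℕ → Ω → ℝ} {b : Fin n → ℕ → ℝ}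
    (h : ∀ i, ∀ k < K, MeanLE μ (r i k) (b i k)) :
    MeanLE μ (fun ω => dmean n K fun i k => r i k ω) (ScaffoldP.dmean n K b) :=
  const_mul (by positivity) <| sum fun i _ => const_mul (by positivity) <| sum fun k hk =>
    h i k (Finset.mem_range.1 hk)

end MeanLE

variable {E : Type*} [NormedAddCommGroup E] [InnerProductSpace ℝ E]

lemma meanLE_sq {f : Ω → E} (hf : MemLp f 2 μ) {b : ℝ} (h : sqMean μ f ≤ b) :
    MeanLE μ (fun ω => ‖f ω‖ ^ 2) b :=
  ⟨integrable_norm_sq hf, h⟩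

lemma meanLE_inner [CompleteSpace E] [IsProbabilityMeasure μ] {f : Ω → E} (hf : MemLp f 2 μ)
    (h : ∫ ω, f ω ∂μ = 0) (w : E) : MeanLE μ (fun ω => inner ℝ w (f ω)) 0 := by
  have hi : Integrable f μ := hf.integrable one_le_two
  exact ⟨hi.const_inner w, by rw [integral_inner hi, h, inner_zero_right]⟩

lemma memLp_vmean {n : ℕ} {f : Fin n → Ω → E} (hf : ∀ i, MemLp (f i) 2 μ) :
    MemLp (fun ω => vmean fun i => f i ω) 2 μ :=
  (memLp_sum _ fun i _ => hf i).const_smul (1 / (n : ℝ))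

lemma integral_vmean_eq_zero [IsProbabilityMeasure μ] {n : ℕ}
    {f : Fin n → Ω → E} (hf : ∀ i, MemLp (f i) 2 μ) (h : ∀ i, ∫ ω, f i ω ∂μ = 0) :
    ∫ ω, vmean (fun i => f i ω) ∂μ = 0 := by
  simp only [vmean]
  rw [integral_smul, integral_finsetSum _ fun i _ => (hf i).integrable one_le_two]
  simp [h]

lemma sqMean_vmean_le {n : ℕ} {f : Fin n → Ω → E} (hf : ∀ i, MemLp (f i) 2 μ) :
    sqMean μ (fun ω => vmean fun i => f i ω) ≤ (1 / (n : ℝ)) * ∑ i, sqMean μ (f i) := by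
  have h := MeanLE.const_mul (r := 1 / (n : ℝ)) (by positivity)
    (MeanLE.sum (s := Finset.univ) fun i _ => meanLE_sq (hf i) le_rfl)
  exact (integral_mono (integrable_norm_sq (memLp_vmean hf)) h.1
    fun ω => norm_vmean_sq_le _).trans h.2

end MeanLE

/-! ### The averages of the local gradients -/

section Averages

variable {n du dv : ℕ} {Ξ : Type*} [MeasurableSpace Ξ]
  {F : Vec du → Vec dv → Ξ → ℝ} {D : Fin n → Measure Ξ} [∀ i, IsProbabilityMeasure (D i)]
  {L σu σv : ℝ} {Ω : Type*} [mΩ : MeasurableSpace Ω] {μ : Measure Ω} [IsProbabilityMeasure μ]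

/-- The average over the first `K` terms of a sequence. -/
def tmean {E : Type*} [AddCommGroup E] [Module ℝ E] (K : ℕ) (y : ℕ → E) : E :=
  (1 / (K : ℝ)) • ∑ k ∈ Finset.range K, y k

lemma tmean_add {E : Type*} [AddCommGroup E] [Module ℝ E] (K : ℕ) (y z : ℕ → E) :
    tmean K (fun k => y k + z k) = tmean K y + tmean K z := by
  simp [tmean, Finset.sum_add_distrib]

lemma tmean_sub_const {E : Type*} [AddCommGroup E] [Module ℝ E] {K : ℕ} (hK : 1 ≤ K) (y : ℕ → E)
    (w : E) : tmean K y - w = tmean K fun k => y k - w := by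
  have : (K : ℝ) ≠ 0 := by exact_mod_cast (by omega : K ≠ 0)
  rw [tmean, tmean, Finset.sum_sub_distrib, smul_sub, Finset.sum_const, Finset.card_range,
    ← Nat.cast_smul_eq_nsmul ℝ, smul_smul, one_div_mul_cancel this, one_smul]

lemma norm_tmean_sq_le {E : Type*} [NormedAddCommGroup E] [NormedSpace ℝ E] (K : ℕ) (y : ℕ → E) :
    ‖tmean K y‖ ^ 2 ≤ (1 / (K : ℝ)) * ∑ k ∈ Finset.range K, ‖y k‖ ^ 2 := by
  rcases Nat.eq_zero_or_pos K with rfl | hK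
  · simp [tmean]
  have hK0 : (0 : ℝ) < K := by exact_mod_cast hK
  rw [tmean, norm_smul, mul_pow, Real.norm_eq_abs, sq_abs]
  have h := norm_sum_sq_le (Finset.range K) y
  rw [Finset.card_range] at h
  calc (1 / (K : ℝ)) ^ 2 * ‖∑ k ∈ Finset.range K, y k‖ ^ 2
      ≤ (1 / (K : ℝ)) ^ 2 * (K * ∑ k ∈ Finset.range K, ‖y k‖ ^ 2) := by gcongr
    _ = _ := by field_simp

/-- Average noise of the stochastic gradients in `u` along a sequence of points. -/
def avgNoiseU (F : Vec du → Vec dv → Ξ → ℝ) (D : Fin n → Measure Ξ) (K : ℕ) (i : Fin n)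
    (p : ℕ → Vec du × Vec dv) (x : ℕ → Ξ) : Vec du :=
  tmean K fun k => noiseU F D i (p k) (x k)

/-- Average noise of the stochastic gradients in `v` along a sequence of points. -/
def avgNoiseV (F : Vec du → Vec dv → Ξ → ℝ) (D : Fin n → Measure Ξ) (K : ℕ) (i : Fin n)
    (p : ℕ → Vec du × Vec dv) (x : ℕ → Ξ) : Vec dv :=
  tmean K fun k => noiseV F D i (p k) (x k)

/-- Average gradient in `u` along a sequence of points. -/
def avgGradU (f : Fin n → Vec du → Vec dv → ℝ) (K : ℕ) (i : Fin n)
    (p : ℕ → Vec du × Vec dv) : Vec du :=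
  tmean K fun k => gradU (f i) (p k).1 (p k).2

/-- Average gradient in `v` along a sequence of points. -/
def avgGradV (f : Fin n → Vec du → Vec dv → ℝ) (K : ℕ) (i : Fin n)
    (p : ℕ → Vec du × Vec dv) : Vec dv :=
  tmean K fun k => gradV (f i) (p k).1 (p k).2

/-- The local iterates as a function of the samples. -/
lemma localIter_fst_sub (P : Params) (hK : 1 ≤ P.K) (i : Fin n)
    (ci c u : Vec du) (v : Vec dv) (x : ℕ → Ξ) :
    u - (localIter F P ci c u v x P.K).1 = (P.K * P.γu) •
      (avgNoiseU F D P.K i (localIter F P ci c u v x) x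
        + avgGradU (localLoss F D) P.K i (localIter F P ci c u v x) - ci + c) := by
  have hK0 : (P.K : ℝ) ≠ 0 := by exact_mod_cast (by omega : P.K ≠ 0)
  have h : ∀ w : Vec du, w = tmean P.K fun _ => w := fun w => by
    rw [tmean, Finset.sum_const, Finset.card_range, ← Nat.cast_smul_eq_nsmul ℝ, smul_smul,
      one_div_mul_cancel hK0, one_smul]
  rw [localIter_fst, sub_sub_cancel, avgNoiseU, avgGradU, ← tmean_add, sub_add,
    tmean_sub_const hK, tmean, smul_smul, mul_comm (P.K : ℝ), mul_assoc,
    mul_one_div_cancel hK0, mul_one]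
  congr 1
  refine Finset.sum_congr rfl fun k _ => ?_
  simp only [noiseU]
  abel

lemma localIter_snd_sub (P : Params) (hK : 1 ≤ P.K) (i : Fin n)
    (ci c u : Vec du) (v : Vec dv) (x : ℕ → Ξ) :
    (localIter F P ci c u v x P.K).2 = v - (P.K * P.γv) •
      (avgNoiseV F D P.K i (localIter F P ci c u v x) x
        + avgGradV (localLoss F D) P.K i (localIter F P ci c u v x)) := by
  have hK0 : (P.K : ℝ) ≠ 0 := by exact_mod_cast (by omega : P.K ≠ 0)
  rw [localIter_snd, avgNoiseV, avgGradV, ← tmean_add, tmean, smul_smul, mul_comm (P.K : ℝ),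
    mul_assoc, mul_one_div_cancel hK0, mul_one]
  congr 2
  refine Finset.sum_congr rfl fun k _ => ?_
  simp only [noiseV]
  abel

namespace ClientRun

variable {P : Params} {i : Fin n} {x : ℕ → Ω → Ξ} {𝓕 : ℕ → MeasurableSpace Ω}
  (ci c u : Vec du) (v : Vec dv)

lemma memLp_avgNoiseU (h : ClientRun μ F D L σu σv P i x 𝓕) :
    MemLp (fun ω => avgNoiseU F D P.K i (localIter F P ci c u v fun k => x k ω)
      fun k => x k ω) 2 μ :=
  (memLp_sum _ fun _ hk => h.fresh.memLp_noise h.isNoiseU (h.measurable_iter ci c u v)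
    (Finset.mem_range.1 hk)).const_smul (1 / (P.K : ℝ))

lemma memLp_avgNoiseV (h : ClientRun μ F D L σu σv P i x 𝓕) :
    MemLp (fun ω => avgNoiseV F D P.K i (localIter F P ci c u v fun k => x k ω)
      fun k => x k ω) 2 μ :=
  (memLp_sum _ fun _ hk => h.fresh.memLp_noise h.isNoiseV (h.measurable_iter ci c u v)
    (Finset.mem_range.1 hk)).const_smul (1 / (P.K : ℝ))

lemma memLp_avgGradU (h : ClientRun μ F D L σu σv P i x 𝓕) :
    MemLp (fun ω => avgGradU (localLoss F D) P.K i (localIter F P ci c u v fun k => x k ω)) 2 μ :=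
  (memLp_sum _ fun _ hk =>
    h.memLp_gradU_iter ci c u v (Finset.mem_range.1 hk).le).const_smul (1 / (P.K : ℝ))

lemma memLp_avgGradV (h : ClientRun μ F D L σu σv P i x 𝓕) :
    MemLp (fun ω => avgGradV (localLoss F D) P.K i (localIter F P ci c u v fun k => x k ω)) 2 μ :=
  (memLp_sum _ fun _ hk =>
    h.memLp_gradV_iter ci c u v (Finset.mem_range.1 hk).le).const_smul (1 / (P.K : ℝ))

lemma sqMean_avgNoiseU_le (h : ClientRun μ F D L σu σv P i x 𝓕) (hK : 1 ≤ P.K) :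
    sqMean μ (fun ω => avgNoiseU F D P.K i (localIter F P ci c u v fun k => x k ω)
      fun k => x k ω) ≤ σu ^ 2 / P.K := by
  have hK0 : (0 : ℝ) < P.K := by exact_mod_cast hK
  have h1 := h.fresh.sqMean_sum_noise_le h.isNoiseU (h.measurable_iter ci c u v) le_rfl
  simp only [avgNoiseU, tmean]
  rw [sqMean_smul]
  calc _ ≤ (1 / (P.K : ℝ)) ^ 2 * (P.K * σu ^ 2) := by gcongr
    _ = _ := by field_simp

lemma sqMean_avgNoiseV_le (h : ClientRun μ F D L σu σv P i x 𝓕) (hK : 1 ≤ P.K) :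
    sqMean μ (fun ω => avgNoiseV F D P.K i (localIter F P ci c u v fun k => x k ω)
      fun k => x k ω) ≤ σv ^ 2 / P.K := by
  have hK0 : (0 : ℝ) < P.K := by exact_mod_cast hK
  have h1 := h.fresh.sqMean_sum_noise_le h.isNoiseV (h.measurable_iter ci c u v) le_rfl
  simp only [avgNoiseV, tmean]
  rw [sqMean_smul]
  calc _ ≤ (1 / (P.K : ℝ)) ^ 2 * (P.K * σv ^ 2) := by gcongr
    _ = _ := by field_simp

/-- Here `φ` may be anything known before the first local step. Since `𝓕 0` will later contain the
samples of all other clients, this also yields orthogonality between clients. -/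
lemma integral_inner_avgNoiseU (h : ClientRun μ F D L σu σv P i x 𝓕) {φ : Ω → Vec du}
    (hφ : Measurable[𝓕 0] φ) (hφ2 : MemLp φ 2 μ) :
    ∫ ω, inner ℝ (φ ω) (avgNoiseU F D P.K i (localIter F P ci c u v fun k => x k ω)
      fun k => x k ω) ∂μ = 0 := by
  simp only [avgNoiseU, tmean, inner_smul_right, inner_sum]
  rw [integral_const_mul, integral_finsetSum, Finset.sum_eq_zero, mul_zero]
  · intro k hk
    exact h.fresh.integral_inner_noise h.isNoiseU (h.measurable_iter ci c u v)
      (Finset.mem_range.1 hk) (hφ.mono (h.fresh.mono (Nat.zero_le k)) le_rfl) hφ2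
  · intro k hk
    exact integrable_inner_of_memLp hφ2 (h.fresh.memLp_noise h.isNoiseU
      (h.measurable_iter ci c u v) (Finset.mem_range.1 hk))

lemma integral_inner_avgNoiseV (h : ClientRun μ F D L σu σv P i x 𝓕) {φ : Ω → Vec dv}
    (hφ : Measurable[𝓕 0] φ) (hφ2 : MemLp φ 2 μ) :
    ∫ ω, inner ℝ (φ ω) (avgNoiseV F D P.K i (localIter F P ci c u v fun k => x k ω)
      fun k => x k ω) ∂μ = 0 := by
  simp only [avgNoiseV, tmean, inner_smul_right, inner_sum]
  rw [integral_const_mul, integral_finsetSum, Finset.sum_eq_zero, mul_zero]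
  · intro k hk
    exact h.fresh.integral_inner_noise h.isNoiseV (h.measurable_iter ci c u v)
      (Finset.mem_range.1 hk) (hφ.mono (h.fresh.mono (Nat.zero_le k)) le_rfl) hφ2
  · intro k hk
    exact integrable_inner_of_memLp hφ2 (h.fresh.memLp_noise h.isNoiseV
      (h.measurable_iter ci c u v) (Finset.mem_range.1 hk))

lemma integral_avgNoiseU (h : ClientRun μ F D L σu σv P i x 𝓕) :
    ∫ ω, avgNoiseU F D P.K i (localIter F P ci c u v fun k => x k ω) (fun k => x k ω) ∂μ = 0 := by
  refine ext_inner_left ℝ fun w => ?_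
  rw [← integral_inner ((h.memLp_avgNoiseU ci c u v).integrable one_le_two), inner_zero_right]
  exact h.integral_inner_avgNoiseU ci c u v measurable_const (memLp_const w)

lemma integral_avgNoiseV (h : ClientRun μ F D L σu σv P i x 𝓕) :
    ∫ ω, avgNoiseV F D P.K i (localIter F P ci c u v fun k => x k ω) (fun k => x k ω) ∂μ = 0 := by
  refine ext_inner_left ℝ fun w => ?_
  rw [← integral_inner ((h.memLp_avgNoiseV ci c u v).integrable one_le_two), inner_zero_right]
  exact h.integral_inner_avgNoiseV ci c u v measurable_const (memLp_const w)

lemma sqMean_avgGradU_sub_le (h : ClientRun μ F D L σu σv P i x 𝓕) (hK : 1 ≤ P.K) :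
    sqMean μ (fun ω => avgGradU (localLoss F D) P.K i (localIter F P ci c u v fun k => x k ω)
      - gradU (localLoss F D i) u v)
      ≤ 2 * L ^ 2 * ((1 / (P.K : ℝ)) * ∑ k ∈ Finset.range P.K, drift μ F P x ci c u v k) := by
  have hm := MeanLE.const_mul (r := 1 / (P.K : ℝ)) (by positivity)
    (MeanLE.sum (s := Finset.range P.K) fun k hk => meanLE_sq
      ((h.memLp_gradU_iter ci c u v (Finset.mem_range.1 hk).le).sub (memLp_const _))
      (h.sqMean_gradU_sub_le ci c u v (Finset.mem_range.1 hk).le))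
  refine (integral_mono (integrable_norm_sq ((h.memLp_avgGradU ci c u v).sub (memLp_const _)))
    hm.1 fun ω => ?_).trans (hm.2.trans_eq ?_)
  · simp only [avgGradU, Pi.sub_apply, tmean_sub_const hK]
    exact norm_tmean_sq_le _ _
  · rw [← Finset.mul_sum]; ring

lemma sqMean_avgGradV_sub_le (h : ClientRun μ F D L σu σv P i x 𝓕) (hK : 1 ≤ P.K) :
    sqMean μ (fun ω => avgGradV (localLoss F D) P.K i (localIter F P ci c u v fun k => x k ω)
      - gradV (localLoss F D i) u v)
      ≤ 2 * L ^ 2 * ((1 / (P.K : ℝ)) * ∑ k ∈ Finset.range P.K, drift μ F P x ci c u v k) := by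
  have hm := MeanLE.const_mul (r := 1 / (P.K : ℝ)) (by positivity)
    (MeanLE.sum (s := Finset.range P.K) fun k hk => meanLE_sq
      ((h.memLp_gradV_iter ci c u v (Finset.mem_range.1 hk).le).sub (memLp_const _))
      (h.sqMean_gradV_sub_le ci c u v (Finset.mem_range.1 hk).le))
  refine (integral_mono (integrable_norm_sq ((h.memLp_avgGradV ci c u v).sub (memLp_const _)))
    hm.1 fun ω => ?_).trans (hm.2.trans_eq ?_)
  · simp only [avgGradV, Pi.sub_apply, tmean_sub_const hK]
    exact norm_tmean_sq_le _ _
  · rw [← Finset.mul_sum]; ring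

end ClientRun

end Averages

end ScaffoldP

end

noncomputable section

set_option linter.unusedSectionVars false

namespace ScaffoldP

/-! ### The mean progress of one round -/

section UpperMean

variable {Ω : Type*} [mΩ : MeasurableSpace Ω] {μ : Measure Ω}

/-- `f` has an integrable majorant with mean at most `b`. -/
def UpperMean (μ : Measure Ω) (f : Ω → ℝ) (b : ℝ) : Prop :=
  ∃ q : Ω → ℝ, (∀ ω, f ω ≤ q ω) ∧ MeanLE μ q b

lemma MeanLE.upperMean {f g : Ω → ℝ} {b : ℝ} (hg : MeanLE μ g b) (h : ∀ ω, f ω ≤ g ω) :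
    UpperMean μ f b :=
  ⟨g, h, hg⟩

namespace UpperMean

variable {f g : Ω → ℝ} {a b : ℝ}

lemma add (hf : UpperMean μ f a) (hg : UpperMean μ g b) :
    UpperMean μ (fun ω => f ω + g ω) (a + b) := by
  obtain ⟨q, hq, hq'⟩ := hf
  obtain ⟨r, hr, hr'⟩ := hg
  exact ⟨fun ω => q ω + r ω, fun ω => add_le_add (hq ω) (hr ω), hq'.add hr'⟩

lemma const_mul {r : ℝ} (hr : 0 ≤ r) (hf : UpperMean μ f a) :
    UpperMean μ (fun ω => r * f ω) (r * a) := by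
  obtain ⟨q, hq, hq'⟩ := hf
  exact ⟨fun ω => r * q ω, fun ω => mul_le_mul_of_nonneg_left (hq ω) hr, hq'.const_mul hr⟩

lemma const [IsProbabilityMeasure μ] (r : ℝ) : UpperMean μ (fun _ => r) r :=
  (MeanLE.const r).upperMean fun _ => le_rfl

lemma mono (hf : UpperMean μ f a) (h : a ≤ b) : UpperMean μ f b := by
  obtain ⟨q, hq, hq'⟩ := hf
  exact ⟨q, hq, hq'.mono h⟩

lemma of_le (hg : UpperMean μ g a) (h : ∀ ω, f ω ≤ g ω) : UpperMean μ f a := by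
  obtain ⟨q, hq, hq'⟩ := hg
  exact ⟨q, fun ω => (h ω).trans (hq ω), hq'⟩

end UpperMean

end UpperMean

/-! ### Mean bounds for the terms of one round, from a fixed state -/

section RoundData

variable {n du dv : ℕ} {Ω : Type*} [mΩ : MeasurableSpace Ω] {μ : Measure Ω}
  [IsProbabilityMeasure μ]

/-- Noise `e, d` and average gradients `a, g` of one round started at `(u, v)`, where the gradients
are `b, h`; the local iterates are `Mp` and their mean drift is at most `W`. -/
structure RoundData (μ : Measure Ω) (K : ℕ) (Su Sv L W : ℝ) (b : Fin n → Vec du)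
    (h : Fin n → Vec dv) (u : Vec du) (v : Fin n → Vec dv) (e a : Fin n → Ω → Vec du)
    (d g : Fin n → Ω → Vec dv) (Mp : Fin n → ℕ → Ω → Vec du × Vec dv) : Prop where
  memLp_e : ∀ i, MemLp (e i) 2 μ
  memLp_a : ∀ i, MemLp (a i) 2 μ
  memLp_d : ∀ i, MemLp (d i) 2 μ
  memLp_g : ∀ i, MemLp (g i) 2 μ
  integral_e : ∀ i, ∫ ω, e i ω ∂μ = 0
  integral_d : ∀ i, ∫ ω, d i ω ∂μ = 0
  sqMean_e : ∀ i, sqMean μ (e i) ≤ Su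
  sqMean_d : ∀ i, sqMean μ (d i) ≤ Sv
  sqMean_vmean_e : sqMean μ (fun ω => vmean fun i => e i ω) ≤ Su / n
  sqMean_a_sub : (1 / (n : ℝ)) * ∑ i, sqMean μ (fun ω => a i ω - b i) ≤ 2 * L ^ 2 * W
  sqMean_g_sub : (1 / (n : ℝ)) * ∑ i, sqMean μ (fun ω => g i ω - h i) ≤ 2 * L ^ 2 * W
  lag_le : MeanLE μ (fun ω => lag K u v fun i k => Mp i k ω) W

namespace RoundData

variable {K m : ℕ} {Su Sv L W : ℝ} {b : Fin n → Vec du} {h : Fin n → Vec dv} {u : Vec du}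
  {v : Fin n → Vec dv} {e a : Fin n → Ω → Vec du} {d g : Fin n → Ω → Vec dv}
  {Mp : Fin n → ℕ → Ω → Vec du × Vec dv}

lemma meanLE_vmean_a_sub (R : RoundData μ K Su Sv L W b h u v e a d g Mp) :
    MeanLE μ (fun ω => ‖vmean (fun i => a i ω) - vmean b‖ ^ 2) (2 * L ^ 2 * W) := by
  have hm : ∀ i, MemLp (fun ω => a i ω - b i) 2 μ := fun i => (R.memLp_a i).sub (memLp_const _)
  have := meanLE_sq (memLp_vmean hm) ((sqMean_vmean_le hm).trans R.sqMean_a_sub)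
  simpa only [vmean_sub] using this

lemma meanLE_vmean_a (R : RoundData μ K Su Sv L W b h u v e a d g Mp) :
    MeanLE μ (fun ω => ‖vmean (fun i => a i ω)‖ ^ 2) (2 * ‖vmean b‖ ^ 2 + 4 * L ^ 2 * W) := by
  have h1 := ((MeanLE.const (μ := μ) (2 * ‖vmean b‖ ^ 2)).add
    (R.meanLE_vmean_a_sub.const_mul zero_le_two)).mono (b := 2 * ‖vmean b‖ ^ 2 + 4 * L ^ 2 * W)
    (by linarith)
  have hi := integrable_norm_sq (memLp_vmean R.memLp_a)
  refine ⟨hi, (integral_mono hi h1.1 fun ω => ?_).trans h1.2⟩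
  have := norm_add_sq_le_two (vmean b) (vmean (fun i => a i ω) - vmean b)
  rwa [add_sub_cancel] at this

/-- Distance of the average gradients to the control variables `ci`, where `w` are the averages
of the gradients at the remembered points. -/
lemma meanLE_sub_ctrl (R : RoundData μ K Su Sv L W b h u v e a d g Mp) (ci w : Fin n → Vec du)
    {X N : ℝ} (hX : (1 / (n : ℝ)) * ∑ i, ‖b i - w i‖ ^ 2 ≤ 2 * L ^ 2 * X)
    (hN : (1 / (n : ℝ)) * ∑ i, ‖ci i - w i‖ ^ 2 ≤ N) :
    MeanLE μ (fun ω => (1 / (n : ℝ)) * ∑ i, ‖a i ω - ci i‖ ^ 2)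
      (6 * L ^ 2 * W + 6 * L ^ 2 * X + 3 * N) := by
  -- The difference passes through the current gradient `b i` and the remembered average `w i` of
  -- the same client, so each piece is drift, lag or stored noise and heterogeneity never enters.
  have h1 : ∀ i, sqMean μ (fun ω => a i ω - ci i)
      ≤ 3 * (sqMean μ (fun ω => a i ω - b i) + ‖b i - w i‖ ^ 2 + ‖ci i - w i‖ ^ 2) := by
    intro i
    have := sqMean_add_add_le (μ := μ) ((R.memLp_a i).sub (memLp_const (b i)))
      (memLp_const (b i - w i)) (memLp_const (w i - ci i))
    simp only [Pi.sub_apply, sqMean_const, norm_sub_rev (w i)] at this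
    refine le_of_eq_of_le ?_ this
    congr 1
    ext1 ω
    abel
  refine (MeanLE.const_mul (by positivity) (MeanLE.sum fun i _ =>
    meanLE_sq ((R.memLp_a i).sub (memLp_const (ci i))) (h1 i))).mono ?_
  rw [← Finset.mul_sum, Finset.sum_add_distrib, Finset.sum_add_distrib]
  have := R.sqMean_a_sub
  linarith

/-- The client corrections cancel on average because the server variable is their mean; they
influence only the spread of the steps. -/
lemma vmean_step (hn : 1 ≤ n) {ci : Fin n → Vec du} {c : Vec du} (hc : c = vmean ci) (ω : Ω) :
    vmean (fun i => e i ω + a i ω - ci i + c)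
      = vmean (fun i => e i ω) + vmean (fun i => a i ω) := by
  rw [vmean_add, vmean_sub, vmean_add, vmean_const hn, ← hc, sub_add_cancel]

/-- The spread, which governs the sampling variance, sees the gradient only through `a i - ci i`.
This is the variance reduction provided by the control variables. -/
lemma step_sub_vmean (hn : 1 ≤ n) (ci : Fin n → Vec du) (c : Vec du) (ω : Ω) (i : Fin n) :
    (e i ω + a i ω - ci i + c) - vmean (fun i => e i ω + a i ω - ci i + c)
      = (e i ω - vmean fun i => e i ω)
        + ((a i ω - ci i) - vmean fun i => a i ω - ci i) := by
  rw [vmean_add, vmean_sub, vmean_add, vmean_const hn, vmean_sub]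
  abel

/-- The mean squared length of the step in `u`. -/
lemma upperMean_stepU (R : RoundData μ K Su Sv L W b h u v e a d g Mp) (hm : 1 ≤ m) (hmn : m ≤ n)
    {ci : Fin n → Vec du} {c : Vec du} (hc : c = vmean ci) {Z : ℝ}
    (hZ : MeanLE μ (fun ω => (1 / (n : ℝ)) * ∑ i, ‖a i ω - ci i‖ ^ 2) Z) :
    UpperMean μ (fun ω => subsetAvg m fun A =>
      ‖(1 / (m : ℝ)) • ∑ i ∈ A, (e i ω + a i ω - ci i + c)‖ ^ 2)
      (2 * (Su / n) + 2 * (2 * ‖vmean b‖ ^ 2 + 4 * L ^ 2 * W)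
        + (1 / (m : ℝ)) * (2 * Su + 2 * Z)) := by
  have hn := hm.trans hmn
  have hn0 : (n : ℝ) ≠ 0 := by exact_mod_cast (by omega : n ≠ 0)
  have he : MeanLE μ (fun ω => (1 / (n : ℝ)) * ∑ i, ‖e i ω‖ ^ 2) Su := by
    refine (MeanLE.const_mul (by positivity) (MeanLE.sum fun i _ =>
      meanLE_sq (R.memLp_e i) (R.sqMean_e i))).mono (le_of_eq ?_)
    simp only [Finset.sum_const, Finset.card_univ, Fintype.card_fin, nsmul_eq_mul]
    field_simp
  refine ((((meanLE_sq (memLp_vmean R.memLp_e) R.sqMean_vmean_e).const_mul zero_le_two).add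
    (R.meanLE_vmean_a.const_mul zero_le_two)).add (MeanLE.const_mul
      (r := 1 / (m : ℝ)) (by positivity) ((he.const_mul zero_le_two).add
      (hZ.const_mul zero_le_two)))).upperMean fun ω => ?_
  refine (subsetAvg_norm_sq_le hm hmn _).trans (add_le_add ?_ ?_)
  · rw [vmean_step hn hc]
    exact norm_add_sq_le_two _ _
  · have h1 : ∑ i, ‖(e i ω + a i ω - ci i + c) - vmean fun i => e i ω + a i ω - ci i + c‖ ^ 2
        ≤ ∑ i, ‖e i ω + (a i ω - ci i)‖ ^ 2 := by
      refine le_of_eq_of_le (Finset.sum_congr rfl fun i _ => ?_) (sum_norm_sub_vmean_sq_le _)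
      rw [step_sub_vmean hn, vmean_add]
      congr 2
      abel
    have h2 : ∑ i, ‖e i ω + (a i ω - ci i)‖ ^ 2
        ≤ 2 * ∑ i, ‖e i ω‖ ^ 2 + 2 * ∑ i, ‖a i ω - ci i‖ ^ 2 := by
      rw [Finset.mul_sum, Finset.mul_sum, ← Finset.sum_add_distrib]
      exact Finset.sum_le_sum fun i _ => norm_add_sq_le_two _ _
    refine mul_le_mul_of_nonneg_left ?_ (by positivity)
    calc _ ≤ (1 / (n : ℝ)) * (2 * ∑ i, ‖e i ω‖ ^ 2 + 2 * ∑ i, ‖a i ω - ci i‖ ^ 2) :=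
          mul_le_mul_of_nonneg_left (h1.trans h2) (by positivity)
      _ = _ := by ring

/-- The mean squared length of the steps in `v`. -/
lemma upperMean_stepV (R : RoundData μ K Su Sv L W b h u v e a d g Mp) (hn : 1 ≤ n) :
    UpperMean μ (fun ω => (1 / (n : ℝ)) * ∑ i, ‖d i ω + g i ω‖ ^ 2)
      (2 * Sv + 4 * ((1 / (n : ℝ)) * ∑ i, ‖h i‖ ^ 2) + 8 * L ^ 2 * W) := by
  have hn0 : (n : ℝ) ≠ 0 := by exact_mod_cast (by omega : n ≠ 0)
  have h1 : MeanLE μ (fun ω => (1 / (n : ℝ)) * ∑ i,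
      (2 * ‖d i ω‖ ^ 2 + 4 * ‖g i ω - h i‖ ^ 2 + 4 * ‖h i‖ ^ 2))
      ((1 / (n : ℝ)) * ∑ i,
        (2 * Sv + 4 * sqMean μ (fun ω => g i ω - h i) + 4 * ‖h i‖ ^ 2)) :=
    MeanLE.const_mul (by positivity) (MeanLE.sum fun i _ =>
      (((meanLE_sq (R.memLp_d i) (R.sqMean_d i)).const_mul zero_le_two).add
        ((meanLE_sq ((R.memLp_g i).sub (memLp_const (h i))) le_rfl).const_mul
          zero_le_four)).add (MeanLE.const _))
  refine UpperMean.mono (h1.upperMean fun ω => ?_) ?_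
  · gcongr with i
    have e1 := norm_add_sq_le_two (d i ω) (g i ω)
    have e2 := norm_add_sq_le_two (g i ω - h i) (h i)
    rw [sub_add_cancel] at e2
    linarith
  · have := R.sqMean_g_sub
    simp only [Finset.sum_add_distrib, ← Finset.mul_sum, Finset.sum_const, Finset.card_univ,
      Fintype.card_fin, nsmul_eq_mul]
    have e3 : 1 / (n : ℝ) * (n * (2 * Sv)) = 2 * Sv := by field_simp
    nlinarith

/-- The mean progress along the gradient in `u`. -/
lemma upperMean_innerU (R : RoundData μ K Su Sv L W b h u v e a d g Mp) (hn : 1 ≤ n)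
    {ci : Fin n → Vec du} {c : Vec du} (hc : c = vmean ci) :
    UpperMean μ (fun ω => -inner ℝ (vmean b) (vmean fun i => e i ω + a i ω - ci i + c))
      (-(‖vmean b‖ ^ 2 / 2) + L ^ 2 * W) := by
  have h1 := ((meanLE_inner (memLp_vmean R.memLp_e)
    (integral_vmean_eq_zero R.memLp_e R.integral_e) (-vmean b)).add
    (MeanLE.const (-(‖vmean b‖ ^ 2 / 2)))).add
      (R.meanLE_vmean_a_sub.const_mul (r := 1 / 2) (by norm_num))
  refine UpperMean.mono (h1.upperMean fun ω => ?_) (by linarith)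
  rw [vmean_step hn hc, inner_add_right, inner_neg_left]
  -- Polarization: `-⟨b, a⟩ = (‖a - b‖² - ‖a‖² - ‖b‖²)/2` for the means of `a` and `b`, and `-‖a‖²`
  -- is discarded. The noise part of the step has mean zero against the fixed vector `vmean b`.
  have := norm_sub_sq_real (vmean fun i => a i ω) (vmean b)
  rw [real_inner_comm] at this
  nlinarith [sq_nonneg ‖vmean fun i => a i ω‖]

/-- The mean progress along the gradients in `v`. -/
lemma upperMean_innerV (R : RoundData μ K Su Sv L W b h u v e a d g Mp) :
    UpperMean μ (fun ω => -((1 / (n : ℝ)) * ∑ i, inner ℝ (h i) (d i ω + g i ω)))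
      (-((1 / (n : ℝ)) * ∑ i, ‖h i‖ ^ 2) / 2 + L ^ 2 * W) := by
  have h1 : MeanLE μ (fun ω => (1 / (n : ℝ)) * ∑ i,
      (inner ℝ (-h i) (d i ω) + -(‖h i‖ ^ 2 / 2) + 1 / 2 * ‖g i ω - h i‖ ^ 2))
      ((1 / (n : ℝ)) * ∑ i, (0 + -(‖h i‖ ^ 2 / 2) + 1 / 2 * sqMean μ (fun ω => g i ω - h i))) :=
    MeanLE.const_mul (by positivity) (MeanLE.sum fun i _ =>
      ((meanLE_inner (R.memLp_d i) (R.integral_d i) (-h i)).add (MeanLE.const _)).add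
        ((meanLE_sq ((R.memLp_g i).sub (memLp_const (h i))) le_rfl).const_mul (by norm_num)))
  refine UpperMean.mono (h1.upperMean fun ω => ?_) ?_
  · rw [← mul_neg, ← Finset.sum_neg_distrib]
    gcongr with i
    rw [inner_add_right, inner_neg_left]
    have := norm_sub_sq_real (g i ω) (h i)
    rw [real_inner_comm] at this
    nlinarith [sq_nonneg ‖g i ω‖]
  · have := R.sqMean_g_sub
    simp only [zero_add, Finset.sum_add_distrib, ← Finset.mul_sum, Finset.sum_neg_distrib,
      ← Finset.sum_div]
    nlinarith

/-- The mean of the cross terms in the update of the lag. -/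
lemma upperMean_cross (R : RoundData μ K Su Sv L W b h u v e a d g Mp) (hm : 1 ≤ m)
    (hmn : m ≤ n) (hK : 1 ≤ K) {ci : Fin n → Vec du} {c : Vec du} (hc : c = vmean ci) {Z : ℝ}
    (hZ : MeanLE μ (fun ω => (1 / (n : ℝ)) * ∑ i, ‖a i ω - ci i‖ ^ 2) Z)
    {κ : ℝ} (hκ0 : 0 ≤ κ) (hκn : κ ≤ 1 / (n : ℝ)) (M : Fin n → ℕ → Vec du × Vec dv) (B : ℝ) :
    UpperMean μ (fun ω => 2 * B * dmean n K fun i k =>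
        (1 - (m : ℝ) / n) * inner ℝ ((M i k).1 - u) (vmean fun i => e i ω + a i ω - ci i + c)
        - κ * inner ℝ ((M i k).1 - u) ((e i ω + a i ω - ci i + c)
            - vmean fun i => e i ω + a i ω - ci i + c))
      ((m : ℝ) / n / 2 * lag K u v M
        + 4 / ((m : ℝ) / n) * B ^ 2 * (2 * ‖vmean b‖ ^ 2 + 4 * L ^ 2 * W)
        + 4 / ((m : ℝ) * n) * B ^ 2 * Z) := by
  have hn := hm.trans hmn
  have hn0 : (0 : ℝ) < n := by exact_mod_cast hn
  have hm0 : (0 : ℝ) < m := by exact_mod_cast hm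
  set p : ℝ := (m : ℝ) / n with hp
  have hp0 : 0 < p := by positivity
  have hp1 : p ≤ 1 := by rw [hp, div_le_one hn0]; exact_mod_cast hmn
  -- The noise part of the cross terms, collected into one vector per client. It is paired with `(M
  -- i k).1 - u`, which is fixed during the round, so it vanishes in the mean and needs no Young
  -- inequality.
  let ne : Fin n → Ω → Vec du := fun i ω => (2 * B) •
    ((1 - p) • vmean (fun i => e i ω) - κ • (e i ω - vmean fun i => e i ω))
  have hme := memLp_vmean R.memLp_e
  have hne2 : ∀ i, MemLp (ne i) 2 μ := fun i =>
    ((hme.const_smul (1 - p)).sub (((R.memLp_e i).sub hme).const_smul κ)).const_smul (2 * B)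
  have hne0 : ∀ i, ∫ ω, ne i ω ∂μ = 0 := by
    intro i
    have i1 := hme.integrable one_le_two
    have i2 := (R.memLp_e i).integrable one_le_two
    simp only [ne]
    rw [integral_smul, integral_sub, integral_smul, integral_smul, integral_sub i2 i1,
      integral_vmean_eq_zero R.memLp_e R.integral_e, R.integral_e]
    · simp
    · exact i1.smul (1 - p)
    · exact (i2.sub i1).smul κ
  have h1 : MeanLE μ (fun ω => dmean n K fun i k => inner ℝ ((M i k).1 - u) (ne i ω))
      (dmean n K fun _ _ => 0) :=
    MeanLE.dmean fun i k _ => meanLE_inner (hne2 i) (hne0 i) _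
  rw [dmean_const hn hK] at h1
  have h2 := ((h1.add (MeanLE.const (p / 2 * lag K u v M))).add
    (R.meanLE_vmean_a.const_mul (r := 4 / p * B ^ 2) (by positivity))).add
      (hZ.const_mul (r := 4 / ((m : ℝ) * n) * B ^ 2) (by positivity))
  refine UpperMean.mono (h2.upperMean fun ω => ?_) (by linarith)
  rw [← dmean_mul_left]
  set za : Vec du := vmean fun i => a i ω with hza
  set z : Fin n → Vec du := fun i => (a i ω - ci i) - vmean fun i => a i ω - ci i with hz
  -- Two applications with weight `p / 4` use up `p / 2` of the lag. Together with `1 - p` from the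
  -- unsampled clients this leaves a contraction by `1 - p / 2`.
  have young : ∀ (x w : Vec du) (r : ℝ), 2 * r * inner ℝ x w
      ≤ p / 4 * ‖x‖ ^ 2 + 4 / p * r ^ 2 * ‖w‖ ^ 2 := by
    intro x w r
    have e1 := norm_sub_sq_real ((p / 4) • x) (r • w)
    rw [inner_smul_left, inner_smul_right, norm_smul, norm_smul, mul_pow, mul_pow,
      Real.norm_eq_abs, Real.norm_eq_abs, sq_abs, sq_abs, conj_trivial] at e1
    have e2 : p / 4 * ‖x‖ ^ 2 + 4 / p * r ^ 2 * ‖w‖ ^ 2 - 2 * r * inner ℝ x w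
        = 4 / p * ‖(p / 4) • x - r • w‖ ^ 2 := by
      rw [e1]; field_simp; ring
    have e3 : 0 ≤ 4 / p * ‖(p / 4) • x - r • w‖ ^ 2 := by positivity
    linarith
  have hterm : ∀ i k, 2 * B * ((1 - p) * inner ℝ ((M i k).1 - u)
        (vmean fun i => e i ω + a i ω - ci i + c)
        - κ * inner ℝ ((M i k).1 - u) ((e i ω + a i ω - ci i + c)
            - vmean fun i => e i ω + a i ω - ci i + c))
      ≤ inner ℝ ((M i k).1 - u) (ne i ω)
        + p / 2 * (‖(M i k).1 - u‖ ^ 2 + ‖(M i k).2 - v i‖ ^ 2)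
        + 4 / p * B ^ 2 * ‖za‖ ^ 2 + 4 / ((m : ℝ) * n) * B ^ 2 * ‖z i‖ ^ 2 := by
    intro i k
    rw [step_sub_vmean hn, vmean_step hn hc]
    have y1 := young ((M i k).1 - u) za (B * (1 - p))
    have y2 := young ((M i k).1 - u) (z i) (-(B * κ))
    have y3 : 4 / p * (B * (1 - p)) ^ 2 * ‖za‖ ^ 2 ≤ 4 / p * B ^ 2 * ‖za‖ ^ 2 := by
      have : (B * (1 - p)) ^ 2 ≤ B ^ 2 := by
        rw [mul_pow]
        exact mul_le_of_le_one_right (sq_nonneg _) (by nlinarith)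
      gcongr
    -- The bias `κ ≤ 1 / n` compensates the large Young constant: `4 / p · 1 / n² = 4 / (m n)`.
    have y4 : 4 / p * (-(B * κ)) ^ 2 * ‖z i‖ ^ 2 ≤ 4 / ((m : ℝ) * n) * B ^ 2 * ‖z i‖ ^ 2 := by
      have hκ2 : κ ^ 2 ≤ (1 / (n : ℝ)) ^ 2 := by gcongr
      have : 4 / p * (-(B * κ)) ^ 2 ≤ 4 / ((m : ℝ) * n) * B ^ 2 := by
        calc 4 / p * (-(B * κ)) ^ 2 = 4 / p * B ^ 2 * κ ^ 2 := by ring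
          _ ≤ 4 / p * B ^ 2 * (1 / (n : ℝ)) ^ 2 := by gcongr
          _ = _ := by rw [hp]; field_simp
      gcongr
    have y5 : 0 ≤ p / 2 * ‖(M i k).2 - v i‖ ^ 2 := by positivity
    simp only [ne, inner_add_right, inner_smul_right, inner_sub_right] at y2 ⊢
    simp only [hz, inner_sub_right] at y2 y4 ⊢
    linarith
  refine (dmean_mono hterm).trans ?_
  rw [dmean_add, dmean_add, dmean_add, dmean_const hn hK, dmean_mul_left (p / 2),
    dmean_mul_left (4 / ((m : ℝ) * n) * B ^ 2), dmean_left hK]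
  refine add_le_add le_rfl ?_
  gcongr 4 / ((m : ℝ) * n) * B ^ 2 * (1 / (n : ℝ) * ?_)
  exact sum_norm_sub_vmean_sq_le _

end RoundData

end RoundData

end ScaffoldP

end

noncomputable section

set_option linter.unusedSectionVars false

namespace ScaffoldP

/-! ### Choice of the constants -/

section Constants

/-- The constants of the one-round inequality, in normalized variables. -/
lemma normalized_progress_le {θ Y s x ν G h : ℝ} (hθ0 : 0 ≤ θ) (hθ : θ ≤ 1 / 72) (hY0 : 0 ≤ Y)
    (hs : 0 ≤ s) (hx : 0 ≤ x) (hν : 0 ≤ ν) (hG : 0 ≤ G) (hh : 0 ≤ h)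
    (hY : Y ≤ 4 * θ ^ 2 * (s + 4 * x + 2 * ν + G + h)) :
    -(G + h) / 2 + 2 * Y + θ * (4 * s + 4 * G + 4 * h + 28 * Y + 12 * x + 6 * ν)
      - 15 * θ * x + 60 * θ * Y + 120 / 373248 * (2 * G + 4 * Y)
      + 120 * θ ^ 3 * (6 * Y + 6 * x + 3 * ν)
      + 60 / 5184 * θ * (4 * s + 4 * G + 4 * h + 28 * Y + 12 * x + 6 * ν)
    ≤ -(G + h) / 4 + θ * (20 * s + 15 * ν) := by
  have hY' : Y ≤ 1 / 18 * (θ * s + 4 * (θ * x) + 2 * (θ * ν) + θ * G + θ * h) := by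
    refine hY.trans ?_
    have : θ ^ 2 ≤ 1 / 72 * θ := by nlinarith
    calc 4 * θ ^ 2 * (s + 4 * x + 2 * ν + G + h)
        ≤ 4 * (1 / 72 * θ) * (s + 4 * x + 2 * ν + G + h) := by gcongr
      _ = _ := by ring
  -- The inequality closes because the contraction gives `-15 θ x`. Against it stand `12 θ x` from
  -- the step length and smaller amounts: those in the lag terms, and the one obtained when `Y` is
  -- replaced by its bound.
  have h3 : θ ^ 3 ≤ 1 / 5184 * θ := by
    have : θ ^ 2 ≤ (1 / 72) ^ 2 := by gcongr
    calc θ ^ 3 = θ ^ 2 * θ := by ring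
      _ ≤ (1 / 72) ^ 2 * θ := by gcongr
      _ = _ := by norm_num
  have e1 : θ * Y ≤ 1 / 72 * Y := by gcongr
  have e2 : θ * G ≤ 1 / 72 * G := by gcongr
  have e3 : θ * h ≤ 1 / 72 * h := by gcongr
  have e4 : 120 * θ ^ 3 * (6 * Y + 6 * x + 3 * ν)
      ≤ 120 * (1 / 5184 * θ) * (6 * Y + 6 * x + 3 * ν) := by gcongr
  have e5 : 0 ≤ θ * s := by positivity
  have e6 : 0 ≤ θ * x := by positivity
  have e7 : 0 ≤ θ * ν := by positivity
  nlinarith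

/-- The constants of the one-round inequality. -/
lemma progress_le {m n B L G H X N W Su Sv : ℝ} (hm : 1 ≤ m) (hmn : m ≤ n) (hB : 0 < B)
    (hL : 0 ≤ L) (hθ1 : L * B ≤ 1 / 72) (hθ2 : (L * B) ^ 2 * n ≤ m ^ 2 / 5184)
    (hθ3 : (L * B) ^ 3 * n ^ 2 ≤ m ^ 3 / 373248) (hG : 0 ≤ G) (hH : 0 ≤ H) (hX : 0 ≤ X)
    (hN : 0 ≤ N) (hW0 : 0 ≤ W) (hSu : 0 ≤ Su) (hSv : 0 ≤ Sv)
    (hW : W ≤ 4 * B ^ 2 * (1 / m * Su + m / n * Sv)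
      + 4 * B ^ 2 * (1 / m * (4 * L ^ 2 * X + 2 * N + G) + m / n * H)) :
    (B * (-(G / 2) + L ^ 2 * W) + B * (m / n) * (-H / 2 + L ^ 2 * W)
      + L * B ^ 2 * (2 * (Su / n) + 2 * (2 * G + 4 * L ^ 2 * W)
          + 1 / m * (2 * Su + 2 * (6 * L ^ 2 * W + 6 * L ^ 2 * X + 3 * N)))
      + L * B ^ 2 * (m / n) * (2 * Sv + 4 * H + 8 * L ^ 2 * W))
    + 30 * L ^ 3 * B ^ 2 * n / m ^ 2 * ((1 - m / n) * X + 2 * (m / n) * W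
      + 2 * B ^ 2 * (2 * (Su / n) + 2 * (2 * G + 4 * L ^ 2 * W)
          + 1 / m * (2 * Su + 2 * (6 * L ^ 2 * W + 6 * L ^ 2 * X + 3 * N)))
      + 2 * B ^ 2 * (m / n) * (2 * Sv + 4 * H + 8 * L ^ 2 * W)
      + (m / n / 2 * X + 4 / (m / n) * B ^ 2 * (2 * G + 4 * L ^ 2 * W)
        + 4 / (m * n) * B ^ 2 * (6 * L ^ 2 * W + 6 * L ^ 2 * X + 3 * N)))
    ≤ 30 * L ^ 3 * B ^ 2 * n / m ^ 2 * X - B / 4 * (G + m / n * H)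
      + B * (L * B) * (20 * (1 / m * Su + m / n * Sv) + 15 * (1 / m * N)) := by
  have hm0 : 0 < m := by linarith
  have hn0 : 0 < n := by linarith
  have hp1 : m / n ≤ 1 := by rw [div_le_one hn0]; exact hmn
  have hp0 : 0 ≤ m / n := by positivity
  have hi1 : 1 / m ≤ 1 := by rw [div_le_one hm0]; exact hm
  have hi0 : 0 ≤ 1 / m := by positivity
  set θ := L * B with hθ
  have hθ0 : 0 ≤ θ := by positivity
  set Y := L ^ 2 * W with hY
  set s := 1 / m * Su + m / n * Sv with hs
  set x := 1 / m * (L ^ 2 * X) with hx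
  set ν := 1 / m * N with hν
  set h := m / n * H with hh
  have hY0 : 0 ≤ Y := by positivity
  have hs0 : 0 ≤ s := by positivity
  have hx0 : 0 ≤ x := by positivity
  have hν0 : 0 ≤ ν := by positivity
  have hh0 : 0 ≤ h := by positivity
  have hYle : Y ≤ 4 * θ ^ 2 * (s + 4 * x + 2 * ν + G + h) := by
    have h1 : 1 / m * (4 * L ^ 2 * X + 2 * N + G) ≤ 4 * x + 2 * ν + G := by
      have : 1 / m * G ≤ 1 * G := by gcongr
      calc 1 / m * (4 * L ^ 2 * X + 2 * N + G) = 4 * x + 2 * ν + 1 / m * G := by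
            rw [hx, hν]; ring
        _ ≤ _ := by linarith
    calc Y ≤ L ^ 2 * (4 * B ^ 2 * s + 4 * B ^ 2 * (4 * x + 2 * ν + G + h)) := by
          rw [hY]; refine mul_le_mul_of_nonneg_left (hW.trans ?_) (sq_nonneg _); gcongr
      _ = _ := by rw [hθ]; ring
  set Z := 6 * L ^ 2 * W + 6 * L ^ 2 * X + 3 * N with hZ
  have hZ0 : 0 ≤ Z := by positivity
  have hZle : 1 / m * Z ≤ 6 * Y + 6 * x + 3 * ν := by
    have : 1 / m * Y ≤ 1 * Y := by gcongr
    calc 1 / m * Z = 6 * (1 / m * Y) + 6 * x + 3 * ν := by rw [hZ, hY, hx, hν]; ring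
      _ ≤ _ := by linarith
  set Bk := 4 * s + 4 * G + 4 * h + 28 * Y + 12 * x + 6 * ν with hBk
  have hBk0 : 0 ≤ Bk := by positivity
  set EU := 2 * (Su / n) + 2 * (2 * G + 4 * L ^ 2 * W) + 1 / m * (2 * Su + 2 * Z) with hEU
  set EV := 2 * Sv + 4 * H + 8 * L ^ 2 * W with hEV
  have hE : EU + m / n * EV ≤ Bk := by
    have h1 : Su / n ≤ 1 / m * Su := by
      rw [div_eq_mul_inv, mul_comm, ← one_div]; gcongr
    have h2 : m / n * Y ≤ 1 * Y := by gcongr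
    have h3 : 0 ≤ m / n * Sv := by positivity
    have h4 : EU = 2 * (Su / n) + 4 * G + 8 * Y + 2 * (1 / m * Su) + 2 * (1 / m * Z) := by
      rw [hEU, hY]; ring
    have h5 : m / n * EV = 2 * (m / n * Sv) + 4 * h + 8 * (m / n * Y) := by
      rw [hEV, hh, hY]; ring
    rw [h4, h5, hBk, hs]
    linarith
  have q2 : θ ^ 2 * n / m ^ 2 ≤ 1 / 5184 := by
    rw [div_le_iff₀ (by positivity)]
    linarith
  have q3 : θ ^ 3 * n ^ 2 / m ^ 3 ≤ 1 / 373248 := by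
    rw [div_le_iff₀ (by positivity)]
    linarith
  have key := normalized_progress_le hθ0 hθ1 hY0 hs0 hx0 hν0 hG hh0 hYle
  set lam := 30 * L ^ 3 * B ^ 2 * n / m ^ 2 with hlam
  have hlam0 : 0 ≤ lam := by positivity
  -- This fixes the factor `30` in `lam`: the contraction gains half of this term, `15 B θ x`, which
  -- must exceed the `12 B θ x` coming from the variance of the step in `u`.
  have t1 : lam * (m / n * X) = 30 * B * (θ * x) := by
    rw [hlam, hθ, hx]; field_simp
  have t2 : lam * (2 * (m / n) * W) ≤ B * (60 * θ * Y) := by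
    calc lam * (2 * (m / n) * W) = B * (60 * θ * Y) * (1 / m) := by
          rw [hlam, hθ, hY]; field_simp; ring
      _ ≤ _ := mul_le_of_le_one_right (by positivity) hi1
  -- The motion of `u` seen by unsampled clients. This is the term that needs `θ³n²/m³` small, and
  -- with it the restriction of the step size by `m / n^(2/3)`.
  have t3 : lam * (4 / (m / n) * B ^ 2 * (2 * G + 4 * L ^ 2 * W))
      ≤ B * (120 / 373248 * (2 * G + 4 * Y)) := by
    calc _ = B * (120 * (θ ^ 3 * n ^ 2 / m ^ 3) * (2 * G + 4 * Y)) := by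
          rw [hlam, hθ, hY]; field_simp; ring
      _ ≤ B * (120 * (1 / 373248) * (2 * G + 4 * Y)) := by
          gcongr
      _ = _ := by ring
  have t4 : lam * (4 / (m * n) * B ^ 2 * Z)
      ≤ B * (120 * θ ^ 3 * (6 * Y + 6 * x + 3 * ν)) := by
    calc _ = B * (120 * θ ^ 3 * (1 / m * Z)) * (1 / m) * (1 / m) := by
          rw [hlam, hθ]; field_simp; ring
      _ ≤ B * (120 * θ ^ 3 * (6 * Y + 6 * x + 3 * ν)) * 1 * 1 := by gcongr
      _ = _ := by ring
  have t5 : lam * (2 * B ^ 2 * (EU + m / n * EV))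
      ≤ B * (60 / 5184 * θ * Bk) := by
    calc _ ≤ lam * (2 * B ^ 2 * Bk) := by gcongr
      _ = B * (60 * (θ ^ 2 * n / m ^ 2) * θ * Bk) := by rw [hlam, hθ]; field_simp; ring
      _ ≤ B * (60 * (1 / 5184) * θ * Bk) := by
          gcongr
      _ = _ := by ring
  have t6 : L * B ^ 2 * (EU + m / n * EV) ≤ B * (θ * Bk) := by
    calc L * B ^ 2 * (EU + m / n * EV) ≤ L * B ^ 2 * Bk := by gcongr
      _ = _ := by rw [hθ]; ring
  have t7 : B * (m / n) * (-H / 2 + Y) ≤ B * (-h / 2 + Y) := by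
    have h2 : m / n * Y ≤ 1 * Y := by gcongr
    calc B * (m / n) * (-H / 2 + Y) = B * (-h / 2 + m / n * Y) := by rw [hh]; ring
      _ ≤ _ := by gcongr; linarith
  have key' := mul_le_mul_of_nonneg_left key hB.le
  rw [← hBk] at key'
  set T3 := 4 / (m / n) * B ^ 2 * (2 * G + 4 * L ^ 2 * W) with hT3
  set T4 := 4 / (m * n) * B ^ 2 * Z with hT4
  calc _ = lam * X + B * (-(G / 2) + Y) + B * (m / n) * (-H / 2 + Y)
        + L * B ^ 2 * (EU + m / n * EV) - 1 / 2 * (lam * (m / n * X)) + lam * (2 * (m / n) * W)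
        + lam * (2 * B ^ 2 * (EU + m / n * EV)) + lam * T3 + lam * T4 := by ring
    _ ≤ lam * X + B * (-(G / 2) + Y) + B * (-h / 2 + Y) + B * (θ * Bk)
        - 1 / 2 * (30 * B * (θ * x)) + B * (60 * θ * Y) + B * (60 / 5184 * θ * Bk)
        + B * (120 / 373248 * (2 * G + 4 * Y)) + B * (120 * θ ^ 3 * (6 * Y + 6 * x + 3 * ν)) := by
        rw [t1]
        linarith only [t2, t3, t4, t5, t6, t7]
    _ ≤ _ := by linarith only [key']

end Constants

end ScaffoldP

end

noncomputable section

set_option linter.unusedSectionVars false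

namespace ScaffoldP

/-! ### One round of the algorithm -/

section Round

variable {n du dv : ℕ} {Ξ : Type*} [MeasurableSpace Ξ]
  {F : Vec du → Vec dv → Ξ → ℝ} {D : Fin n → Measure Ξ} [∀ i, IsProbabilityMeasure (D i)]
  {L σu σv : ℝ}

/-- A state together with, for each client, the local iterates at which its control variable was
computed. -/
abbrev AugState (n du dv : ℕ) := State n du dv × (Fin n → ℕ → Vec du × Vec dv)

/-- One round on augmented states. -/
def augRound (F : Vec du → Vec dv → Ξ → ℝ) (P : Params) (A : Finset (Fin n))
    (x : Fin n → ℕ → Ξ) (s : AugState n du dv) : AugState n du dv :=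
  (round F P A x s.1, fun i k =>
    if i ∈ A then localIter F P (s.1.ci i) s.1.c s.1.u (s.1.v i) (x i) k else s.2 i k)

/-- The new control variable of client `i`, if sampled, is `newCtrl`. -/
def newCtrl (F : Vec du → Vec dv → Ξ → ℝ) (D : Fin n → Measure Ξ) (P : Params)
    (x : Fin n → ℕ → Ξ) (s : State n du dv) (i : Fin n) : Vec du :=
  avgNoiseU F D P.K i (localIter F P (s.ci i) s.c s.u (s.v i) (x i)) (x i)
    + avgGradU (localLoss F D) P.K i (localIter F P (s.ci i) s.c s.u (s.v i) (x i))

/-- The average stochastic gradient in `v` of client `i`. -/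
def dirV (F : Vec du → Vec dv → Ξ → ℝ) (D : Fin n → Measure Ξ) (P : Params)
    (x : Fin n → ℕ → Ξ) (s : State n du dv) (i : Fin n) : Vec dv :=
  avgNoiseV F D P.K i (localIter F P (s.ci i) s.c s.u (s.v i) (x i)) (x i)
    + avgGradV (localLoss F D) P.K i (localIter F P (s.ci i) s.c s.u (s.v i) (x i))

variable {P : Params} {A : Finset (Fin n)}

lemma round_u (hK : 1 ≤ P.K) (hm : 1 ≤ P.m) (hA : A.card = P.m) (x : Fin n → ℕ → Ξ)
    (s : State n du dv) :
    (round F P A x s).u = s.u - (P.γu * P.ηu * P.K) • (1 / (P.m : ℝ)) • ∑ i ∈ A,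
      (newCtrl F D P x s i - s.ci i + s.c) := by
  have hm0 : (P.m : ℝ) ≠ 0 := by exact_mod_cast (by omega : P.m ≠ 0)
  have h : ∀ i, (localIter F P (s.ci i) s.c s.u (s.v i) (x i) P.K).1
      = s.u - (P.K * P.γu) • (newCtrl F D P x s i - s.ci i + s.c) := by
    intro i
    have := localIter_fst_sub (F := F) (D := D) P hK i (s.ci i) s.c s.u (s.v i) (x i)
    rw [newCtrl, ← this, sub_sub_cancel]
  simp only [round, h]
  rw [Finset.sum_sub_distrib, Finset.sum_const, hA, ← Finset.smul_sum,
    ← Nat.cast_smul_eq_nsmul ℝ, smul_sub, smul_smul, smul_smul, smul_smul, div_mul_cancel₀ _ hm0,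
    sub_smul, one_smul, sub_add_sub_cancel]
  congr 2
  field_simp

lemma round_v (hK : 1 ≤ P.K) (x : Fin n → ℕ → Ξ) (s : State n du dv) (i : Fin n) :
    (round F P A x s).v i
      = if i ∈ A then s.v i - (P.γv * P.ηv * P.K) • dirV F D P x s i else s.v i := by
  simp only [round]
  split_ifs
  · rw [localIter_snd_sub (D := D) P hK i, ← dirV, smul_sub, sub_smul, one_smul, sub_add_sub_cancel,
      smul_smul]
    congr 2
    ring
  · rfl

/-- The terms `ci` and `c` built into the local steps cancel those in the control update, so the new
control variable retains no explicit term from the old one; the old one acts only through the local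
path. -/
lemma round_ci (hK : 1 ≤ P.K) (hγ : P.γu ≠ 0) (x : Fin n → ℕ → Ξ) (s : State n du dv)
    (i : Fin n) :
    (round F P A x s).ci i = if i ∈ A then newCtrl F D P x s i else s.ci i := by
  have hK0 : (P.K : ℝ) ≠ 0 := by exact_mod_cast (by omega : P.K ≠ 0)
  simp only [round]
  split_ifs
  · rw [localIter_fst_sub (D := D) P hK i, ← newCtrl, smul_smul,
      one_div_mul_cancel (mul_ne_zero hK0 hγ), one_smul]
    abel
  · rfl

omit [MeasurableSpace Ξ] in
-- The server sum over sampled clients equals the sum over all clients, since unsampled control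
-- variables do not change. The identity `c = vmean ci` is thus an invariant.
lemma round_c (x : Fin n → ℕ → Ξ) {s : State n du dv} (hc : s.c = vmean s.ci) :
    (round F P A x s).c = vmean (round F P A x s).ci := by
  have h : ∑ i ∈ A, ((round F P A x s).ci i - s.ci i)
      = ∑ i, ((round F P A x s).ci i - s.ci i) := by
    refine Finset.sum_subset (Finset.subset_univ A) fun i _ hi => ?_
    simp [round, hi]
  have h2 : (round F P A x s).c
      = s.c + (1 / (n : ℝ)) • ∑ i ∈ A, ((round F P A x s).ci i - s.ci i) := rfl
  have h3 : (1 / (n : ℝ)) • ∑ i, ((round F P A x s).ci i - s.ci i)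
      = vmean (round F P A x s).ci - vmean s.ci := by
    rw [← vmean_sub]; rfl
  rw [h2, h, h3, hc, add_sub_cancel]

/-- Mean squared deviation of the control variables from the average gradients at the remembered
points. -/
def ctrlErr (F : Vec du → Vec dv → Ξ → ℝ) (D : Fin n → Measure Ξ) (K : ℕ)
    (s : AugState n du dv) : ℝ :=
  (1 / (n : ℝ)) * ∑ i, ‖s.1.ci i - avgGradU (localLoss F D) K i (s.2 i)‖ ^ 2

/-- The objective plus a multiple of the lag of the remembered points. -/
def potential (F : Vec du → Vec dv → Ξ → ℝ) (D : Fin n → Measure Ξ) (K : ℕ) (lam : ℝ)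
    (s : AugState n du dv) : ℝ :=
  globalLoss F D s.1.u s.1.v + lam * lag K s.1.u s.1.v s.2

lemma JointSmooth.gradU_globalLoss (hf : JointSmooth (localLoss F D) L) (u : Vec du)
    (v : Fin n → Vec dv) :
    gradU (globalLoss F D) u v = vmean fun i => gradU (localLoss F D i) u (v i) :=
  (hf.hasGradientAt_mean u v).gradient

/-- Distance of the gradients to the averages of the gradients at the remembered points. -/
lemma JointSmooth.mean_sub_avgGradU_le (hf : JointSmooth (localLoss F D) L) {K : ℕ} (hK : 1 ≤ K)
    (u : Vec du) (v : Fin n → Vec dv) (M : Fin n → ℕ → Vec du × Vec dv) :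
    (1 / (n : ℝ)) * ∑ i, ‖gradU (localLoss F D i) u (v i)
      - avgGradU (localLoss F D) K i (M i)‖ ^ 2 ≤ 2 * L ^ 2 * lag K u v M := by
  rw [lag, ← dmean_mul_left, dmean]
  gcongr with i
  rw [norm_sub_rev, avgGradU, tmean_sub_const hK]
  refine (norm_tmean_sq_le _ _).trans ?_
  gcongr with k
  exact hf.gradU_sq_le i _ _ _ _

/-- The local iterates depend measurably on the data. -/
lemma measurable_localIter (hF : WellPosed F D) (P : Params) (k : ℕ) :
    Measurable fun z : (Vec du × Vec du × Vec du × Vec dv) × (ℕ → Ξ) =>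
      localIter F P z.1.1 z.1.2.1 z.1.2.2.1 z.1.2.2.2 z.2 k := by
  induction k with
  | zero =>
    simp only [localIter]
    fun_prop
  | succ k ih =>
    have hx : Measurable fun z : (Vec du × Vec du × Vec du × Vec dv) × (ℕ → Ξ) => z.2 k := by
      fun_prop
    have h2 := ih.prodMk hx
    have hu : Measurable fun z : (Vec du × Vec du × Vec du × Vec dv) × (ℕ → Ξ) =>
        stochGradU F (localIter F P z.1.1 z.1.2.1 z.1.2.2.1 z.1.2.2.2 z.2 k).1
          (localIter F P z.1.1 z.1.2.1 z.1.2.2.1 z.1.2.2.2 z.2 k).2 (z.2 k) :=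
      hF.measurable_stochGradU.comp h2
    have hv : Measurable fun z : (Vec du × Vec du × Vec du × Vec dv) × (ℕ → Ξ) =>
        stochGradV F (localIter F P z.1.1 z.1.2.1 z.1.2.2.1 z.1.2.2.2 z.2 k).1
          (localIter F P z.1.1 z.1.2.1 z.1.2.2.1 z.1.2.2.2 z.2 k).2 (z.2 k) :=
      hF.measurable_stochGradV.comp h2
    simp only [localIter]
    exact ((measurable_fst.comp ih).sub (((hu.sub (by fun_prop)).add (by fun_prop)).const_smul
      P.γu)).prodMk ((measurable_snd.comp ih).sub (hv.const_smul P.γv))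

omit [∀ i, IsProbabilityMeasure (D i)] in
lemma measurable_avgNoiseU {i : Fin n}
    (h : Measurable fun z : (Vec du × Vec dv) × Ξ => noiseU F D i z.1 z.2) (K : ℕ) :
    Measurable fun z : (ℕ → Vec du × Vec dv) × (ℕ → Ξ) => avgNoiseU F D K i z.1 z.2 := by
  have hk : ∀ k, Measurable fun z : (ℕ → Vec du × Vec dv) × (ℕ → Ξ) =>
      noiseU F D i (z.1 k) (z.2 k) := fun k => by
    have h1 : Measurable fun z : (ℕ → Vec du × Vec dv) × (ℕ → Ξ) => (z.1 k, z.2 k) := by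
      fun_prop
    have h2 := h.comp h1
    exact h2
  exact (Finset.measurable_fun_sum _ fun k _ => hk k).const_smul (1 / (K : ℝ))

/-! ### One random round started at a fixed state -/

variable {Ω : Type*} [mΩ : MeasurableSpace Ω] {μ : Measure Ω} [IsProbabilityMeasure μ]

/-- The samples of one round: those of different clients are independent. -/
structure RoundRun (μ : Measure Ω) (F : Vec du → Vec dv → Ξ → ℝ) (D : Fin n → Measure Ξ)
    (L σu σv : ℝ) (P : Params) (x : Fin n → ℕ → Ω → Ξ)
    (𝓕 : Fin n → ℕ → MeasurableSpace Ω) : Prop where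
  client : ∀ i, ClientRun μ F D L σu σv P i (x i) (𝓕 i)
  cross : ∀ i j, i ≠ j → ∀ k, Measurable[𝓕 j 0] (x i k)

namespace RoundRun

variable {x : Fin n → ℕ → Ω → Ξ} {𝓕 : Fin n → ℕ → MeasurableSpace Ω}

/-- The noise of client `i` is a function of its own samples, and these belong to the initial
information of every other client `j`. It may therefore be tested against the noise of `j`. -/
lemma measurable_avgNoiseU (h : RoundRun μ F D L σu σv P x 𝓕) (s : State n du dv) {i j : Fin n}
    (hij : i ≠ j) : Measurable[𝓕 j 0] fun ω => avgNoiseU F D P.K i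
      (localIter F P (s.ci i) s.c s.u (s.v i) fun k => x i k ω) fun k => x i k ω := by
  have hx : Measurable[𝓕 j 0] fun ω k => x i k ω :=
    @measurable_pi_lambda _ _ _ (𝓕 j 0) _ _ fun k => h.cross i j hij k
  have hi := h.client i
  have hp : ∀ k, Measurable[𝓕 j 0] fun ω =>
      localIter F P (s.ci i) s.c s.u (s.v i) (fun k => x i k ω) k := fun k =>
    (measurable_localIter hi.wellPosed P k).comp
      ((@measurable_const _ _ _ (𝓕 j 0) (s.ci i, s.c, s.u, s.v i)).prodMk hx)
  have hpx := (@measurable_pi_lambda _ _ _ (𝓕 j 0) _ _ hp).prodMk hx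
  have hm := (_root_.ScaffoldP.measurable_avgNoiseU hi.isNoiseU.measurable P.K).comp hpx
  exact hm

/-- The mean drift of all clients. -/
def meanDrift (μ : Measure Ω) (F : Vec du → Vec dv → Ξ → ℝ) (P : Params)
    (x : Fin n → ℕ → Ω → Ξ) (s : State n du dv) : ℝ :=
  dmean n P.K fun i k => ClientRun.drift μ F P (x i) (s.ci i) s.c s.u (s.v i) k

lemma meanDrift_nonneg (s : State n du dv) : 0 ≤ meanDrift μ F P x s :=
  dmean_nonneg fun _ _ => ClientRun.drift_nonneg _ _ _ _ _

lemma roundData (h : RoundRun μ F D L σu σv P x 𝓕) (hn : 1 ≤ n) (hK : 1 ≤ P.K)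
    (s : State n du dv) :
    RoundData μ P.K (σu ^ 2 / P.K) (σv ^ 2 / P.K) L (meanDrift μ F P x s)
      (fun i => gradU (localLoss F D i) s.u (s.v i)) (fun i => gradV (localLoss F D i) s.u (s.v i))
      s.u s.v
      (fun i ω => avgNoiseU F D P.K i (localIter F P (s.ci i) s.c s.u (s.v i) fun k => x i k ω)
        fun k => x i k ω)
      (fun i ω => avgGradU (localLoss F D) P.K i
        (localIter F P (s.ci i) s.c s.u (s.v i) fun k => x i k ω))
      (fun i ω => avgNoiseV F D P.K i (localIter F P (s.ci i) s.c s.u (s.v i) fun k => x i k ω)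
        fun k => x i k ω)
      (fun i ω => avgGradV (localLoss F D) P.K i
        (localIter F P (s.ci i) s.c s.u (s.v i) fun k => x i k ω))
      (fun i k ω => localIter F P (s.ci i) s.c s.u (s.v i) (fun k => x i k ω) k) where
  memLp_e i := (h.client i).memLp_avgNoiseU _ _ _ _
  memLp_a i := (h.client i).memLp_avgGradU _ _ _ _
  memLp_d i := (h.client i).memLp_avgNoiseV _ _ _ _
  memLp_g i := (h.client i).memLp_avgGradV _ _ _ _
  integral_e i := (h.client i).integral_avgNoiseU _ _ _ _
  integral_d i := (h.client i).integral_avgNoiseV _ _ _ _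
  sqMean_e i := (h.client i).sqMean_avgNoiseU_le _ _ _ _ hK
  sqMean_d i := (h.client i).sqMean_avgNoiseV_le _ _ _ _ hK
  -- Orthogonality between clients gains the factor `1 / n` over the trivial bound for a mean.
  sqMean_vmean_e := by
    have hn0 : (n : ℝ) ≠ 0 := by exact_mod_cast (by omega : n ≠ 0)
    simp only [vmean]
    rw [sqMean_smul, sqMean_sum_of_orthogonal _ fun i _ => (h.client i).memLp_avgNoiseU _ _ _ _]
    · calc _ ≤ (1 / (n : ℝ)) ^ 2 * ∑ _i : Fin n, σu ^ 2 / P.K := by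
            gcongr with i
            exact (h.client i).sqMean_avgNoiseU_le _ _ _ _ hK
        _ = _ := by
            simp only [Finset.sum_const, Finset.card_univ, Fintype.card_fin, nsmul_eq_mul]
            field_simp
    · intro i _ j _ hij
      exact (h.client j).integral_inner_avgNoiseU _ _ _ _ (h.measurable_avgNoiseU s hij)
        ((h.client i).memLp_avgNoiseU _ _ _ _)
  sqMean_a_sub := by
    rw [meanDrift, dmean, mul_left_comm, Finset.mul_sum (a := 2 * L ^ 2)]
    gcongr with i
    exact (h.client i).sqMean_avgGradU_sub_le _ _ _ _ hK
  sqMean_g_sub := by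
    rw [meanDrift, dmean, mul_left_comm, Finset.mul_sum (a := 2 * L ^ 2)]
    gcongr with i
    exact (h.client i).sqMean_avgGradV_sub_le _ _ _ _ hK
  lag_le := MeanLE.dmean fun i k hk =>
    (meanLE_sq (((h.client i).memLp_iter _ _ _ _ hk.le).1.sub (memLp_const _)) le_rfl).add
      (meanLE_sq (((h.client i).memLp_iter _ _ _ _ hk.le).2.sub (memLp_const _)) le_rfl)

/-- The mean drift in terms of the gradients, the lag and the control error. -/
lemma meanDrift_le (h : RoundRun μ F D L σu σv P x 𝓕) (hm : 1 ≤ P.m) (hmn : P.m ≤ n)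
    (hK : 1 ≤ P.K) {γ : ℝ} (ha : P.γu ^ 2 ≤ 1 / (P.m : ℝ) * γ ^ 2)
    (hb : P.γv ^ 2 ≤ (P.m : ℝ) / n * γ ^ 2) (hθ0 : 0 ≤ L * γ * P.K) (hθ : L * γ * P.K ≤ 1 / 72)
    (s : AugState n du dv) (hc : s.1.c = vmean s.1.ci) :
    meanDrift μ F P x s.1 ≤
      4 * (γ * P.K) ^ 2 * (1 / (P.m : ℝ) * (σu ^ 2 / P.K) + (P.m : ℝ) / n * (σv ^ 2 / P.K))
      + 4 * (γ * P.K) ^ 2 * (1 / (P.m : ℝ) * (4 * L ^ 2 * lag P.K s.1.u s.1.v s.2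
          + 2 * ctrlErr F D P.K s
          + ‖vmean fun i => gradU (localLoss F D i) s.1.u (s.1.v i)‖ ^ 2)
        + (P.m : ℝ) / n * ((1 / (n : ℝ)) * ∑ i, ‖gradV (localLoss F D i) s.1.u (s.1.v i)‖ ^ 2)) := by
  have hn := hm.trans hmn
  have hn0 : (0 : ℝ) < n := by exact_mod_cast hn
  have hm0 : (0 : ℝ) < P.m := by exact_mod_cast hm
  have hK0 : (0 : ℝ) < P.K := by exact_mod_cast hK
  have hi1 : 1 / (P.m : ℝ) ≤ 1 := by rw [div_le_one hm0]; exact_mod_cast hm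
  have hp1 : (P.m : ℝ) / n ≤ 1 := by rw [div_le_one hn0]; exact_mod_cast hmn
  obtain ⟨⟨u, v, ci, c⟩, M⟩ := s
  dsimp only at hc ⊢
  set b : Fin n → Vec du := fun i => gradU (localLoss F D i) u (v i) with hbdef
  set w : Fin n → Vec du := fun i => avgGradU (localLoss F D) P.K i (M i) with hw
  have hterm : ∀ i : Fin n, 1 / (P.K : ℝ) * ∑ k ∈ Finset.range P.K,
      ClientRun.drift μ F P (x i) (ci i) c u (v i) k ≤
      4 * P.K * γ ^ 2 * (1 / (P.m : ℝ) * σu ^ 2 + (P.m : ℝ) / n * σv ^ 2)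
      + 4 * P.K ^ 2 * γ ^ 2 * (1 / (P.m : ℝ) * ‖b i - ci i + c‖ ^ 2
        + (P.m : ℝ) / n * ‖gradV (localLoss F D i) u (v i)‖ ^ 2) := fun i =>
    (h.client i).mean_drift_le _ _ _ _ hK ha hb hi1 hp1 hθ0 hθ
  have hr : (1 / (n : ℝ)) * ∑ i, ‖b i - ci i + c‖ ^ 2
      ≤ 4 * L ^ 2 * lag P.K u v M
        + 2 * ((1 / (n : ℝ)) * ∑ i, ‖ci i - w i‖ ^ 2) + ‖vmean b‖ ^ 2 := by
    -- Bias and variance of the corrected directions: their mean is the global gradient, and their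
    -- spread is at most that of `b i - ci i`, which smoothness bounds by the lag up to the control
    -- error.
    have e1 := sum_norm_sub_vmean_sq fun i => b i - ci i + c
    have e2 : vmean (fun i => b i - ci i + c) = vmean b := by
      rw [vmean_add, vmean_sub, vmean_const hn, ← hc, sub_add_cancel]
    have e3 : ∑ i, ‖(b i - ci i + c) - vmean fun i => b i - ci i + c‖ ^ 2
        ≤ ∑ i, ‖b i - ci i‖ ^ 2 := by
      refine le_of_eq_of_le (Finset.sum_congr rfl fun i _ => ?_)
        (sum_norm_sub_vmean_sq_le fun i => b i - ci i)
      rw [vmean_add, vmean_const hn]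
      congr 2
      abel
    have e4 : ∑ i, ‖b i - ci i‖ ^ 2 ≤ 2 * ∑ i, ‖b i - w i‖ ^ 2 + 2 * ∑ i, ‖ci i - w i‖ ^ 2 := by
      rw [Finset.mul_sum, Finset.mul_sum, ← Finset.sum_add_distrib]
      refine Finset.sum_le_sum fun i _ => ?_
      have := norm_add_sq_le_two (b i - w i) (w i - ci i)
      rwa [sub_add_sub_cancel, norm_sub_rev (w i)] at this
    have e5 := (h.client ⟨0, hn⟩).smooth.mean_sub_avgGradU_le hK u v M
    rw [e2] at e1 e3
    have e6 : ∑ i, ‖b i - ci i + c‖ ^ 2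
        ≤ 2 * ∑ i, ‖b i - w i‖ ^ 2 + 2 * ∑ i, ‖ci i - w i‖ ^ 2 + n * ‖vmean b‖ ^ 2 := by
      linarith
    calc (1 / (n : ℝ)) * ∑ i, ‖b i - ci i + c‖ ^ 2
        ≤ (1 / (n : ℝ)) * (2 * ∑ i, ‖b i - w i‖ ^ 2 + 2 * ∑ i, ‖ci i - w i‖ ^ 2
          + n * ‖vmean b‖ ^ 2) := by gcongr
      _ = 2 * ((1 / (n : ℝ)) * ∑ i, ‖b i - w i‖ ^ 2)
          + 2 * ((1 / (n : ℝ)) * ∑ i, ‖ci i - w i‖ ^ 2) + ‖vmean b‖ ^ 2 := by field_simp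
      _ ≤ _ := by linarith
  calc meanDrift μ F P x ⟨u, v, ci, c⟩
      ≤ (1 / (n : ℝ)) * ∑ i,
        (4 * P.K * γ ^ 2 * (1 / (P.m : ℝ) * σu ^ 2 + (P.m : ℝ) / n * σv ^ 2)
          + 4 * P.K ^ 2 * γ ^ 2 * (1 / (P.m : ℝ) * ‖b i - ci i + c‖ ^ 2
            + (P.m : ℝ) / n * ‖gradV (localLoss F D i) u (v i)‖ ^ 2)) := by
        rw [meanDrift, dmean]
        gcongr with i
        exact hterm i
    _ = 4 * (γ * P.K) ^ 2 * (1 / (P.m : ℝ) * (σu ^ 2 / P.K) + (P.m : ℝ) / n * (σv ^ 2 / P.K))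
        + 4 * (γ * P.K) ^ 2 * (1 / (P.m : ℝ) * ((1 / (n : ℝ)) * ∑ i, ‖b i - ci i + c‖ ^ 2)
          + (P.m : ℝ) / n * ((1 / (n : ℝ)) * ∑ i, ‖gradV (localLoss F D i) u (v i)‖ ^ 2)) := by
        simp only [Finset.sum_add_distrib, ← Finset.mul_sum, Finset.sum_const, Finset.card_univ,
          Fintype.card_fin, nsmul_eq_mul]
        field_simp
    _ ≤ _ := by
        rw [ctrlErr]
        gcongr

/-- The mean of the control error after a round. -/
lemma upperMean_ctrlErr (h : RoundRun μ F D L σu σv P x 𝓕) (hm : 1 ≤ P.m) (hmn : P.m ≤ n)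
    (hK : 1 ≤ P.K) (hγ : P.γu ≠ 0) (s : AugState n du dv) :
    UpperMean μ (fun ω => subsetAvg P.m fun A =>
        ctrlErr F D P.K (augRound F P A (fun i k => x i k ω) s))
      ((P.m : ℝ) / n * (σu ^ 2 / P.K) + (1 - (P.m : ℝ) / n) * ctrlErr F D P.K s) := by
  have hn := hm.trans hmn
  have hn0 : (n : ℝ) ≠ 0 := by exact_mod_cast (by omega : n ≠ 0)
  have R := h.roundData hn hK s.1
  have h1 := MeanLE.const_mul (r := 1 / (n : ℝ)) (by positivity)
    (MeanLE.sum (s := Finset.univ) fun i _ =>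
    ((meanLE_sq (R.memLp_e i) (R.sqMean_e i)).const_mul (r := (P.m : ℝ) / n) (by positivity)).add
      (MeanLE.const ((1 - (P.m : ℝ) / n)
        * ‖s.1.ci i - avgGradU (localLoss F D) P.K i (s.2 i)‖ ^ 2)))
  refine UpperMean.mono (h1.upperMean fun ω => le_of_eq ?_) (le_of_eq ?_)
  · simp only [ctrlErr]
    rw [subsetAvg_mul_left, subsetAvg_sum]
    congr 1
    refine Finset.sum_congr rfl fun i _ => ?_
    rw [← subsetAvg_ite hm hmn i]
    refine subsetAvg_congr fun A _ => ?_
    simp only [augRound]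
    rw [round_ci (D := D) hK hγ]
    split_ifs
    · simp only [newCtrl, add_sub_cancel_right]
    · rfl
  · simp only [ctrlErr, Finset.sum_add_distrib, ← Finset.mul_sum, Finset.sum_const,
      Finset.card_univ, Fintype.card_fin, nsmul_eq_mul]
    field_simp

/-- The mean of the potential after a round. -/
lemma upperMean_potential (h : RoundRun μ F D L σu σv P x 𝓕) (hm : 1 ≤ P.m) (hmn : P.m ≤ n)
    (hK : 1 ≤ P.K) {γ : ℝ} (hγ : 0 < γ) (hγu : γ = P.γu * P.ηu) (hγv : γ = P.γv * P.ηv)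
    (ha : P.γu ^ 2 ≤ 1 / (P.m : ℝ) * γ ^ 2) (hb : P.γv ^ 2 ≤ (P.m : ℝ) / n * γ ^ 2)
    (hθ1 : L * (γ * P.K) ≤ 1 / 72) (hθ2 : (L * (γ * P.K)) ^ 2 * n ≤ (P.m : ℝ) ^ 2 / 5184)
    (hθ3 : (L * (γ * P.K)) ^ 3 * (n : ℝ) ^ 2 ≤ (P.m : ℝ) ^ 3 / 373248)
    (s : AugState n du dv) (hc : s.1.c = vmean s.1.ci) :
    UpperMean μ (fun ω => subsetAvg P.m fun A =>
        potential F D P.K (30 * L ^ 3 * (γ * P.K) ^ 2 * n / (P.m : ℝ) ^ 2)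
          (augRound F P A (fun i k => x i k ω) s))
      (potential F D P.K (30 * L ^ 3 * (γ * P.K) ^ 2 * n / (P.m : ℝ) ^ 2) s
        - γ * P.K / 4 * (sqGradU F D s.1
          + (P.m : ℝ) / n * ((1 / (n : ℝ)) * ∑ i, sqGradV F D i s.1))
        + γ * P.K * (L * (γ * P.K)) * (20 * (1 / (P.m : ℝ) * (σu ^ 2 / P.K)
          + (P.m : ℝ) / n * (σv ^ 2 / P.K)) + 15 * (1 / (P.m : ℝ) * ctrlErr F D P.K s))) := by
  have hn := hm.trans hmn
  have hK0 : (0 : ℝ) < P.K := by exact_mod_cast hK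
  have hf := (h.client ⟨0, hn⟩).smooth
  have hL := hf.nonneg
  have R := h.roundData hn hK s.1
  have hW := h.meanDrift_le hm hmn hK ha hb (by positivity) (by rwa [mul_assoc]) s hc
  have hZ := R.meanLE_sub_ctrl s.1.ci (fun i => avgGradU (localLoss F D) P.K i (s.2 i))
    (hf.mean_sub_avgGradU_le hK s.1.u s.1.v s.2) le_rfl
  obtain ⟨κ, hκ0, hκn, hκ⟩ := exists_subsetAvg_lag_le (du := du) (dv := dv) hm hmn hK
  set B := γ * P.K with hB
  have hB0 : 0 < B := by positivity
  set lam := 30 * L ^ 3 * B ^ 2 * n / (P.m : ℝ) ^ 2 with hlam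
  have hlam0 : 0 ≤ lam := by positivity
  have hSU := R.upperMean_stepU hm hmn hc hZ
  have hSV := R.upperMean_stepV hn
  have hIU := R.upperMean_innerU hn hc
  have hIV := R.upperMean_innerV
  have hC := R.upperMean_cross hm hmn hK hc hZ hκ0 hκn s.2 B
  have hLag : UpperMean μ _ _ := R.lag_le.upperMean fun ω => le_rfl
  have hp0 : 0 ≤ (P.m : ℝ) / n := by positivity
  have hdesc := (((UpperMean.const (globalLoss F D s.1.u s.1.v)).add
    ((hIU.const_mul hB0.le).add (hIV.const_mul (mul_nonneg hB0.le hp0)))).add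
      (hSU.const_mul (r := L * B ^ 2) (by positivity))).add
      (hSV.const_mul (r := L * B ^ 2 * ((P.m : ℝ) / n)) (by positivity))
  have hlag := ((((UpperMean.const ((1 - (P.m : ℝ) / n) * lag P.K s.1.u s.1.v s.2)).add
    (hLag.const_mul (mul_nonneg zero_le_two hp0))).add
      (hSU.const_mul (r := 2 * B ^ 2) (by positivity))).add
      (hSV.const_mul (r := 2 * B ^ 2 * ((P.m : ℝ) / n)) (by positivity))).add hC
  refine ((hdesc.add (hlag.const_mul hlam0)).of_le fun ω => ?_).mono ?_
  -- Both variables move with the same effective step `B`, because the products of inner and outer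
  -- step sizes agree.
  · have hpt : ∀ A : Finset (Fin n), A.card = P.m →
        potential F D P.K lam (augRound F P A (fun i k => x i k ω) s)
        = (1 / (n : ℝ)) * ∑ i, localLoss F D i
            (s.1.u - B • (1 / (P.m : ℝ)) • ∑ j ∈ A,
              (newCtrl F D P (fun i k => x i k ω) s.1 j - s.1.ci j + s.1.c))
            (if i ∈ A then s.1.v i - B • dirV F D P (fun i k => x i k ω) s.1 i else s.1.v i)
          + lam * lag P.K (s.1.u - B • (1 / (P.m : ℝ)) • ∑ j ∈ A,
              (newCtrl F D P (fun i k => x i k ω) s.1 j - s.1.ci j + s.1.c))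
            (fun i => if i ∈ A then s.1.v i - B • dirV F D P (fun i k => x i k ω) s.1 i
              else s.1.v i)
            (fun i k => if i ∈ A then localIter F P (s.1.ci i) s.1.c s.1.u (s.1.v i)
              (fun k => x i k ω) k else s.2 i k) := by
      intro A hA
      have hu := round_u (F := F) (D := D) hK hm hA (fun i k => x i k ω) s.1
      have hv : (round F P A (fun i k => x i k ω) s.1).v = _ :=
        funext fun i => round_v (F := F) (D := D) hK (fun i k => x i k ω) s.1 i
      rw [← hγu, ← hB] at hu
      rw [← hγv, ← hB] at hv
      simp only [potential, globalLoss, augRound, hu, hv]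
    rw [subsetAvg_congr hpt, subsetAvg_add, subsetAvg_mul_left lam]
    refine add_le_add ?_ ?_
    · refine (hf.subsetAvg_descent hm hmn _ _ _ _ _).trans (le_of_eq ?_)
      simp only [globalLoss, newCtrl, dirV]
      ring
    · refine mul_le_mul_of_nonneg_left ?_ hlam0
      exact hκ _ _ _ _ _ _ _
  · have key := progress_le (m := P.m) (n := n) (B := B) (L := L)
      (by exact_mod_cast hm) (by exact_mod_cast hmn) hB0 hL hθ1 hθ2 hθ3
      (sq_nonneg ‖vmean fun i => gradU (localLoss F D i) s.1.u (s.1.v i)‖)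
      (H := (1 / (n : ℝ)) * ∑ i, ‖gradV (localLoss F D i) s.1.u (s.1.v i)‖ ^ 2)
      (by positivity) (lag_nonneg P.K s.1.u s.1.v s.2)
      (N := ctrlErr F D P.K s) (by unfold ctrlErr; positivity)
      (meanDrift_nonneg (μ := μ) (F := F) (P := P) (x := x) s.1)
      (Su := σu ^ 2 / P.K) (Sv := σv ^ 2 / P.K) (by positivity) (by positivity) hW
    simp only [potential, sqGradU, sqGradV, hf.gradU_globalLoss]
    rw [← hlam] at key
    have hce : ctrlErr F D P.K s = 1 / (n : ℝ) * ∑ i, ‖s.1.ci i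
      - (fun i => avgGradU (localLoss F D) P.K i (s.2 i)) i‖ ^ 2 := rfl
    rw [← hce]
    linarith

end RoundRun

end Round

end ScaffoldP

end

noncomputable section

set_option linter.unusedSectionVars false

namespace ScaffoldP

/-! ### Independence of the samples and the client sets -/

section Independence

variable {Ω : Type*} [mΩ : MeasurableSpace Ω] {μ : Measure Ω}

/-- Two independent families of independent σ-algebras form one independent family. -/
lemma iIndep_sumElim {ι κ : Type*} {m : ι → MeasurableSpace Ω} {m' : κ → MeasurableSpace Ω}
    (h1 : iIndep m μ) (h2 : iIndep m' μ) (h : Indep (⨆ i, m i) (⨆ j, m' j) μ) :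
    iIndep (Sum.elim m m') μ := by
  classical
  rw [iIndep_iff] at h1 h2 ⊢
  intro s f hf
  have hl : ∀ i ∈ s.toLeft, MeasurableSet[m i] (f (Sum.inl i)) := fun i hi =>
    hf _ (Finset.mem_toLeft.1 hi)
  have hr : ∀ j ∈ s.toRight, MeasurableSet[m' j] (f (Sum.inr j)) := fun j hj =>
    hf _ (Finset.mem_toRight.1 hj)
  have e : (⋂ i ∈ s, f i)
      = (⋂ i ∈ s.toLeft, f (Sum.inl i)) ∩ ⋂ j ∈ s.toRight, f (Sum.inr j) := by
    ext ω
    simp [Sum.forall]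
  have hl' : MeasurableSet[⨆ i, m i] (⋂ i ∈ s.toLeft, f (Sum.inl i)) :=
    @Finset.measurableSet_biInter _ _ (⨆ i, m i) _ _ fun i hi => le_iSup m i _ (hl i hi)
  have hr' : MeasurableSet[⨆ j, m' j] (⋂ j ∈ s.toRight, f (Sum.inr j)) :=
    @Finset.measurableSet_biInter _ _ (⨆ j, m' j) _ _ fun j hj => le_iSup m' j _ (hr j hj)
  rw [e, (Indep_iff _ _ μ).1 h _ _ hl' hr', h1 _ (f := fun i => f (Sum.inl i)) hl,
    h2 _ (f := fun j => f (Sum.inr j)) hr,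
    ← Finset.prod_disjSum _ _ fun i => μ (f i), Finset.toLeft_disjSum_toRight]

variable {n K T m : ℕ} {Ξ : Type*} [MeasurableSpace Ξ] {D : Fin n → Measure Ξ}
  {ξ : ℕ → Fin n → ℕ → Ω → Ξ} {S : ℕ → Ω → Finset (Fin n)}

/-- Indices of all random variables of the algorithm. -/
abbrev SampleIdx (n K T : ℕ) := (Fin (T + 1) × Fin n × Fin K) ⊕ Fin T

/-- The σ-algebra of one sample or one client set. -/
@[reducible]
def sampleAlg (K T : ℕ) (ξ : ℕ → Fin n → ℕ → Ω → Ξ) (S : ℕ → Ω → Finset (Fin n)) :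
    SampleIdx n K T → MeasurableSpace Ω :=
  Sum.elim (fun j => MeasurableSpace.comap (ξ j.1 j.2.1 j.2.2) inferInstance)
    (fun t => MeasurableSpace.comap (S t) inferInstance)

/-- The σ-algebra of the random variables with indices in `I`. -/
@[reducible]
def infoAlg (ξ : ℕ → Fin n → ℕ → Ω → Ξ) (S : ℕ → Ω → Finset (Fin n))
    (I : Set (SampleIdx n K T)) : MeasurableSpace Ω :=
  ⨆ j ∈ I, sampleAlg K T ξ S j

/-- The samples of the first rounds, continued by a constant. -/
def truncSample (x₀ : Ξ) (K T : ℕ) (ξ : ℕ → Fin n → ℕ → Ω → Ξ) (t : ℕ) (i : Fin n) (k : ℕ)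
    (ω : Ω) : Ξ :=
  if t ≤ T ∧ k < K then ξ t i k ω else x₀

/-- The client sets of the first rounds, continued by the empty set. -/
def truncSet (T : ℕ) (S : ℕ → Ω → Finset (Fin n)) (t : ℕ) (ω : Ω) : Finset (Fin n) :=
  if t < T then S t ω else ∅

lemma infoAlg_mono {I J : Set (SampleIdx n K T)} (h : I ⊆ J) : infoAlg ξ S I ≤ infoAlg ξ S J :=
  biSup_mono h

lemma measurable_truncSample (x₀ : Ξ) {I : Set (SampleIdx n K T)} {t : ℕ} {i : Fin n} {k : ℕ}
    (h : ∀ (ht : t < T + 1) (hk : k < K), Sum.inl (⟨t, ht⟩, i, ⟨k, hk⟩) ∈ I) :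
    Measurable[infoAlg ξ S I] (truncSample x₀ K T ξ t i k) := by
  by_cases hc : t ≤ T ∧ k < K
  · have he : truncSample x₀ K T ξ t i k = ξ t i k := by
      funext ω
      exact if_pos hc
    rw [he, measurable_iff_comap_le]
    exact le_iSup₂_of_le (f := fun j (_ : j ∈ I) => sampleAlg K T ξ S j) _
      (h (Nat.lt_succ_of_le hc.1) hc.2) le_rfl
  · have he : truncSample x₀ K T ξ t i k = fun _ => x₀ := by
      funext ω
      exact if_neg hc
    rw [he]
    exact measurable_const

lemma measurable_truncSet {I : Set (SampleIdx n K T)} {t : ℕ}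
    (h : ∀ ht : t < T, Sum.inr ⟨t, ht⟩ ∈ I) : Measurable[infoAlg ξ S I] (truncSet T S t) := by
  by_cases hc : t < T
  · have he : truncSet T S t = S t := by
      funext ω
      exact if_pos hc
    rw [he, measurable_iff_comap_le]
    exact le_iSup₂_of_le (f := fun j (_ : j ∈ I) => sampleAlg K T ξ S j) _ (h hc) le_rfl
  · have he : truncSet T S t = fun _ => ∅ := by
      funext ω
      exact if_neg hc
    rw [he]
    exact measurable_const

namespace Sampling

lemma sampleAlg_le (h : Sampling μ D m K T ξ S) (j : SampleIdx n K T) :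
    sampleAlg K T ξ S j ≤ mΩ := by
  rcases j with j | t
  · exact (h.measurable_ξ j.1 (Nat.le_of_lt_succ j.1.2) j.2.1 j.2.2 j.2.2.2).comap_le
  · exact (h.measurable_S t t.2).comap_le

lemma infoAlg_le (h : Sampling μ D m K T ξ S) (I : Set (SampleIdx n K T)) :
    infoAlg ξ S I ≤ mΩ :=
  iSup₂_le fun j _ => h.sampleAlg_le j

lemma iIndep_sampleAlg (h : Sampling μ D m K T ξ S) : iIndep (sampleAlg K T ξ S) μ := by
  refine iIndep_sumElim h.indep_ξ h.indep_S ?_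
  have h0 := (IndepFun_iff_Indep _ _ _).1 h.indep_ξ_S
  refine indep_of_indep_of_le_left (indep_of_indep_of_le_right h0 ?_) ?_
  · exact iSup_le fun t => Measurable.comap_le
      ((measurable_pi_apply t).comp (comap_measurable fun ω (t : Fin T) => S t ω))
  · exact iSup_le fun j => Measurable.comap_le ((measurable_pi_apply j).comp
      (comap_measurable fun ω (j : Fin (T + 1) × Fin n × Fin K) => ξ j.1 j.2.1 j.2.2 ω))

lemma indep_infoAlg (h : Sampling μ D m K T ξ S) {I J : Set (SampleIdx n K T)}
    (hIJ : Disjoint I J) : Indep (infoAlg ξ S I) (infoAlg ξ S J) μ :=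
  indep_iSup_of_disjoint h.sampleAlg_le h.iIndep_sampleAlg hIJ

lemma indepFun_of_disjoint (h : Sampling μ D m K T ξ S) {I J : Set (SampleIdx n K T)}
    (hIJ : Disjoint I J) {α β : Type*} [MeasurableSpace α] [MeasurableSpace β] {X : Ω → α}
    {Y : Ω → β} (hX : Measurable[infoAlg ξ S I] X) (hY : Measurable[infoAlg ξ S J] Y) :
    IndepFun X Y μ := by
  rw [IndepFun_iff_Indep]
  exact indep_of_indep_of_le_left (indep_of_indep_of_le_right (h.indep_infoAlg hIJ) hY.comap_le)
    hX.comap_le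

/-- The samples seen by client `i` in a round before its local step `k`, together with those of
the other clients. -/
def roundIdx (K T t : ℕ) (i : Fin n) (k : ℕ) : Set (SampleIdx n K T) :=
  {j | Sum.elim (fun j => (j.1 : ℕ) = t ∧ (j.2.1 ≠ i ∨ (j.2.2 : ℕ) < k)) (fun _ => False) j}

variable [IsProbabilityMeasure μ]

/-- Independence is read off from index sets: disjoint ones generate independent σ-algebras, and
`roundIdx` at step `k` omits the index of the sample used there. Truncated samples beyond the range
are constants, so measurability holds for every `k`. -/
lemma freshSamples (h : Sampling μ D m K T ξ S) (x₀ : Ξ) {t : ℕ} (ht : t ≤ T) (i : Fin n) :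
    FreshSamples μ (D i) K (truncSample x₀ K T ξ t i)
      (fun k => infoAlg ξ S (roundIdx K T t i k)) where
  le k := h.infoAlg_le _
  mono k l hkl := infoAlg_mono fun j hj => by
    rcases j with j | j
    · exact ⟨hj.1, hj.2.imp_right fun hlt => hlt.trans_le hkl⟩
    · exact hj
  measurable k := measurable_truncSample x₀ fun _ _ => ⟨rfl, Or.inr (Nat.lt_succ_self k)⟩
  law k hk := by
    rw [← h.law_ξ t ht i k hk]
    congr 1
    funext ω
    exact if_pos ⟨ht, hk⟩
  indep k hk := by
    have hJ : Measurable[infoAlg ξ S ({Sum.inl (⟨t, Nat.lt_succ_of_le ht⟩, i, ⟨k, hk⟩)} :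
        Set (SampleIdx n K T))] (truncSample x₀ K T ξ t i k) :=
      measurable_truncSample x₀ fun _ _ => rfl
    refine indep_of_indep_of_le_right (h.indep_infoAlg ?_) hJ.comap_le
    rw [Set.disjoint_singleton_right]
    rintro ⟨-, h1 | h1⟩
    · exact h1 rfl
    · exact lt_irrefl _ h1

end Sampling

end Independence

/-! ### Averages over a random client set -/

section Step

variable {Ω σ X : Type*} [MeasurableSpace Ω] [MeasurableSpace σ] [MeasurableSpace X]
  {μ : Measure Ω} [IsProbabilityMeasure μ] {n m : ℕ}

/-- No integrability of `f` is needed. Applied to the potential, it makes the one-round bound itself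
nonnegative, and this later bounds the squared gradients by integrable quantities. -/
lemma UpperMean.nonneg {f : Ω → ℝ} {b : ℝ} (h : UpperMean μ f b) (hf : ∀ ω, 0 ≤ f ω) :
    0 ≤ b := by
  obtain ⟨q, hq, _, hqb⟩ := h
  exact (integral_nonneg fun ω => (hf ω).trans (hq ω)).trans hqb

lemma lintegral_uniformOn_card {φ : Finset (Fin n) → ℝ} (hφ : ∀ A, 0 ≤ φ A) :
    ∫⁻ A, ENNReal.ofReal (φ A) ∂(uniformOn {A : Finset (Fin n) | A.card = m})
      = ENNReal.ofReal (subsetAvg m φ) := by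
  have hs : {A : Finset (Fin n) | A.card = m}
      = ((Finset.powersetCard m Finset.univ : Finset (Finset (Fin n))) :
        Set (Finset (Fin n))) := by
    ext A
    simp [Finset.mem_powersetCard]
  rw [hs, uniformOn, ProbabilityTheory.cond, lintegral_smul_measure, lintegral_finset, Measure.count_apply_finset,
    Finset.card_powersetCard, Finset.card_univ, Fintype.card_fin]
  simp only [Measure.count_singleton, mul_one]
  rw [← ENNReal.ofReal_sum_of_nonneg fun A _ => hφ A, subsetAvg, smul_eq_mul, div_eq_inv_mul]
  -- If there are no `m`-subsets, the sum is empty and both sides are zero despite the division by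
  -- zero.
  rcases Nat.eq_zero_or_pos (n.choose m) with h0 | h0
  · have : Finset.powersetCard m (Finset.univ : Finset (Fin n)) = ∅ := by
      rw [← Finset.card_eq_zero, Finset.card_powersetCard, Finset.card_univ, Fintype.card_fin, h0]
    simp [this]
  · rw [ENNReal.ofReal_mul (by positivity), ENNReal.ofReal_inv_of_pos (by exact_mod_cast h0),
      ENNReal.ofReal_natCast]

/-- The mean after one step that is independent of the present state, from bounds for fixed
states. -/
lemma meanLE_step {A : Ω → Finset (Fin n)} {x : Ω → X} {Z : Ω → σ} (hA : Measurable A)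
    (hx : Measurable x) (hZ : Measurable Z)
    (hlaw : μ.map A = uniformOn {A : Finset (Fin n) | A.card = m}) (hxA : IndepFun x A μ)
    (hZxA : IndepFun Z (fun ω => (x ω, A ω)) μ) {Φ : Finset (Fin n) → X → σ → ℝ}
    (hΦ : Measurable fun p : σ × X × Finset (Fin n) => Φ p.2.2 p.2.1 p.1)
    (hΦ0 : ∀ A x s, 0 ≤ Φ A x s) {b : σ → ℝ}
    (hb : ∀ ω', UpperMean μ (fun ω => subsetAvg m fun A => Φ A (x ω) (Z ω')) (b (Z ω')))
    (hbi : Integrable (fun ω => b (Z ω)) μ) :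
    MeanLE μ (fun ω => Φ (A ω) (x ω) (Z ω)) (∫ ω, b (Z ω) ∂μ) := by
  have hb0 : ∀ ω', 0 ≤ b (Z ω') := fun ω' =>
    (hb ω').nonneg fun ω => subsetAvg_nonneg fun A => hΦ0 _ _ _
  have hin : ∀ ω', ∫⁻ ω, ENNReal.ofReal (subsetAvg m fun A => Φ A (x ω) (Z ω')) ∂μ
      ≤ ENNReal.ofReal (b (Z ω')) := fun ω' => by
    obtain ⟨q, hq, hqi, hqb⟩ := hb ω'
    calc _ ≤ ∫⁻ ω, ENNReal.ofReal (q ω) ∂μ :=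
          lintegral_mono fun ω => ENNReal.ofReal_le_ofReal (hq ω)
      _ = ENNReal.ofReal (∫ ω, q ω ∂μ) :=
          (ofReal_integral_eq_lintegral_ofReal hqi (Filter.Eventually.of_forall fun ω =>
            (subsetAvg_nonneg fun A => hΦ0 _ _ _).trans (hq ω))).symm
      _ ≤ _ := ENNReal.ofReal_le_ofReal hqb
  have hg : Measurable fun p : σ × X × Finset (Fin n) => ENNReal.ofReal (Φ p.2.2 p.2.1 p.1) :=
    hΦ.ennreal_ofReal
  have hp1 : IsProbabilityMeasure (μ.map x) := Measure.isProbabilityMeasure_map hx.aemeasurable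
  have hp2 : IsProbabilityMeasure (μ.map Z) := Measure.isProbabilityMeasure_map hZ.aemeasurable
  have hp3 : IsProbabilityMeasure (uniformOn {A : Finset (Fin n) | A.card = m}) := by
    rw [← hlaw]
    exact Measure.isProbabilityMeasure_map hA.aemeasurable
  -- The present state is held fixed in the inner integrals, where the majorants apply; the
  -- nonnegative integral is used since integrability at the random state belongs to the conclusion.
  have hle : ∫⁻ ω, ENNReal.ofReal (Φ (A ω) (x ω) (Z ω)) ∂μ
      ≤ ENNReal.ofReal (∫ ω, b (Z ω) ∂μ) := by
    calc ∫⁻ ω, ENNReal.ofReal (Φ (A ω) (x ω) (Z ω)) ∂μ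
        = ∫⁻ p, ENNReal.ofReal (Φ p.2.2 p.2.1 p.1) ∂(μ.map fun ω => (Z ω, x ω, A ω)) :=
          (lintegral_map hg (hZ.prodMk (hx.prodMk hA))).symm
      _ = ∫⁻ z, ∫⁻ a, ENNReal.ofReal (Φ a.2 a.1 z) ∂((μ.map x).prod
            (uniformOn {A : Finset (Fin n) | A.card = m})) ∂(μ.map Z) := by
          rw [map_prodMk_of_indepFun hZ (hx.prodMk hA) (map_prodMk_of_indepFun hx hA hlaw hxA)
            hZxA, lintegral_prod _ hg.aemeasurable]
      _ = ∫⁻ ω', ∫⁻ a, ENNReal.ofReal (Φ a.2 a.1 (Z ω')) ∂((μ.map x).prod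
            (uniformOn {A : Finset (Fin n) | A.card = m})) ∂μ :=
          lintegral_map hg.lintegral_prod_right' hZ
      _ ≤ ∫⁻ ω', ENNReal.ofReal (b (Z ω')) ∂μ := by
          refine lintegral_mono fun ω' => le_trans (le_of_eq ?_) (hin ω')
          have hg' : Measurable fun a : X × Finset (Fin n) => ENNReal.ofReal (Φ a.2 a.1 (Z ω')) :=
            hg.comp (measurable_const.prodMk measurable_id)
          rw [lintegral_prod _ hg'.aemeasurable,
            lintegral_map (f := fun y => ∫⁻ A, ENNReal.ofReal (Φ A y (Z ω'))
              ∂(uniformOn {A : Finset (Fin n) | A.card = m})) hg'.lintegral_prod_right' hx]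
          simp only [lintegral_uniformOn_card fun A => hΦ0 _ _ _]
      _ = _ := (ofReal_integral_eq_lintegral_ofReal hbi (Filter.Eventually.of_forall hb0)).symm
  have hm : Measurable fun ω => Φ (A ω) (x ω) (Z ω) := hΦ.comp (hZ.prodMk (hx.prodMk hA))
  have hi : Integrable (fun ω => Φ (A ω) (x ω) (Z ω)) μ := by
    refine ⟨hm.aestronglyMeasurable, ?_⟩
    rw [hasFiniteIntegral_iff_ofReal (Filter.Eventually.of_forall fun _ => hΦ0 _ _ _)]
    exact hle.trans_lt ENNReal.ofReal_lt_top
  refine ⟨hi, ?_⟩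
  rw [← ofReal_integral_eq_lintegral_ofReal hi
    (Filter.Eventually.of_forall fun _ => hΦ0 _ _ _)] at hle
  exact (ENNReal.ofReal_le_ofReal_iff (integral_nonneg hb0)).1 hle

end Step

end ScaffoldP

end

noncomputable section

set_option linter.unusedSectionVars false

namespace ScaffoldP

/-! ### Measurability of the algorithm -/

section StateMeasurable

variable {n du dv : ℕ}

instance State.instMeasurableSpace : MeasurableSpace (State n du dv) :=
  MeasurableSpace.comap (fun s => (s.u, s.v, s.ci, s.c)) inferInstance

namespace State

lemma measurable_toProd : Measurable fun s : State n du dv => (s.u, s.v, s.ci, s.c) :=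
  comap_measurable _

lemma measurable_u : Measurable (State.u : State n du dv → _) :=
  measurable_fst.comp measurable_toProd

lemma measurable_v : Measurable (State.v : State n du dv → _) :=
  (measurable_fst.comp measurable_snd).comp measurable_toProd

lemma measurable_ci : Measurable (State.ci : State n du dv → _) :=
  (measurable_fst.comp (measurable_snd.comp measurable_snd)).comp measurable_toProd

lemma measurable_c : Measurable (State.c : State n du dv → _) :=
  (measurable_snd.comp (measurable_snd.comp measurable_snd)).comp measurable_toProd

lemma measurable_mk {α : Type*} [MeasurableSpace α] {f : α → State n du dv}
    (hu : Measurable fun a => (f a).u) (hv : Measurable fun a => (f a).v)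
    (hci : Measurable fun a => (f a).ci) (hc : Measurable fun a => (f a).c) : Measurable f :=
  measurable_comap_iff.2 (hu.prodMk (hv.prodMk (hci.prodMk hc)))

end State

variable {Ξ : Type*} [MeasurableSpace Ξ] {F : Vec du → Vec dv → Ξ → ℝ} {D : Fin n → Measure Ξ}
  [∀ i, IsProbabilityMeasure (D i)] {L : ℝ} {P : Params}

lemma measurable_localIter_state (hF : WellPosed F D) (i : Fin n) (k : ℕ) :
    Measurable fun z : AugState n du dv × (Fin n → ℕ → Ξ) =>
      localIter F P (z.1.1.ci i) z.1.1.c z.1.1.u (z.1.1.v i) (z.2 i) k := by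
  have hs : Measurable fun z : AugState n du dv × (Fin n → ℕ → Ξ) => z.1.1 := by fun_prop
  have h1 : Measurable fun z : AugState n du dv × (Fin n → ℕ → Ξ) =>
      ((z.1.1.ci i, z.1.1.c, z.1.1.u, z.1.1.v i), z.2 i) :=
    (((measurable_pi_apply i).comp (State.measurable_ci.comp hs)).prodMk
      ((State.measurable_c.comp hs).prodMk ((State.measurable_u.comp hs).prodMk
        ((measurable_pi_apply i).comp (State.measurable_v.comp hs))))).prodMk
      ((measurable_pi_apply i).comp measurable_snd)
  have h2 := (measurable_localIter hF P k).comp h1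
  exact h2

lemma measurable_augRound (hF : WellPosed F D) (A : Finset (Fin n)) :
    Measurable fun z : AugState n du dv × (Fin n → ℕ → Ξ) => augRound F P A z.2 z.1 := by
  have hs : Measurable fun z : AugState n du dv × (Fin n → ℕ → Ξ) => z.1.1 := by fun_prop
  have hit := fun i k => measurable_localIter_state (P := P) hF i k
  have hu : Measurable fun z : AugState n du dv × (Fin n → ℕ → Ξ) => z.1.1.u :=
    State.measurable_u.comp hs
  have hv : ∀ i, Measurable fun z : AugState n du dv × (Fin n → ℕ → Ξ) => z.1.1.v i := fun i =>
    (measurable_pi_apply i).comp (State.measurable_v.comp hs)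
  have hci : ∀ i, Measurable fun z : AugState n du dv × (Fin n → ℕ → Ξ) => z.1.1.ci i := fun i =>
    (measurable_pi_apply i).comp (State.measurable_ci.comp hs)
  have hc : Measurable fun z : AugState n du dv × (Fin n → ℕ → Ξ) => z.1.1.c :=
    State.measurable_c.comp hs
  have hci' : ∀ i, Measurable fun z : AugState n du dv × (Fin n → ℕ → Ξ) =>
      (round F P A z.2 z.1.1).ci i := by
    intro i
    simp only [round]
    have := hci i
    have := hit i P.K
    split_ifs <;> fun_prop
  have hu' : Measurable fun z : AugState n du dv × (Fin n → ℕ → Ξ) =>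
      (round F P A z.2 z.1.1).u := by
    have := fun i => hit i P.K
    simp only [round]
    fun_prop
  have hv' : ∀ i, Measurable fun z : AugState n du dv × (Fin n → ℕ → Ξ) =>
      (round F P A z.2 z.1.1).v i := by
    intro i
    have := hv i
    have := hit i P.K
    simp only [round]
    split_ifs <;> fun_prop
  have hc' : Measurable fun z : AugState n du dv × (Fin n → ℕ → Ξ) =>
      z.1.1.c + (1 / (n : ℝ)) • ∑ i ∈ A, ((round F P A z.2 z.1.1).ci i - z.1.1.ci i) := by
    fun_prop
  have hM : ∀ i k, Measurable fun z : AugState n du dv × (Fin n → ℕ → Ξ) =>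
      if i ∈ A then localIter F P (z.1.1.ci i) z.1.1.c z.1.1.u (z.1.1.v i) (z.2 i) k
        else z.1.2 i k := by
    intro i k
    have := hit i k
    split_ifs <;> fun_prop
  have hr : Measurable fun z : AugState n du dv × (Fin n → ℕ → Ξ) => round F P A z.2 z.1.1 :=
    State.measurable_mk hu' (measurable_pi_lambda _ hv') (measurable_pi_lambda _ hci') hc'
  have hM' : Measurable fun z : AugState n du dv × (Fin n → ℕ → Ξ) => fun i k =>
      if i ∈ A then localIter F P (z.1.1.ci i) z.1.1.c z.1.1.u (z.1.1.v i) (z.2 i) k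
        else z.1.2 i k :=
    measurable_pi_lambda _ fun i => measurable_pi_lambda _ fun k => hM i k
  exact hr.prodMk hM'

/-- There are only countably many client sets, so measurability may be checked for each set
separately. -/
lemma measurable_augRound_joint (hF : WellPosed F D) :
    Measurable fun z : AugState n du dv × (Fin n → ℕ → Ξ) × Finset (Fin n) =>
      augRound F P z.2.2 z.2.1 z.1 := by
  have h : Measurable fun z : (AugState n du dv × (Fin n → ℕ → Ξ)) × Finset (Fin n) =>
      augRound F P z.2 z.1.2 z.1.1 :=
    measurable_from_prod_countable_left fun A => measurable_augRound hF A
  have h2 : Measurable fun z : AugState n du dv × (Fin n → ℕ → Ξ) × Finset (Fin n) =>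
      ((z.1, z.2.1), z.2.2) := by fun_prop
  have h3 := h.comp h2
  exact h3

lemma AugState.measurable_uv (i : Fin n) :
    Measurable fun s : AugState n du dv => (s.1.u, s.1.v i) :=
  (State.measurable_u.comp measurable_fst).prodMk
    ((measurable_pi_apply i).comp (State.measurable_v.comp measurable_fst))

lemma JointSmooth.measurable_sqGradV (hf : JointSmooth (localLoss F D) L) (i : Fin n) :
    Measurable fun s : AugState n du dv => sqGradV F D i s.1 := by
  have h := (hf.measurable_gradV i).comp (AugState.measurable_uv i)
  exact h.norm.pow_const 2

lemma JointSmooth.measurable_sqGradU (hf : JointSmooth (localLoss F D) L) :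
    Measurable fun s : AugState n du dv => sqGradU F D s.1 := by
  have h : ∀ i, Measurable fun s : AugState n du dv => gradU (localLoss F D i) s.1.u (s.1.v i) :=
    fun i => (hf.measurable_gradU i).comp (AugState.measurable_uv i)
  have h2 : Measurable fun s : AugState n du dv =>
      ‖(1 / (n : ℝ)) • ∑ i, gradU (localLoss F D i) s.1.u (s.1.v i)‖ ^ 2 := by
    fun_prop
  simp only [sqGradU, hf.gradU_globalLoss]
  exact h2

lemma JointSmooth.measurable_ctrlErr (hf : JointSmooth (localLoss F D) L) (K : ℕ) :
    Measurable (ctrlErr (du := du) (dv := dv) F D K) := by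
  have hM : ∀ i k, Measurable fun s : AugState n du dv => s.2 i k := fun i k => by fun_prop
  have hg : ∀ i k, Measurable fun s : AugState n du dv =>
      gradU (localLoss F D i) (s.2 i k).1 (s.2 i k).2 := fun i k =>
    (hf.measurable_gradU i).comp (hM i k)
  have hci : ∀ i, Measurable fun s : AugState n du dv => s.1.ci i := fun i =>
    (measurable_pi_apply i).comp (State.measurable_ci.comp measurable_fst)
  unfold ctrlErr
  simp only [avgGradU, tmean]
  exact (Finset.measurable_fun_sum _ fun i _ => (((hci i).sub
    ((Finset.measurable_fun_sum _ fun k _ => hg i k).const_smul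
      (1 / (K : ℝ)))).norm.pow_const 2)).const_mul _

lemma JointSmooth.measurable_potential (hf : JointSmooth (localLoss F D) L) (K : ℕ) (lam : ℝ) :
    Measurable (potential (du := du) (dv := dv) F D K lam) := by
  have hu : Measurable fun s : AugState n du dv => s.1.u :=
    State.measurable_u.comp measurable_fst
  have hv : ∀ i, Measurable fun s : AugState n du dv => s.1.v i := fun i =>
    (measurable_pi_apply i).comp (State.measurable_v.comp measurable_fst)
  have hM : ∀ i k, Measurable fun s : AugState n du dv => s.2 i k := fun i k => by fun_prop
  have hl : ∀ i, Measurable fun s : AugState n du dv => localLoss F D i s.1.u (s.1.v i) :=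
    fun i => (hf.measurable_uncurry i).comp (hu.prodMk (hv i))
  unfold potential globalLoss lag dmean
  refine ((Finset.measurable_fun_sum _ fun i _ => hl i).const_mul _).add
    (((Finset.measurable_fun_sum _ fun i _ =>
      (Finset.measurable_fun_sum _ fun k _ => ?_).const_mul _).const_mul _).const_mul _)
  exact ((((hM i k).fst.sub hu)).norm.pow_const 2).add ((((hM i k).snd.sub (hv i))).norm.pow_const 2)

end StateMeasurable

/-! ### The augmented process -/

section AugProcess

variable {n du dv : ℕ} {Ξ Ω : Type*}
  {F : Vec du → Vec dv → Ξ → ℝ} {P : Params} {u₀ : Vec du} {v₀ : Fin n → Vec dv}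

lemma localIter_congr {ci c u : Vec du} {v : Vec dv} {x y : ℕ → Ξ} :
    ∀ {k : ℕ}, (∀ l < k, x l = y l) →
      localIter F P ci c u v x k = localIter F P ci c u v y k
  | 0, _ => rfl
  | k + 1, h => by
    simp only [localIter]
    rw [localIter_congr fun l hl => h l (hl.trans (Nat.lt_succ_self k)), h k (Nat.lt_succ_self k)]

lemma round_congr {x y : Fin n → ℕ → Ξ} (h : ∀ i, ∀ k < P.K, x i k = y i k) (A : Finset (Fin n))
    (s : State n du dv) : round F P A x s = round F P A y s := by
  have h1 : ∀ i, localIter F P (s.ci i) s.c s.u (s.v i) (x i) P.K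
      = localIter F P (s.ci i) s.c s.u (s.v i) (y i) P.K := fun i => localIter_congr (h i)
  simp only [round, h1]

lemma initState_congr {x y : Fin n → ℕ → Ξ} (h : ∀ i, ∀ k < P.K, x i k = y i k) :
    initState F P u₀ v₀ x = initState F P u₀ v₀ y := by
  have h1 : ∀ i, ∑ k ∈ Finset.range P.K, stochGradU F u₀ (v₀ i) (x i k)
      = ∑ k ∈ Finset.range P.K, stochGradU F u₀ (v₀ i) (y i k) := fun i =>
    Finset.sum_congr rfl fun k hk => by rw [h i k (Finset.mem_range.1 hk)]
  simp only [initState, h1]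

/-- The augmented states of the algorithm. -/
def augProcess (F : Vec du → Vec dv → Ξ → ℝ) (P : Params) (u₀ : Vec du) (v₀ : Fin n → Vec dv)
    (ξ : ℕ → Fin n → ℕ → Ω → Ξ) (S : ℕ → Ω → Finset (Fin n)) : ℕ → Ω → AugState n du dv
  | 0, ω => (initState F P u₀ v₀ fun i k => ξ 0 i k ω, fun i _ => (u₀, v₀ i))
  | t + 1, ω => augRound F P (S t ω) (fun i k => ξ (t + 1) i k ω) (augProcess F P u₀ v₀ ξ S t ω)

lemma augProcess_c (ξ : ℕ → Fin n → ℕ → Ω → Ξ) (S : ℕ → Ω → Finset (Fin n)) (t : ℕ) (ω : Ω) :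
    (augProcess F P u₀ v₀ ξ S t ω).1.c = vmean (augProcess F P u₀ v₀ ξ S t ω).1.ci := by
  induction t with
  | zero => rfl
  | succ t ih => exact round_c _ ih

/-- `Sampling` controls only the samples and sets with indices in range. Up to time `T` the
algorithm reads no others, so truncation changes nothing there and makes every variable measurable.
-/
lemma fst_augProcess (x₀ : Ξ) {T : ℕ} (ξ : ℕ → Fin n → ℕ → Ω → Ξ) (S : ℕ → Ω → Finset (Fin n))
    (ω : Ω) : ∀ {t : ℕ}, t ≤ T →
    (augProcess F P u₀ v₀ (truncSample x₀ P.K T ξ) (truncSet T S) t ω).1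
      = process F P u₀ v₀ ξ S t ω
  | 0, _ => initState_congr fun _ _ hk => if_pos ⟨Nat.zero_le _, hk⟩
  | t + 1, ht => by
    have ih := fst_augProcess x₀ ξ S ω ((Nat.le_succ t).trans ht)
    have hS : truncSet T S t ω = S t ω := if_pos ht
    simp only [augProcess, augRound, process, run, ih, hS]
    exact round_congr (fun _ _ hk => if_pos ⟨ht, hk⟩) _ _

variable [MeasurableSpace Ξ] [mΩ : MeasurableSpace Ω] {μ : Measure Ω} {D : Fin n → Measure Ξ}
  [∀ i, IsProbabilityMeasure (D i)]
  {T : ℕ} {ξ : ℕ → Fin n → ℕ → Ω → Ξ} {S : ℕ → Ω → Finset (Fin n)} {L σu σv : ℝ}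

/-- Indices of the random variables used before round `t`. -/
def pastIdx (n K T t : ℕ) : Set (SampleIdx n K T) :=
  {j | Sum.elim (fun j => (j.1 : ℕ) ≤ t) (fun r => (r : ℕ) < t) j}

/-- Indices of the random variables used in round `t`. -/
def presentIdx (n K T t : ℕ) : Set (SampleIdx n K T) :=
  {j | Sum.elim (fun j => (j.1 : ℕ) = t + 1) (fun r => (r : ℕ) = t) j}

lemma disjoint_past_present (n K T t : ℕ) :
    Disjoint (pastIdx n K T t) (presentIdx n K T t) := by
  rw [Set.disjoint_left]
  rintro (j | r) h1 h2
  · exact absurd (show (j.1 : ℕ) ≤ t from h1) (by rw [show (j.1 : ℕ) = t + 1 from h2]; omega)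
  · exact absurd (show (r : ℕ) < t from h1) (by rw [show (r : ℕ) = t from h2]; omega)

/-- The state at round `t` is built from the batches `0, …, t` and the sets before `t`. Round `t`
itself uses batch `t + 1` and set `t`, hence data independent of that state. -/
lemma measurable_augProcess (hF : WellPosed F D) (x₀ : Ξ) (t : ℕ) :
    Measurable[infoAlg ξ S (pastIdx n P.K T t)]
      (augProcess F P u₀ v₀ (truncSample x₀ P.K T ξ) (truncSet T S) t) := by
  induction t with
  | zero =>
    have hx : ∀ i k, Measurable[infoAlg ξ S (pastIdx n P.K T 0)]
        (truncSample x₀ P.K T ξ 0 i k) := fun i k =>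
      measurable_truncSample x₀ fun _ _ => Nat.le_refl 0
    have hg : ∀ i k, Measurable[infoAlg ξ S (pastIdx n P.K T 0)] fun ω =>
        stochGradU F u₀ (v₀ i) (truncSample x₀ P.K T ξ 0 i k ω) := fun i k => by
      have h1 : Measurable fun y : Ξ => stochGradU F u₀ (v₀ i) y :=
        hF.measurable_u.comp (measurable_const.prodMk (measurable_const.prodMk measurable_id))
      exact h1.comp (hx i k)
    have hci : ∀ i, Measurable[infoAlg ξ S (pastIdx n P.K T 0)] fun ω =>
        (1 / (P.K : ℝ)) • ∑ k ∈ Finset.range P.K,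
          stochGradU F u₀ (v₀ i) (truncSample x₀ P.K T ξ 0 i k ω) := fun i =>
      (Finset.measurable_fun_sum _ fun k _ => hg i k).const_smul (1 / (P.K : ℝ))
    have hc : Measurable[infoAlg ξ S (pastIdx n P.K T 0)] fun ω =>
        (1 / (n : ℝ)) • ∑ i, (1 / (P.K : ℝ)) • ∑ k ∈ Finset.range P.K,
          stochGradU F u₀ (v₀ i) (truncSample x₀ P.K T ξ 0 i k ω) :=
      (Finset.measurable_fun_sum _ fun i _ => hci i).const_smul (1 / (n : ℝ))
    have hs : Measurable[infoAlg ξ S (pastIdx n P.K T 0)] fun ω =>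
        initState F P u₀ v₀ fun i k => truncSample x₀ P.K T ξ 0 i k ω :=
      @State.measurable_mk _ _ _ _ (infoAlg ξ S (pastIdx n P.K T 0)) _
        (@measurable_const _ _ _ (_) _) (@measurable_const _ _ _ (_) _)
        (@measurable_pi_lambda _ _ _ (_) _ _ hci) hc
    exact hs.prodMk (@measurable_const _ _ _ (_) _)
  | succ t ih =>
    have hsub : pastIdx n P.K T t ⊆ pastIdx n P.K T (t + 1) := by
      rintro (j | r) h
      · exact Nat.le_succ_of_le h
      · exact Nat.lt_succ_of_lt h
    have hz := ih.mono (infoAlg_mono (ξ := ξ) (S := S) hsub) le_rfl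
    have hx : Measurable[infoAlg ξ S (pastIdx n P.K T (t + 1))] fun ω (i : Fin n) (k : ℕ) =>
        truncSample x₀ P.K T ξ (t + 1) i k ω :=
      @measurable_pi_lambda _ _ _ (_) _ _ fun i => @measurable_pi_lambda _ _ _ (_) _ _ fun k =>
        measurable_truncSample x₀ fun _ _ => Nat.le_refl (t + 1)
    have hS : Measurable[infoAlg ξ S (pastIdx n P.K T (t + 1))] (truncSet T S t) :=
      measurable_truncSet fun _ => Nat.lt_succ_self t
    have h := (measurable_augRound_joint (P := P) hF).comp (hz.prodMk (hx.prodMk hS))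
    exact h

variable [IsProbabilityMeasure μ]

namespace Sampling

lemma roundRun (h : Sampling μ D P.m P.K T ξ S) (hF : WellPosed F D)
    (hg : StochasticGradient F D σu σv) (hf : JointSmooth (localLoss F D) L) (x₀ : Ξ) {t : ℕ}
    (ht : t ≤ T) :
    RoundRun μ F D L σu σv P (truncSample x₀ P.K T ξ t)
      (fun i k => infoAlg ξ S (roundIdx P.K T t i k)) where
  client i := ⟨hF, hg, hf, h.freshSamples x₀ ht i⟩
  cross _ _ hij _ := measurable_truncSample x₀ fun _ _ => ⟨rfl, Or.inl hij⟩

/-- The mean of a function of the next state. -/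
lemma meanLE_augProcess_succ (h : Sampling μ D P.m P.K T ξ S) (hF : WellPosed F D) (x₀ : Ξ)
    {t : ℕ} (ht : t < T) {Φ b : AugState n du dv → ℝ} (hΦ : Measurable Φ) (hΦ0 : ∀ s, 0 ≤ Φ s)
    (hb : ∀ s : AugState n du dv, s.1.c = vmean s.1.ci →
      UpperMean μ (fun ω => subsetAvg P.m fun A =>
        Φ (augRound F P A (fun i k => truncSample x₀ P.K T ξ (t + 1) i k ω) s)) (b s))
    (hbi : Integrable (fun ω =>
      b (augProcess F P u₀ v₀ (truncSample x₀ P.K T ξ) (truncSet T S) t ω)) μ) :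
    MeanLE μ (fun ω =>
        Φ (augProcess F P u₀ v₀ (truncSample x₀ P.K T ξ) (truncSet T S) (t + 1) ω))
      (∫ ω, b (augProcess F P u₀ v₀ (truncSample x₀ P.K T ξ) (truncSet T S) t ω) ∂μ) := by
  have hZ := measurable_augProcess (P := P) (T := T) (ξ := ξ) (S := S) (u₀ := u₀) (v₀ := v₀)
    hF x₀ t
  have hx : ∀ {I : Set (SampleIdx n P.K T)},
      (∀ (ht : t + 1 < T + 1) i k, Sum.inl (⟨t + 1, ht⟩, i, k) ∈ I) →
      Measurable[infoAlg ξ S I] fun ω (i : Fin n) (k : ℕ) =>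
        truncSample x₀ P.K T ξ (t + 1) i k ω := fun hI =>
    @measurable_pi_lambda _ _ _ (_) _ _ fun i => @measurable_pi_lambda _ _ _ (_) _ _ fun k =>
      measurable_truncSample x₀ fun _ _ => hI _ _ _
  have hxp := hx (I := presentIdx n P.K T t) fun _ _ _ => rfl
  have hSp : Measurable[infoAlg ξ S (presentIdx n P.K T t)] (truncSet T S t) :=
    measurable_truncSet fun _ => rfl
  have hlaw : μ.map (truncSet T S t) = uniformOn {A : Finset (Fin n) | A.card = P.m} := by
    rw [← h.law_S t ht]
    congr 1
    funext ω
    exact if_pos ht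
  have hxS : IndepFun (fun ω (i : Fin n) (k : ℕ) => truncSample x₀ P.K T ξ (t + 1) i k ω)
      (truncSet T S t) μ := by
    refine h.indepFun_of_disjoint (I := Set.range Sum.inl) (J := Set.range Sum.inr)
      Set.isCompl_range_inl_range_inr.disjoint (hx fun _ _ _ => ⟨_, rfl⟩)
      (measurable_truncSet fun _ => ⟨_, rfl⟩)
  have hZxS := h.indepFun_of_disjoint (disjoint_past_present n P.K T t) hZ (hxp.prodMk hSp)
  refine meanLE_step (hSp.mono (h.infoAlg_le _) le_rfl) (hxp.mono (h.infoAlg_le _) le_rfl)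
    (hZ.mono (h.infoAlg_le _) le_rfl) hlaw hxS hZxS
    (Φ := fun A x s => Φ (augRound F P A x s)) (hΦ.comp (measurable_augRound_joint hF))
    (fun _ _ _ => hΦ0 _) (fun ω' => hb _ (augProcess_c _ _ t ω')) hbi

/-- The initial control error. -/
lemma meanLE_ctrlErr_zero (h : Sampling μ D P.m P.K T ξ S) (hF : WellPosed F D)
    (hg : StochasticGradient F D σu σv) (hf : JointSmooth (localLoss F D) L) (hn : 1 ≤ n)
    (hK : 1 ≤ P.K) (x₀ : Ξ) :
    MeanLE μ (fun ω => ctrlErr F D P.K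
        (augProcess F P u₀ v₀ (truncSample x₀ P.K T ξ) (truncSet T S) 0 ω))
      (σu ^ 2 / P.K) := by
  have hn0 : (n : ℝ) ≠ 0 := by exact_mod_cast (by omega : n ≠ 0)
  have hK0 : (0 : ℝ) < P.K := by exact_mod_cast hK
  have key : ∀ i, MeanLE μ (fun ω => ‖(1 / (P.K : ℝ)) • ∑ k ∈ Finset.range P.K,
      noiseU F D i (u₀, v₀ i) (truncSample x₀ P.K T ξ 0 i k ω)‖ ^ 2) (σu ^ 2 / P.K) := by
    intro i
    have hfr := h.freshSamples x₀ (Nat.zero_le T) i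
    have hno := hg.isNoise_noiseU hF hf i
    have hp : ∀ k, Measurable[infoAlg ξ S (roundIdx P.K T 0 i k)]
        fun _ : Ω => ((u₀, v₀ i) : Vec du × Vec dv) := fun k => measurable_const
    refine meanLE_sq ((memLp_sum _ fun k hk => hfr.memLp_noise hno hp
      (Finset.mem_range.1 hk)).const_smul (1 / (P.K : ℝ))) ?_
    refine (sqMean_smul _ _).trans_le ?_
    calc _ ≤ (1 / (P.K : ℝ)) ^ 2 * (P.K * σu ^ 2) := by
          gcongr
          exact hfr.sqMean_sum_noise_le hno hp le_rfl
      _ = _ := by field_simp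
  have h1 := MeanLE.const_mul (r := 1 / (n : ℝ)) (by positivity)
    (MeanLE.sum (s := Finset.univ) fun i _ => key i)
  have e : (fun ω => ctrlErr F D P.K
      (augProcess F P u₀ v₀ (truncSample x₀ P.K T ξ) (truncSet T S) 0 ω))
      = fun ω => (1 / (n : ℝ)) * ∑ i, ‖(1 / (P.K : ℝ)) • ∑ k ∈ Finset.range P.K,
        noiseU F D i (u₀, v₀ i) (truncSample x₀ P.K T ξ 0 i k ω)‖ ^ 2 := by
    funext ω
    simp only [ctrlErr, augProcess, initState, avgGradU, tmean, ← smul_sub,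
      ← Finset.sum_sub_distrib, noiseU]
  rw [e]
  refine h1.mono (le_of_eq ?_)
  simp only [Finset.sum_const, Finset.card_univ, Fintype.card_fin, nsmul_eq_mul]
  field_simp

/-- The control error stays bounded. -/
lemma meanLE_ctrlErr (h : Sampling μ D P.m P.K T ξ S) (hF : WellPosed F D)
    (hg : StochasticGradient F D σu σv) (hf : JointSmooth (localLoss F D) L) (hm : 1 ≤ P.m)
    (hmn : P.m ≤ n) (hK : 1 ≤ P.K) (hγ : P.γu ≠ 0) (x₀ : Ξ) :
    ∀ {t : ℕ}, t ≤ T → MeanLE μ (fun ω => ctrlErr F D P.K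
        (augProcess F P u₀ v₀ (truncSample x₀ P.K T ξ) (truncSet T S) t ω)) (σu ^ 2 / P.K)
  | 0, _ => h.meanLE_ctrlErr_zero hF hg hf (hm.trans hmn) hK x₀
  | t + 1, ht => by
    have ih := h.meanLE_ctrlErr hF hg hf hm hmn hK hγ x₀ ((Nat.le_succ t).trans ht)
    have hn0 : (0 : ℝ) < n := by exact_mod_cast hm.trans hmn
    have hp1 : (P.m : ℝ) / n ≤ 1 := by rw [div_le_one hn0]; exact_mod_cast hmn
    have hb := (MeanLE.const (μ := μ) ((P.m : ℝ) / n * (σu ^ 2 / P.K))).add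
      (ih.const_mul (sub_nonneg.2 hp1))
    refine (h.meanLE_augProcess_succ hF x₀ ht (hf.measurable_ctrlErr P.K)
      (fun s => by unfold ctrlErr; positivity)
      (fun s _ => (h.roundRun hF hg hf x₀ ht).upperMean_ctrlErr hm hmn hK hγ s) hb.1).mono ?_
    -- The bound `σu ^ 2 / K` is a fixed point of the recursion, which mixes it with the old error
    -- with weights `m/n` and `1 - m/n`.
    exact hb.2.trans (le_of_eq (by ring))

end Sampling

end AugProcess

end ScaffoldP

end

noncomputable section

set_option linter.unusedSectionVars false

namespace ScaffoldP

/-! ### Convergence -/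

section Convergence

variable {n du dv : ℕ} {Ξ Ω : Type*} [MeasurableSpace Ξ] [mΩ : MeasurableSpace Ω]
  {F : Vec du → Vec dv → Ξ → ℝ} {P : Params} {u₀ : Vec du} {v₀ : Fin n → Vec dv}
  {μ : Measure Ω} [IsProbabilityMeasure μ] {D : Fin n → Measure Ξ}
  [∀ i, IsProbabilityMeasure (D i)] {T : ℕ} {ξ : ℕ → Fin n → ℕ → Ω → Ξ}
  {S : ℕ → Ω → Finset (Fin n)} {L σu σv : ℝ}

/-- The squared gradient controlled by the descent. -/
def progress (F : Vec du → Vec dv → Ξ → ℝ) (D : Fin n → Measure Ξ) (m : ℕ)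
    (s : State n du dv) : ℝ :=
  sqGradU F D s + (m : ℝ) / n * ((1 / (n : ℝ)) * ∑ i, sqGradV F D i s)

lemma progress_nonneg (m : ℕ) (s : State n du dv) : 0 ≤ progress F D m s := by
  unfold progress sqGradU sqGradV
  positivity

lemma JointSmooth.measurable_progress (hf : JointSmooth (localLoss F D) L) (m : ℕ) :
    Measurable fun s : AugState n du dv => progress F D m s.1 :=
  hf.measurable_sqGradU.add
    (((Finset.measurable_fun_sum _ fun i _ => hf.measurable_sqGradV i).const_mul _).const_mul _)

lemma potential_sub_iInf_nonneg
    (hbdd : BddBelow (Set.range fun p : Vec du × (Fin n → Vec dv) => globalLoss F D p.1 p.2))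
    (K : ℕ) {lam : ℝ} (hlam : 0 ≤ lam) (s : AugState n du dv) :
    0 ≤ potential F D K lam s - ⨅ p : Vec du × (Fin n → Vec dv), globalLoss F D p.1 p.2 := by
  have h1 := ciInf_le hbdd (s.1.u, s.1.v)
  have h2 := mul_nonneg hlam (lag_nonneg K s.1.u s.1.v s.2)
  unfold potential
  linarith

/-- All remembered points start at `(u₀, v₀ i)`, so the initial lag vanishes and the potential
contributes nothing beyond the objective. -/
lemma potential_augProcess_zero (K : ℕ) (lam : ℝ) (ω : Ω) :
    potential F D K lam (augProcess F P u₀ v₀ ξ S 0 ω) = globalLoss F D u₀ v₀ := by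
  simp [potential, augProcess, initState, lag, dmean]

/-- The summed mean squared gradients, from the decrease of the potential. -/
lemma Sampling.sum_progress_le (h : Sampling μ D P.m P.K T ξ S) (hF : WellPosed F D)
    (hg : StochasticGradient F D σu σv) (hf : JointSmooth (localLoss F D) L) (hm : 1 ≤ P.m)
    (hmn : P.m ≤ n) (hK : 1 ≤ P.K)
    (hbdd : BddBelow (Set.range fun p : Vec du × (Fin n → Vec dv) => globalLoss F D p.1 p.2))
    {γ : ℝ} (hγ : 0 < γ) (hγu : γ = P.γu * P.ηu) (hγv : γ = P.γv * P.ηv)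
    (ha : P.γu ^ 2 ≤ 1 / (P.m : ℝ) * γ ^ 2) (hb : P.γv ^ 2 ≤ (P.m : ℝ) / n * γ ^ 2)
    (hθ1 : L * (γ * P.K) ≤ 1 / 72) (hθ2 : (L * (γ * P.K)) ^ 2 * n ≤ (P.m : ℝ) ^ 2 / 5184)
    (hθ3 : (L * (γ * P.K)) ^ 3 * (n : ℝ) ^ 2 ≤ (P.m : ℝ) ^ 3 / 373248) (x₀ : Ξ) :
    (∀ t < T, Integrable (fun ω => progress F D P.m
      (augProcess F P u₀ v₀ (truncSample x₀ P.K T ξ) (truncSet T S) t ω).1) μ) ∧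
    γ * P.K / 4 * ∑ t ∈ Finset.range T, ∫ ω, progress F D P.m
      (augProcess F P u₀ v₀ (truncSample x₀ P.K T ξ) (truncSet T S) t ω).1 ∂μ ≤
      initialGap F D u₀ v₀ + T * (γ * P.K * (L * (γ * P.K)) *
        (35 * (1 / (P.m : ℝ) * (σu ^ 2 / P.K) + (P.m : ℝ) / n * (σv ^ 2 / P.K)))) := by
  have hL := hf.nonneg
  have hK0 : (0 : ℝ) < P.K := by exact_mod_cast hK
  have hm0 : (0 : ℝ) < P.m := by exact_mod_cast hm
  have hγu0 : P.γu ≠ 0 := fun h0 => hγ.ne' (by rw [hγu, h0, zero_mul])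
  set lam := 30 * L ^ 3 * (γ * P.K) ^ 2 * n / (P.m : ℝ) ^ 2 with hlam
  have hlam0 : 0 ≤ lam := by positivity
  set B := γ * P.K with hB
  have hB0 : 0 < B := by positivity
  set I := ⨅ p : Vec du × (Fin n → Vec dv), globalLoss F D p.1 p.2 with hI
  set Q := 1 / (P.m : ℝ) * (σu ^ 2 / P.K) + (P.m : ℝ) / n * (σv ^ 2 / P.K) with hQ
  let Z : ℕ → Ω → AugState n du dv :=
    augProcess F P u₀ v₀ (truncSample x₀ P.K T ξ) (truncSet T S)
  -- Subtracting the infimum makes the potential nonnegative, as `meanLE_step` requires.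
  let V : AugState n du dv → ℝ := fun s => potential F D P.K lam s - I
  have hV0 : ∀ s, 0 ≤ V s := potential_sub_iInf_nonneg hbdd P.K hlam0
  have hVm : Measurable V := (hf.measurable_potential P.K lam).sub_const I
  let b : AugState n du dv → ℝ := fun s => V s - B / 4 * progress F D P.m s.1
    + B * (L * B) * (20 * Q + 15 * (1 / (P.m : ℝ) * ctrlErr F D P.K s))
  have hUM : ∀ t < T, ∀ s : AugState n du dv, s.1.c = vmean s.1.ci →
      UpperMean μ (fun ω => subsetAvg P.m fun A =>
        V (augRound F P A (fun i k => truncSample x₀ P.K T ξ (t + 1) i k ω) s)) (b s) := by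
    intro t ht s hc
    have h1 := (h.roundRun hF hg hf x₀ (Nat.succ_le_of_lt ht)).upperMean_potential hm hmn hK hγ
      hγu hγv ha hb hθ1 hθ2 hθ3 s hc
    refine ((h1.add (UpperMean.const (-I))).of_le fun ω => le_of_eq ?_).mono (le_of_eq ?_)
    · simp only [V]
      rw [subsetAvg_sub, subsetAvg_const hmn, sub_eq_add_neg]
    · simp only [b, V, progress]
      ring
  have hstep : ∀ t < T, Integrable (fun ω => V (Z t ω)) μ →
      Integrable (fun ω => progress F D P.m (Z t ω).1) μ ∧
      MeanLE μ (fun ω => V (Z (t + 1) ω)) (∫ ω, V (Z t ω) ∂μ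
        - B / 4 * ∫ ω, progress F D P.m (Z t ω).1 ∂μ + B * (L * B) * (35 * Q)) := by
    intro t ht hVi
    obtain ⟨hCi, hCb⟩ := h.meanLE_ctrlErr hF hg hf hm hmn hK hγu0 (u₀ := u₀) (v₀ := v₀) x₀ ht.le
    have hZm : Measurable (Z t) := (measurable_augProcess hF x₀ t).mono (h.infoAlg_le _) le_rfl
    have hNi : Integrable (fun ω => 15 * (1 / (P.m : ℝ) * ctrlErr F D P.K (Z t ω))) μ :=
      (hCi.const_mul _).const_mul _
    have hEi : Integrable (fun ω => B * (L * B) * (20 * Q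
        + 15 * (1 / (P.m : ℝ) * ctrlErr F D P.K (Z t ω)))) μ :=
      ((integrable_const (20 * Q)).add hNi).const_mul _
    have hRi : Integrable (fun ω => V (Z t ω) + B * (L * B) * (20 * Q
        + 15 * (1 / (P.m : ℝ) * ctrlErr F D P.K (Z t ω)))) μ := hVi.add hEi
    -- Nonnegativity of `b` bounds `B / 4` times the squared gradients pointwise by the potential
    -- and the control error, both already integrable. This is how finiteness of the gradient
    -- expectations is obtained.
    have hb0 : ∀ ω, 0 ≤ b (Z t ω) := fun ω =>
      (hUM t ht _ (augProcess_c _ _ t ω)).nonneg fun _ => subsetAvg_nonneg fun _ => hV0 _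
    have hGi : Integrable (fun ω => progress F D P.m (Z t ω).1) μ := by
      refine (hRi.const_mul (4 / B)).mono'
        ((hf.measurable_progress P.m).comp hZm).aestronglyMeasurable
        (Filter.Eventually.of_forall fun ω => ?_)
      rw [Real.norm_of_nonneg (progress_nonneg _ _)]
      have h1 := hb0 ω
      simp only [b] at h1
      rw [div_mul_eq_mul_div, le_div_iff₀ hB0]
      linarith
    have hbi : Integrable (fun ω => b (Z t ω)) μ := by
      refine (hRi.sub (hGi.const_mul (B / 4))).congr (Filter.Eventually.of_forall fun ω => ?_)
      simp only [b, Pi.sub_apply]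
      ring
    refine ⟨hGi, (h.meanLE_augProcess_succ hF x₀ ht hVm hV0 (hUM t ht) hbi).mono ?_⟩
    have e1 : ∫ ω, b (Z t ω) ∂μ = ∫ ω, V (Z t ω) ∂μ - B / 4 * ∫ ω, progress F D P.m (Z t ω).1 ∂μ
        + B * (L * B) * (20 * Q + 15 * (1 / (P.m : ℝ) * ∫ ω, ctrlErr F D P.K (Z t ω) ∂μ)) := by
      have hVG : Integrable (fun ω => V (Z t ω) - B / 4 * progress F D P.m (Z t ω).1) μ :=
        hVi.sub (hGi.const_mul (B / 4))
      simp only [b]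
      rw [integral_add hVG hEi, integral_sub hVi (hGi.const_mul (B / 4)), integral_const_mul,
        integral_const_mul, integral_add (integrable_const _) hNi, integral_const_mul,
        integral_const_mul, integral_const_mul, integral_const, probReal_univ, one_smul]
    -- The stored noise has the same bound as fresh noise, so `20 Q + 15 Q` gives the constant `35`.
    have e2 : 1 / (P.m : ℝ) * ∫ ω, ctrlErr F D P.K (Z t ω) ∂μ ≤ Q := by
      have h1 : 1 / (P.m : ℝ) * ∫ ω, ctrlErr F D P.K (Z t ω) ∂μ
          ≤ 1 / (P.m : ℝ) * (σu ^ 2 / P.K) := by gcongr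
      have h2 : 0 ≤ (P.m : ℝ) / n * (σv ^ 2 / P.K) := by positivity
      linarith
    rw [e1]
    have e3 : B * (L * B) * (20 * Q + 15 * (1 / (P.m : ℝ) * ∫ ω, ctrlErr F D P.K (Z t ω) ∂μ))
        ≤ B * (L * B) * (35 * Q) := by
      gcongr
      linarith
    linarith
  have hind : ∀ t ≤ T, Integrable (fun ω => V (Z t ω)) μ ∧
      ∫ ω, V (Z t ω) ∂μ + B / 4 * ∑ r ∈ Finset.range t, ∫ ω, progress F D P.m (Z r ω).1 ∂μ
        ≤ initialGap F D u₀ v₀ + t * (B * (L * B) * (35 * Q)) := by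
    intro t
    induction t with
    | zero =>
      intro _
      have e : (fun ω => V (Z 0 ω)) = fun _ => initialGap F D u₀ v₀ := by
        funext ω
        simp only [V, Z, potential_augProcess_zero, initialGap, hI]
      rw [e]
      exact ⟨integrable_const _, by simp⟩
    | succ t ih =>
      intro ht
      obtain ⟨i1, i2⟩ := ih (by omega)
      obtain ⟨-, i3, i4⟩ := hstep t ht i1
      refine ⟨i3, ?_⟩
      rw [Finset.sum_range_succ]
      push_cast
      linarith
  refine ⟨fun t ht => (hstep t ht (hind t ht.le).1).1, ?_⟩
  have h1 := (hind T le_rfl).2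
  have h2 : 0 ≤ ∫ ω, V (Z T ω) ∂μ := integral_nonneg fun ω => hV0 _
  linarith

/-- The step size condition in polynomial form. -/
lemma stepsize_le {n m : ℕ} (hn : 1 ≤ n) {θ : ℝ} (hθ0 : 0 ≤ θ)
    (hθ : 72 * θ ≤ min ((m : ℝ) / (n : ℝ) ^ ((2 : ℝ) / 3)) 1) :
    θ ≤ 1 / 72 ∧ θ ^ 2 * n ≤ (m : ℝ) ^ 2 / 5184 ∧ θ ^ 3 * (n : ℝ) ^ 2 ≤ (m : ℝ) ^ 3 / 373248 := by
  have hn1 : (1 : ℝ) ≤ n := by exact_mod_cast hn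
  have hn0 : (0 : ℝ) < n := by linarith
  set q : ℝ := (n : ℝ) ^ ((2 : ℝ) / 3) with hq
  have hq0 : 0 < q := by positivity
  have h1 : 72 * θ ≤ 1 := hθ.trans (min_le_right _ _)
  have h2 : 72 * θ * q ≤ m := (le_div_iff₀ hq0).1 (hθ.trans (min_le_left _ _))
  have hq3 : q ^ 3 = (n : ℝ) ^ 2 := by
    rw [hq, ← Real.rpow_natCast, ← Real.rpow_mul hn0.le, ← Real.rpow_natCast]
    norm_num
  -- Here `q ^ 2 = n ^ (4/3)` and `n ≥ 1`, so the quadratic condition follows with room to spare,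
  -- whereas the cubic one is exact through `q ^ 3 = n ^ 2`.
  have hq2 : (n : ℝ) ≤ q ^ 2 := by
    rw [hq, ← Real.rpow_natCast, ← Real.rpow_mul hn0.le]
    calc (n : ℝ) = (n : ℝ) ^ (1 : ℝ) := (Real.rpow_one _).symm
      _ ≤ _ := Real.rpow_le_rpow_of_exponent_le hn1 (by norm_num)
  have h3 : (72 * θ * q) ^ 2 ≤ (m : ℝ) ^ 2 := by gcongr
  have h4 : (72 * θ * q) ^ 3 ≤ (m : ℝ) ^ 3 := by gcongr
  have h5 : θ ^ 2 * n ≤ θ ^ 2 * q ^ 2 := by gcongr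
  refine ⟨by linarith, ?_, ?_⟩
  · have : (72 * θ * q) ^ 2 = 5184 * (θ ^ 2 * q ^ 2) := by ring
    linarith
  · have : (72 * θ * q) ^ 3 = 373248 * (θ ^ 3 * q ^ 3) := by ring
    rw [hq3] at this
    linarith

end Convergence

end ScaffoldP

end

/-! ### Assembly: step sizes, integrability and the final constants -/

theorem mainTheorem4
    {n du dv : ℕ} {Ω Ξ : Type*} [MeasurableSpace Ω] [MeasurableSpace Ξ]
    (μ : Measure Ω) [IsProbabilityMeasure μ]
    (F : ScaffoldP.Vec du → ScaffoldP.Vec dv → Ξ → ℝ)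
    (D : Fin n → Measure Ξ) [∀ i, IsProbabilityMeasure (D i)]
    (P : ScaffoldP.Params) (T : ℕ)
    (u₀ : ScaffoldP.Vec du) (v₀ : Fin n → ScaffoldP.Vec dv)
    (ξ : ℕ → Fin n → ℕ → Ω → Ξ) (S : ℕ → Ω → Finset (Fin n))
    (Lu Luv Lv Lvu : ℝ≥0) (L σu σv γ : ℝ)
    (hK : 1 ≤ P.K) (hm : 1 ≤ P.m) (hmn : P.m ≤ n) (hT : 1 ≤ T)
    -- the problem
    (hF : ScaffoldP.WellPosed F D)
    (hbdd : BddBelow (Set.range fun p : ScaffoldP.Vec du × (Fin n → ScaffoldP.Vec dv) =>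
      ScaffoldP.globalLoss F D p.1 p.2))
    (hsmooth : ScaffoldP.Smooth (ScaffoldP.localLoss F D) Lu Luv Lv Lvu)
    (hL : L = max (max (Lu : ℝ) Lv) (max (Luv : ℝ) Lvu))
    (hgrad : ScaffoldP.StochasticGradient F D σu σv)
    -- the randomness of the algorithm
    (hsamp : ScaffoldP.Sampling μ D P.m P.K T ξ S)
    -- the step sizes
    (hγu : 0 < P.γu) (hγv : 0 < P.γv)
    (hγ_u : γ = P.γu * P.ηu) (hγ_v : γ = P.γv * P.ηv)
    (hηu : √(P.m : ℝ) ≤ P.ηu) (hηv : √((n : ℝ) / (P.m : ℝ)) ≤ P.ηv)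
    -- `γ ≤ (1 / (72 L K)) min(m / n^{2/3}, 1)`, read as no restriction when `L = 0`
    (hγ : 72 * L * (P.K : ℝ) * γ ≤ min ((P.m : ℝ) / (n : ℝ) ^ ((2 : ℝ) / 3)) 1) :
    -- the expectations below are those of integrable functions
    (∀ t < T, Integrable
      (fun ω => ScaffoldP.sqGradU F D (ScaffoldP.process F P u₀ v₀ ξ S t ω)) μ) ∧
    (∀ t < T, ∀ i, Integrable
      (fun ω => ScaffoldP.sqGradV F D i (ScaffoldP.process F P u₀ v₀ ξ S t ω)) μ) ∧
    (1 / (T : ℝ)) * ∑ t ∈ Finset.range T,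
        ((∫ ω, ScaffoldP.sqGradU F D (ScaffoldP.process F P u₀ v₀ ξ S t ω) ∂μ) +
          ((P.m : ℝ) / (n : ℝ) ^ 2) * ∑ i,
            ∫ ω, ScaffoldP.sqGradV F D i (ScaffoldP.process F P u₀ v₀ ξ S t ω) ∂μ) ≤
      4 * ScaffoldP.initialGap F D u₀ v₀ / ((T : ℝ) * (P.K : ℝ) * γ) +
        148 * (σu ^ 2 / (P.m : ℝ) + (P.m : ℝ) * σv ^ 2 / (n : ℝ)) * L * γ := by
  have hn : 1 ≤ n := hm.trans hmn
  have hn0 : (0 : ℝ) < n := by exact_mod_cast hn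
  have hm0 : (0 : ℝ) < P.m := by exact_mod_cast hm
  have hK0 : (0 : ℝ) < P.K := by exact_mod_cast hK
  have hT0 : (0 : ℝ) < T := by exact_mod_cast hT
  have hf := hsmooth.jointSmooth
  rw [← hL] at hf
  have hL0 := hf.nonneg
  have hηu0 : 0 < P.ηu := (Real.sqrt_pos.2 hm0).trans_le hηu
  have hγ0 : 0 < γ := hγ_u ▸ mul_pos hγu hηu0
  have hηu2 : (P.m : ℝ) ≤ P.ηu ^ 2 := (Real.sqrt_le_left hηu0.le).1 hηu
  have hηv2 : (n : ℝ) / P.m ≤ P.ηv ^ 2 :=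
    (Real.sqrt_le_left ((Real.sqrt_nonneg _).trans hηv)).1 hηv
  -- The lower bounds on the outer step sizes make the inner steps short relative to `γ`; this puts
  -- the factors `1 / m` and `m / n` on the drift.
  have ha : P.γu ^ 2 ≤ 1 / (P.m : ℝ) * γ ^ 2 := by
    rw [hγ_u, mul_pow, one_div, ← div_eq_inv_mul, le_div_iff₀ hm0]
    gcongr
  have hb : P.γv ^ 2 ≤ (P.m : ℝ) / n * γ ^ 2 := by
    rw [hγ_v, mul_pow, ← inv_div, ← div_eq_inv_mul, le_div_iff₀ (by positivity)]
    gcongr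
  obtain ⟨hθ1, hθ2, hθ3⟩ := ScaffoldP.stepsize_le (m := P.m) hn (θ := L * (γ * P.K))
    (by positivity) (le_of_eq_of_le (by ring) hγ)
  -- Any point of the data space serves as the constant continuing the samples; one exists because
  -- some `D i` has mass one.
  obtain ⟨x₀⟩ := nonempty_of_isProbabilityMeasure (D ⟨0, hn⟩)
  obtain ⟨hi, hs⟩ := hsamp.sum_progress_le hF hgrad hf hm hmn hK hbdd hγ0 hγ_u hγ_v ha hb hθ1 hθ2
    hθ3 x₀ (u₀ := u₀) (v₀ := v₀)
  have hfst : ∀ t ≤ T, ∀ ω, (ScaffoldP.augProcess F P u₀ v₀ (ScaffoldP.truncSample x₀ P.K T ξ)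
      (ScaffoldP.truncSet T S) t ω).1 = ScaffoldP.process F P u₀ v₀ ξ S t ω :=
    fun t ht ω => ScaffoldP.fst_augProcess x₀ ξ S ω ht
  have hmeas : ∀ t, Measurable (ScaffoldP.augProcess F P u₀ v₀ (ScaffoldP.truncSample x₀ P.K T ξ)
      (ScaffoldP.truncSet T S) t) := fun t =>
    (ScaffoldP.measurable_augProcess hF x₀ t).mono (hsamp.infoAlg_le _) le_rfl
  have hiu : ∀ t < T, Integrable
      (fun ω => ScaffoldP.sqGradU F D (ScaffoldP.process F P u₀ v₀ ξ S t ω)) μ := by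
    intro t ht
    simp only [← hfst t ht.le]
    refine (hi t ht).mono' (hf.measurable_sqGradU.comp (hmeas t)).aestronglyMeasurable
      (Filter.Eventually.of_forall fun ω => ?_)
    unfold ScaffoldP.progress ScaffoldP.sqGradU ScaffoldP.sqGradV
    rw [Real.norm_of_nonneg (by positivity)]
    exact le_add_of_nonneg_right (by positivity)
  have hiv : ∀ t < T, ∀ i, Integrable
      (fun ω => ScaffoldP.sqGradV F D i (ScaffoldP.process F P u₀ v₀ ξ S t ω)) μ := by
    intro t ht i
    simp only [← hfst t ht.le]
    refine ((hi t ht).const_mul (n ^ 2 / (P.m : ℝ))).mono'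
      ((hf.measurable_sqGradV i).comp (hmeas t)).aestronglyMeasurable
      (Filter.Eventually.of_forall fun ω => ?_)
    unfold ScaffoldP.progress
    set s := (ScaffoldP.augProcess F P u₀ v₀ (ScaffoldP.truncSample x₀ P.K T ξ)
      (ScaffoldP.truncSet T S) t ω).1
    have h0 : ∀ j, 0 ≤ ScaffoldP.sqGradV F D j s := fun j => sq_nonneg _
    have h1 := Finset.single_le_sum (fun j _ => h0 j) (Finset.mem_univ i)
    have h2 : 0 ≤ n ^ 2 / (P.m : ℝ) * ScaffoldP.sqGradU F D s :=
      mul_nonneg (by positivity) (sq_nonneg _)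
    rw [Real.norm_of_nonneg (h0 i), mul_add]
    have h3 : (n : ℝ) ^ 2 / P.m * ((P.m : ℝ) / n
        * (1 / (n : ℝ) * ∑ j, ScaffoldP.sqGradV F D j s)) = ∑ j, ScaffoldP.sqGradV F D j s := by
      field_simp
    linarith
  refine ⟨hiu, hiv, ?_⟩
  have hG : ∀ t ∈ Finset.range T, ∫ ω, ScaffoldP.progress F D P.m (ScaffoldP.augProcess F P u₀ v₀
      (ScaffoldP.truncSample x₀ P.K T ξ) (ScaffoldP.truncSet T S) t ω).1 ∂μ
      = (∫ ω, ScaffoldP.sqGradU F D (ScaffoldP.process F P u₀ v₀ ξ S t ω) ∂μ) +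
          ((P.m : ℝ) / (n : ℝ) ^ 2) * ∑ i,
            ∫ ω, ScaffoldP.sqGradV F D i (ScaffoldP.process F P u₀ v₀ ξ S t ω) ∂μ := by
    intro t ht
    have ht := Finset.mem_range.1 ht
    simp only [hfst t ht.le, ScaffoldP.progress]
    rw [integral_add (hiu t ht)
      (((integrable_finsetSum _ fun i _ => hiv t ht i).const_mul _).const_mul _),
      integral_const_mul, integral_const_mul, integral_finsetSum _ fun i _ => hiv t ht i]
    congr 1
    field_simp
  rw [Finset.sum_congr rfl hG] at hs
  set G := ∑ t ∈ Finset.range T,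
        ((∫ ω, ScaffoldP.sqGradU F D (ScaffoldP.process F P u₀ v₀ ξ S t ω) ∂μ) +
          ((P.m : ℝ) / (n : ℝ) ^ 2) * ∑ i,
            ∫ ω, ScaffoldP.sqGradV F D i (ScaffoldP.process F P u₀ v₀ ξ S t ω) ∂μ)
  have hQ : 0 ≤ (σu ^ 2 / (P.m : ℝ) + (P.m : ℝ) * σv ^ 2 / (n : ℝ)) * L * γ := by positivity
  calc 1 / (T : ℝ) * G = 4 / (T * P.K * γ) * (γ * P.K / 4 * G) := by field_simp
    _ ≤ 4 / (T * P.K * γ) * (ScaffoldP.initialGap F D u₀ v₀ + T * (γ * P.K * (L * (γ * P.K)) *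
        (35 * (1 / (P.m : ℝ) * (σu ^ 2 / P.K) + (P.m : ℝ) / n * (σv ^ 2 / P.K))))) := by gcongr
    _ = 4 * ScaffoldP.initialGap F D u₀ v₀ / ((T : ℝ) * (P.K : ℝ) * γ) +
        140 * ((σu ^ 2 / (P.m : ℝ) + (P.m : ℝ) * σv ^ 2 / (n : ℝ)) * L * γ) := by
      field_simp
      ring
    -- Multiplying by `4` turns `35` into `140`, so the stated `148` leaves some slack.
    _ ≤ _ := by linarith
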